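/- Let $k$ be an algebraically closed field of characteristic $\neq 2$. All curves are complete nonsingular curves over $k$; for square-free $f\in k[x]$ of degree $2h+1$ or $2h+2$ ($h\ge 1$), "the curve $y^2=f(x)$ of genus $h$" means the complete nonsingular model, with its double cover $\pi\colon (x,y)\mapsto x$ of $\mathbb{P}^1$ (for $h\ge 2$ this is a hyperelliptic curve of genus $h$). A curve is called a generalized Howe curve if it is isomorphic over $k$ to the normalization of the fiber product $C_1\times_{\mathbb{P}^1}C_2$ of two curves $$C_1\colon y_1^2=\prod_{i=1}^{r}(x-a_i)\prod_{i=1}^{2g_1+2-r}(x-b_i),\qquad C_2\colon y_2^2=\prod_{i=1}^{r}(x-a_i)\prod_{i=1}^{2g_2+2-r}(x-c_i)$$ of genera $1\le g_1\le g_2$, where $a_i,b_i,c_i\in k$ are all distinct and there is no isomorphism $\varphi\colon C_1\to C_2$ with $\pi_2\circ\varphi=\pi_1$. Let $C$ be a hyperelliptic curve of genus $g\ge 2$ over $k$. Then $C$ is a generalized Howe curve if and only if $\mathrm{Aut}(C)$ contains a subgroup isomorphic to $V_4=\mathbb{Z}/2\mathbb{Z}\times\mathbb{Z}/2\mathbb{Z}$.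 In this case there is a square-free polynomial $f\in k[x]$ of degree $g+1$ with $f(0)\neq 0$ such that $C$ is birational over $k$ to $C_1\times_{\mathbb{P}^1}C_2$, where $C_1\colon y^2=f(x)$ has genus $g_1\ge 1$ and $C_2\colon y^2=xf(x)$ has genus $g_2\geq 1$, with $g_1=g_2$ if $g$ is even and $g_2=g_1+1$ if $g$ is odd. -/

import Mathlib

open CategoryTheory CategoryTheory.Limits AlgebraicGeometry Polynomial

attribute [local instance] MvPolynomial.gradedAlgebra

universe u

noncomputable section

namespace HoweCurve

/-- The projective line over `k`, as `Proj k[X₀, X₁]` with the standard grading. -/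
def P1 (k : Type u) [Field k] : Scheme.{u} :=
  Proj (MvPolynomial.homogeneousSubmodule (Fin 2) k)

instance (k : Type u) [Field k] : (P1 k).IsSeparated :=
  inferInstanceAs (Proj (MvPolynomial.homogeneousSubmodule (Fin 2) k)).IsSeparated

/-- The structure morphism `ℙ¹ ⟶ Spec k`. -/
def P1.toSpec (k : Type u) [Field k] : P1 k ⟶ Spec (.of k) :=
  Proj.toSpecZero (MvPolynomial.homogeneousSubmodule (Fin 2) k) ≫
    Spec.map (CommRingCat.ofHom
      (algebraMap k (MvPolynomial.homogeneousSubmodule (Fin 2) k 0)))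

/-- The homogeneous coordinates `[x : 1]` on the affine line: `X₀ ↦ x`, `X₁ ↦ 1`. -/
def lineCoords (k : Type u) [Field k] :
    MvPolynomial (Fin 2) k →+* Γ(Spec (.of k[X]), ⊤) :=
  (Scheme.ΓSpecIso (.of k[X])).inv.hom.comp
    (MvPolynomial.aeval ![(X : k[X]), 1]).toRingHom

lemma lineCoords_irrelevant (k : Type u) [Field k] :
    (HomogeneousIdeal.irrelevant (MvPolynomial.homogeneousSubmodule (Fin 2) k)).toIdeal.map
      (lineCoords k) = ⊤ := by
  refine (Ideal.eq_top_iff_one _).2 ?_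
  have h : lineCoords k (MvPolynomial.X 1) = 1 := by
    simp [lineCoords]
  rw [← h]
  exact Ideal.mem_map_of_mem _ (HomogeneousIdeal.mem_irrelevant_of_mem
    (MvPolynomial.homogeneousSubmodule (Fin 2) k) one_pos (MvPolynomial.isHomogeneous_X k 1))

/-- The standard affine chart `𝔸¹ = Spec k[x] ⟶ ℙ¹`, `x ↦ [x : 1]`. -/
def lineChart (k : Type u) [Field k] : Spec (.of k[X]) ⟶ P1 k :=
  Proj.fromOfGlobalSections _ (lineCoords k) (lineCoords_irrelevant k)

variable {k : Type u} [Field k]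

/-- The coordinate ring `k[x][y] / (y² - f(x))`. -/
abbrev affineRing (f : k[X]) : Type u := AdjoinRoot ((X : k[X][X]) ^ 2 - C f)

/-- The map `(x, y) ↦ [x : 1]` from the affine curve `y² = f(x)` to `ℙ¹`. -/
def affineCover (f : k[X]) : Spec (.of (affineRing f)) ⟶ P1 k :=
  Spec.map (CommRingCat.ofHom (AdjoinRoot.of ((X : k[X][X]) ^ 2 - C f))) ≫ lineChart k

lemma isAffineHom_to_separated {S T : Scheme.{u}} [IsAffine S] [T.IsSeparated] (h : S ⟶ T) :
    IsAffineHom h :=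
  have : IsAffineHom (h ≫ terminal.from T) := inferInstance
  IsAffineHom.of_comp h (terminal.from T)

instance (f : k[X]) : IsAffineHom (affineCover f) := isAffineHom_to_separated _

/-- The complete nonsingular curve `y² = f(x)` (for `f` square-free and nonconstant, `2 ≠ 0`):
the normalization of `ℙ¹` in the affine curve `y² = f(x)`. Over `𝔸¹` it is that affine curve,
and the points at infinity are added by integral closure. -/
def curve (f : k[X]) : Scheme.{u} := (affineCover f).normalization

/-- The double cover of `ℙ¹` by the complete curve `y² = f(x)`, extending `(x, y) ↦ [x : 1]`. -/
def cover (f : k[X]) : curve f ⟶ P1 k := (affineCover f).fromNormalization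

instance (f : k[X]) : IsIntegralHom (cover f) :=
  inferInstanceAs (IsIntegralHom (affineCover f).fromNormalization)

/-- The complete curve `y² = f(x)` as a `k`-scheme. -/
def curveOver (f : k[X]) : Over (Spec (.of k)) := Over.mk (cover f ≫ P1.toSpec k)

/-- The fiber product over `ℙ¹` of the complete curves `y₁² = f₁(x)` and `y₂² = f₂(x)`. -/
def fiberProduct (f₁ f₂ : k[X]) : Scheme.{u} := pullback (cover f₁) (cover f₂)

/-- The projection of the fiber product to `ℙ¹`. -/
def fiberProductCover (f₁ f₂ : k[X]) : fiberProduct f₁ f₂ ⟶ P1 k :=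
  pullback.fst (cover f₁) (cover f₂) ≫ cover f₁

instance (f₁ f₂ : k[X]) : (fiberProduct f₁ f₂).IsSeparated :=
  have : IsSeparated (fiberProductCover f₁ f₂ ≫ terminal.from (P1 k)) := by
    unfold fiberProductCover fiberProduct; infer_instance
  ⟨(terminal.hom_ext _ _ :
    fiberProductCover f₁ f₂ ≫ terminal.from (P1 k) = terminal.from (fiberProduct f₁ f₂)) ▸ this⟩

/-- The inclusion of the generic point `Spec K(S) ⟶ S` of an irreducible scheme. -/
def genericInclusion (S : Scheme.{u}) [IrreducibleSpace S] :
    Spec (S.presheaf.stalk (genericPoint S)) ⟶ S :=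
  S.fromSpecStalk (genericPoint S)

instance (S : Scheme.{u}) [IrreducibleSpace S] [S.IsSeparated] :
    IsAffineHom (genericInclusion S) := isAffineHom_to_separated _

/-- The normalization of an integral separated scheme: the normalization of the scheme in its
function field. -/
def normalization (S : Scheme.{u}) [IsIntegral S] [S.IsSeparated] : Scheme.{u} :=
  (genericInclusion S).normalization

/-- The normalization morphism. -/
def normalizationMap (S : Scheme.{u}) [IsIntegral S] [S.IsSeparated] : normalization S ⟶ S :=
  (genericInclusion S).fromNormalization

/-- `f` is square-free of degree `2g + 1` or `2g + 2`, so that `y² = f(x)` has genus `g`. -/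
def IsModelOfGenus (g : ℕ) (f : k[X]) : Prop :=
  Squarefree f ∧ (f.natDegree = 2 * g + 1 ∨ f.natDegree = 2 * g + 2)

/-- `Y` is (the complete nonsingular model of) a hyperelliptic curve `y² = f(x)` of genus
`g ≥ 2`. -/
def IsHyperelliptic (g : ℕ) (Y : Over (Spec (.of k))) : Prop :=
  2 ≤ g ∧ ∃ f : k[X], IsModelOfGenus g f ∧ Nonempty (Y ≅ curveOver f)

/-- `S` is the normalization of the fiber product over `ℙ¹` of `y₁² = f₁(x)` and `y₂² = f₂(x)`,
this fiber product being an integral scheme. -/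
def IsNormalizedFiberProduct (f₁ f₂ : k[X]) (Y : Over (Spec (.of k))) : Prop :=
  ∃ _ : IsIntegral (fiberProduct f₁ f₂),
    Nonempty (Y ≅ Over.mk
      (normalizationMap (fiberProduct f₁ f₂) ≫ fiberProductCover f₁ f₂ ≫ P1.toSpec k))

/-- The monic polynomial with simple roots at the points of `s`. -/
def rootPoly (s : Finset k) : k[X] := ∏ a ∈ s, (X - C a)

/-- `Y` is a generalized Howe curve: the normalization of `C₁ ×_{ℙ¹} C₂`, where
`C₁ : y₁² = ∏ (x - aᵢ) ∏ (x - bᵢ)` and `C₂ : y₂² = ∏ (x - aᵢ) ∏ (x - cᵢ)` have genera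
`1 ≤ g₁ ≤ g₂`, the `aᵢ, bᵢ, cᵢ` are distinct, and `C₁`, `C₂` are not isomorphic over `ℙ¹`.
The Finsets `A`, `B`, `D` are the sets of the `aᵢ`, the `bᵢ` and the `cᵢ`. -/
def IsGeneralizedHowe (Y : Over (Spec (.of k))) : Prop :=
  ∃ (g₁ g₂ : ℕ) (A B D : Finset k),
    1 ≤ g₁ ∧ g₁ ≤ g₂ ∧ Disjoint A B ∧ Disjoint A D ∧ Disjoint B D ∧
    A.card + B.card = 2 * g₁ + 2 ∧ A.card + D.card = 2 * g₂ + 2 ∧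
    (¬ ∃ φ : curve (rootPoly A * rootPoly B) ≅ curve (rootPoly A * rootPoly D),
      φ.hom ≫ cover (rootPoly A * rootPoly D) = cover (rootPoly A * rootPoly B)) ∧
    IsNormalizedFiberProduct (rootPoly A * rootPoly B) (rootPoly A * rootPoly D) Y

end HoweCurve

end

/-! Let `Y` be `y² = f(x)` with function field `K = k(x, y)`. The argument takes place in `K`. A
complete curve is recovered from `K` as the normalization of `ℙ¹` along the map `Spec K ⟶ ℙ¹` given
by a function `u` (`model`). Relative normalization is transitive along integral morphisms, so
`model k u` does not change when `u` is replaced by `u + c`, `u⁻¹` or `u²`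
(`nonempty_model_iso_of_comp`). Because the affine curve is normal, `y² = f(x)` is `model k x`
(`nonempty_curveOver_iso_model`).

Howe implies Klein: the sign changes of `y₁` and `y₂` act on the fiber product, and lifting to the
normalization is unique and faithful (`exists_isKleinPair_of_isNormalizedFiberProduct`).

Klein implies Howe: the four-group acts faithfully on `K`. An involution that fixes `x` sends `y` to
`±y`, so some involution `ρ` moves `x` (`exists_ne_of_isKleinPair`). The irreducible relation
between `x` and `ρ x` has degree at most 2 in each; if it were quadratic in `ρ x`, its discriminant,
of degree at most 4 in `x`, would be a nonzero square times `f`, although `deg f ≥ 5`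
(`exists_mul_aeval_eq`). Hence `ρ` acts on `x` by a homography of order two, which becomes `x ↦ -x`
in a suitable coordinate (`exists_neg`). Comparing `ρ y` with `y` then gives `f = F(x²)` with `deg F
= g + 1` and `F(0) ≠ 0` (`exists_eq_expand`).

With `t = x²` this makes `K = k(t)(√F(t), √(t F(t)))` biquadratic. The curve is therefore birational
to the fiber product of `y₁² = F(t)` and `y₂² = t F(t)`; concretely, the coordinate rings agree
after inverting `y` (`birationalOver_fiberProduct`). For the Howe form, where infinity is not a
branch point, an unbranched `t = p` is moved to infinity by `s = 1/(t - p)`. The `g + 1` roots of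
`F` become the set `A`, and the images `0` and `-1/p` of `∞` and `0` are distributed over `B` and
`D` according to the parity of `g` (`IsBiquadratic.exists_rootPoly`). The fiber product is integral
because the covers are flat, so that its affine part is dense, and the affine coordinate ring embeds
in `K`; its normalization is `model k s`. Independence of `1, z₁, z₂, z₁z₂` over `k(s)` also
excludes an isomorphism `C₁ ≅ C₂` over `ℙ¹`. -/

noncomputable section

namespace HoweCurve

/-! ### Transitivity, functoriality and localization of relative normalization -/

section RelativeNormalization

variable {X X' T S : Scheme.{u}}

/-- Relative normalization is transitive along integral morphisms. -/
def normalizationCompIso (f : X ⟶ S) [QuasiCompact f] [QuasiSeparated f]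
    (i : X ⟶ T) [QuasiCompact i] [QuasiSeparated i] (g : T ⟶ S) [IsIntegralHom g]
    (H : f = i ≫ g) : f.normalization ≅ i.normalization where
  hom := f.normalizationDesc i.toNormalization (i.fromNormalization ≫ g) (by simp [H])
  inv := i.normalizationDesc f.toNormalization (f.normalizationDesc i g H) (by simp)
  hom_inv_id := by
    have h : i.normalizationDesc f.toNormalization (f.normalizationDesc i g H) (by simp) ≫
        f.fromNormalization = i.fromNormalization ≫ g := by
      rw [← f.normalizationDesc_comp i g H, ← Category.assoc, i.normalizationDesc_comp]
    refine Scheme.Hom.normalization.hom_ext f _ _ f.fromNormalization ?_ ?_ (by simp)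
    · simp
    · rw [Category.assoc, h, f.normalizationDesc_comp]
  inv_hom_id := by
    have h : f.normalizationDesc i.toNormalization (i.fromNormalization ≫ g) (by simp [H]) ≫
        i.fromNormalization = f.normalizationDesc i g H := by
      refine Scheme.Hom.normalization.hom_ext f _ _ g ?_ (by simp) (by simp)
      simp
    refine Scheme.Hom.normalization.hom_ext i _ _ i.fromNormalization ?_ ?_ (by simp)
    · simp
    · rw [Category.assoc, h, i.normalizationDesc_comp]

@[simp]
lemma normalizationCompIso_hom_comp (f : X ⟶ S) [QuasiCompact f] [QuasiSeparated f]
    (i : X ⟶ T) [QuasiCompact i] [QuasiSeparated i] (g : T ⟶ S) [IsIntegralHom g]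
    (H : f = i ≫ g) : (normalizationCompIso f i g H).hom ≫ i.fromNormalization ≫ g =
      f.fromNormalization := by
  simp [normalizationCompIso]

@[simp]
lemma toNormalization_normalizationCompIso_hom (f : X ⟶ S) [QuasiCompact f] [QuasiSeparated f]
    (i : X ⟶ T) [QuasiCompact i] [QuasiSeparated i] (g : T ⟶ S) [IsIntegralHom g]
    (H : f = i ≫ g) : f.toNormalization ≫ (normalizationCompIso f i g H).hom =
      i.toNormalization := by
  simp [normalizationCompIso]

/-- Relative normalization is functorial in isomorphisms of the source. -/
def normalizationIsoOfIso (f : X ⟶ S) [QuasiCompact f] [QuasiSeparated f]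
    (f' : X' ⟶ S) [QuasiCompact f'] [QuasiSeparated f'] (e : X ≅ X')
    (H : f = e.hom ≫ f') : f.normalization ≅ f'.normalization where
  hom := f.normalizationDesc (e.hom ≫ f'.toNormalization) f'.fromNormalization (by simp [H])
  inv := f'.normalizationDesc (e.inv ≫ f.toNormalization) f.fromNormalization (by simp [H])
  hom_inv_id := by
    refine Scheme.Hom.normalization.hom_ext f _ _ f.fromNormalization ?_ (by simp) (by simp)
    simp
  inv_hom_id := by
    refine Scheme.Hom.normalization.hom_ext f' _ _ f'.fromNormalization ?_ (by simp) (by simp)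
    simp

@[simp]
lemma normalizationIsoOfIso_hom_comp (f : X ⟶ S) [QuasiCompact f] [QuasiSeparated f]
    (f' : X' ⟶ S) [QuasiCompact f'] [QuasiSeparated f'] (e : X ≅ X')
    (H : f = e.hom ≫ f') : (normalizationIsoOfIso f f' e H).hom ≫ f'.fromNormalization =
      f.fromNormalization := by
  simp [normalizationIsoOfIso]

@[simp]
lemma normalizationIsoOfIso_hom_comp_assoc (f : X ⟶ S) [QuasiCompact f] [QuasiSeparated f]
    (f' : X' ⟶ S) [QuasiCompact f'] [QuasiSeparated f'] (e : X ≅ X')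
    (H : f = e.hom ≫ f') {Z : Scheme.{u}} (h : S ⟶ Z) :
    (normalizationIsoOfIso f f' e H).hom ≫ f'.fromNormalization ≫ h = f.fromNormalization ≫ h := by
  rw [← Category.assoc, normalizationIsoOfIso_hom_comp]

@[simp]
lemma toNormalization_normalizationIsoOfIso_hom (f : X ⟶ S) [QuasiCompact f] [QuasiSeparated f]
    (f' : X' ⟶ S) [QuasiCompact f'] [QuasiSeparated f'] (e : X ≅ X')
    (H : f = e.hom ≫ f') : f.toNormalization ≫ (normalizationIsoOfIso f f' e H).hom =
      e.hom ≫ f'.toNormalization := by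
  simp [normalizationIsoOfIso]

@[simp]
lemma toNormalization_normalizationIsoOfIso_hom_assoc (f : X ⟶ S) [QuasiCompact f]
    [QuasiSeparated f] (f' : X' ⟶ S) [QuasiCompact f'] [QuasiSeparated f'] (e : X ≅ X')
    (H : f = e.hom ≫ f') {Z : Scheme.{u}} (h : f'.normalization ⟶ Z) :
    f.toNormalization ≫ (normalizationIsoOfIso f f' e H).hom ≫ h =
      e.hom ≫ f'.toNormalization ≫ h := by
  rw [← Category.assoc, toNormalization_normalizationIsoOfIso_hom, Category.assoc]

/-- Relative normalization commutes with restriction to an open subscheme of the target. -/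
lemma exists_isPullback_normalization (i : X ⟶ T) [QuasiCompact i] [QuasiSeparated i]
    (o : T ⟶ S) [IsOpenImmersion o] (f : X ⟶ S) [QuasiCompact f] [QuasiSeparated f]
    (H : f = i ≫ o) : ∃ m : i.normalization ⟶ f.normalization,
      IsPullback m i.fromNormalization f.fromNormalization o ∧
      i.toNormalization ≫ m = f.toNormalization := by
  -- Since `o` is a monomorphism, the base change of `f = i ≫ o` along `o` is `i` itself.
  have hp : IsPullback (𝟙 X) i f o :=
    ⟨⟨by simp [H]⟩, ⟨PullbackCone.IsLimit.mk _ (fun s ↦ s.fst) (by simp)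
      (fun s ↦ by rw [← cancel_mono o, Category.assoc, ← H, s.condition])
      (by intro s m h _; simpa using h)⟩⟩
  let e := normalizationIsoOfIso i (pullback.snd f o) hp.isoPullback (by simp)
  refine ⟨e.hom ≫ f.normalizationPullback o ≫ pullback.fst _ _, ?_, ?_⟩
  · refine IsPullback.of_iso_pullback ⟨?_⟩ (e ≪≫ asIso (f.normalizationPullback o)) ?_ ?_
    · simp [e, pullback.condition]
    · simp
    · simp [e]
  · have := Scheme.Hom.toNormalization_normalizationPullback_fst f o
    simp [e, this]

end RelativeNormalization

/-! ### Points of `Proj` with values in a ring, by homogeneous coordinates -/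

section ProjPoints

variable {A : Type u} [CommRing A] {σ : Type u} [SetLike σ A] [AddSubgroupClass σ A]
  (𝒜 : ℕ → σ) [GradedRing 𝒜] {R : Type u} [CommRing R]

/-- The ring homomorphism `(A_r)₀ → R` induced by a homomorphism `A → R` that maps `r` to a
unit. -/
def awayEval (φ : A →+* R) (r : A) (hr : IsUnit (φ r)) :
    HomogeneousLocalization.Away 𝒜 r →+* R :=
  (IsLocalization.Away.lift (S := Localization.Away r) r hr).comp
    (algebraMap (HomogeneousLocalization.Away 𝒜 r) (Localization.Away r))

/-- The denominator stays on the left, so that equalities of morphisms into `Proj` become equalities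
in `R` that may be checked after multiplying by a unit. -/
lemma awayEval_mk (φ : A →+* R) {r : A} (hr : IsUnit (φ r)) {d : ℕ} (hd : r ∈ 𝒜 d) (n : ℕ) (a : A)
    (ha : a ∈ 𝒜 (n • d)) :
    awayEval 𝒜 φ r hr (HomogeneousLocalization.Away.mk 𝒜 hd n a ha) * φ r ^ n = φ a := by
  simp only [awayEval, RingHom.comp_apply, HomogeneousLocalization.algebraMap_apply,
    HomogeneousLocalization.Away.val_mk]
  have h := IsLocalization.Away.lift_eq (S := Localization.Away r) r hr
  rw [← map_pow, ← h, ← map_mul, ← h a, Localization.mk_eq_mk', mul_comm]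
  exact congrArg _ (IsLocalization.mk'_spec' (Localization (Submonoid.powers r)) a (⟨r ^ n, n, rfl⟩ : Submonoid.powers r))

lemma awayEval_ext {r : A} {d : ℕ} (hd : r ∈ 𝒜 d)
    (ψ ψ' : HomogeneousLocalization.Away 𝒜 r →+* R)
    (h : ∀ n a ha, ψ (.mk 𝒜 hd n a ha) = ψ' (.mk 𝒜 hd n a ha)) : ψ = ψ' := by
  ext x
  obtain ⟨n, a, ha, rfl⟩ := HomogeneousLocalization.Away.mk_surjective 𝒜 hd x
  exact h n a ha

/-- The morphism `Spec R ⟶ Proj A` given by a homomorphism `A → R` that maps the homogeneous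
element `r` of positive degree to a unit. -/
def projPoint (φ : A →+* R) {r : A} {d : ℕ} (hr : IsUnit (φ r)) (hd : r ∈ 𝒜 d) (h0 : 0 < d) :
    Spec (.of R) ⟶ Proj 𝒜 :=
  Spec.map (CommRingCat.ofHom (awayEval 𝒜 φ r hr)) ≫ Proj.awayι 𝒜 r hd h0

/-- A point of the chart `D₊(r)` at which `s` is also invertible lies in the smaller chart `D₊(rs)`.
This makes the choice of chart irrelevant. -/
lemma projPoint_mul (φ : A →+* R) {r s x : A} {d e f : ℕ} (hr : IsUnit (φ r)) (hd : r ∈ 𝒜 d)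
    (h0 : 0 < d) (hs : s ∈ 𝒜 e) (hx : IsUnit (φ x)) (hf : x ∈ 𝒜 f) (hf0 : 0 < f)
    (hx' : x = r * s) (hf' : f = d + e) :
    projPoint 𝒜 φ hr hd h0 = projPoint 𝒜 φ hx hf hf0 := by
  subst hf'
  rw [projPoint, projPoint, ← Proj.SpecMap_awayMap_awayι (𝒜 := 𝒜) hd h0 hs hx', ← Category.assoc,
    ← Spec.map_comp, ← CommRingCat.ofHom_comp]
  congr 3
  refine awayEval_ext 𝒜 hd _ _ fun n a ha ↦ ?_
  have h1 := awayEval_mk 𝒜 φ hr hd n a ha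
  rw [← hr.pow n |>.mul_left_inj, h1, RingHom.comp_apply,
    HomogeneousLocalization.awayMap_mk 𝒜 hs hx' n hd a ha]
  have hs' : IsUnit (φ s) := by
    rw [hx', map_mul] at hx; exact isUnit_of_mul_isUnit_right hx
  have h2 := awayEval_mk 𝒜 φ hx hf n (a * s ^ n)
    (by rw [smul_add]; exact SetLike.mul_mem_graded ha (SetLike.pow_mem_graded _ hs))
  refine (hs'.pow n).mul_left_inj.mp ?_
  rw [map_mul, map_pow] at h2
  rw [← h2, mul_assoc, ← mul_pow, ← map_mul]
  exact congrArg (fun y ↦ _ * φ y ^ n) hx'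

lemma projPoint_eq_projPoint (φ : A →+* R) {r s : A} {d e : ℕ} (hr : IsUnit (φ r)) (hd : r ∈ 𝒜 d)
    (h0 : 0 < d) (hs : IsUnit (φ s)) (he : s ∈ 𝒜 e) (h0' : 0 < e) :
    projPoint 𝒜 φ hr hd h0 = projPoint 𝒜 φ hs he h0' := by
  have hu : IsUnit (φ (r * s)) := by rw [map_mul]; exact hr.mul hs
  rw [projPoint_mul 𝒜 φ hr hd h0 he hu (SetLike.mul_mem_graded hd he) (by omega) rfl rfl,
    projPoint_mul 𝒜 φ hs he h0' hd hu (SetLike.mul_mem_graded hd he) (by omega) (mul_comm _ _)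
      (add_comm _ _)]

/-- Rescaling homogeneous coordinates by `c` multiplies numerator and denominator of every
degree-zero fraction by the same power of `c`. -/
lemma projPoint_eq_of_smul (φ φ' : A →+* R) (c : R)
    (h : ∀ n, ∀ a ∈ 𝒜 n, φ' a = c ^ n * φ a) {r : A} {d : ℕ} (hr : IsUnit (φ r))
    (hr' : IsUnit (φ' r)) (hd : r ∈ 𝒜 d) (h0 : 0 < d) :
    projPoint 𝒜 φ hr hd h0 = projPoint 𝒜 φ' hr' hd h0 := by
  rw [projPoint, projPoint]
  congr 3
  refine awayEval_ext 𝒜 hd _ _ fun n a ha ↦ ?_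
  have h1 := awayEval_mk 𝒜 φ hr hd n a ha
  have h2 := awayEval_mk 𝒜 φ' hr' hd n a ha
  refine (hr'.pow n).mul_left_inj.mp ?_
  rw [h2, h _ _ ha, h _ _ hd, mul_pow, ← pow_mul, mul_comm d n, smul_eq_mul, mul_left_comm, h1]

lemma SpecMap_projPoint {R' : Type u} [CommRing R'] (g : R →+* R') (φ : A →+* R) {r : A} {d : ℕ}
    (hr : IsUnit (φ r)) (hr' : IsUnit ((g.comp φ) r)) (hd : r ∈ 𝒜 d) (h0 : 0 < d) :
    Spec.map (CommRingCat.ofHom g) ≫ projPoint 𝒜 φ hr hd h0 =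
      projPoint 𝒜 (g.comp φ) hr' hd h0 := by
  rw [projPoint, projPoint, ← Category.assoc, ← Spec.map_comp, ← CommRingCat.ofHom_comp]
  congr 3
  refine awayEval_ext 𝒜 hd _ _ fun n a ha ↦ ?_
  have h1 := awayEval_mk 𝒜 φ hr hd n a ha
  have h2 := awayEval_mk 𝒜 (g.comp φ) hr' hd n a ha
  refine (hr'.pow n).mul_left_inj.mp ?_
  rw [h2, RingHom.comp_apply, RingHom.comp_apply, RingHom.comp_apply, ← map_pow, ← map_mul, h1]

lemma projPoint_map {B : Type u} [CommRing B] {τ : Type u} [SetLike τ B] [AddSubgroupClass τ B]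
    (ℬ : ℕ → τ) [GradedRing ℬ] (f : 𝒜 →+*ᵍ ℬ) (hf : HomogeneousIdeal.irrelevant ℬ ≤ (HomogeneousIdeal.irrelevant 𝒜).map f) (φ : B →+* R) {r : A} {d : ℕ}
    (hr : IsUnit (φ (f r))) (hd : r ∈ 𝒜 d) (hd' : f r ∈ ℬ d) (h0 : 0 < d) :
    projPoint ℬ φ hr hd' h0 ≫ Proj.map f hf =
      projPoint 𝒜 (φ.comp (f : A →+* B)) hr hd h0 := by
  unfold projPoint
  rw [Category.assoc, Proj.awayι_comp_map _ _ h0 _ hd, ← Category.assoc,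
    ← Spec.map_comp, ← CommRingCat.ofHom_comp]
  congr 3
  refine awayEval_ext 𝒜 hd _ _ fun n a ha ↦ ?_
  have h1 := awayEval_mk 𝒜 (φ.comp (f : A →+* B)) hr hd n a ha
  have h2 := awayEval_mk ℬ φ hr hd' n (f a) (f.2 ha)
  refine (hr.pow n).mul_left_inj.mp ?_
  rw [RingHom.comp_apply, HomogeneousLocalization.Away.map_mk, h2]
  exact h1.symm

lemma basicOpen_ι_SpecMap (r : Γ(Spec (.of R), ⊤)) (g : Localization.Away r →+* R)
    (hg : g.comp (algebraMap _ _) = (Scheme.ΓSpecIso (.of R)).hom.hom) :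
    ((Spec (.of R)).basicOpen r).ι ≫ Spec.map (CommRingCat.ofHom g) =
      ((Spec (.of R)).isoOfEq ((Spec (.of R)).toSpecΓ_preimage_basicOpen r)).inv ≫
      (Spec (.of R)).toSpecΓ ∣_ _ ≫ (basicOpenIsoSpecAway _).hom := by
  have : Mono (Spec.map (CommRingCat.ofHom (algebraMap Γ(Spec (.of R), ⊤)
    (Localization.Away r)))) := inferInstance
  rw [← cancel_mono (Spec.map (CommRingCat.ofHom (algebraMap Γ(Spec (.of R), ⊤)
    (Localization.Away r))))]
  simp only [Category.assoc, basicOpenIsoSpecAway_hom_SpecMap, ← Spec.map_comp,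
    ← CommRingCat.ofHom_comp, hg]
  refine Eq.trans ?_ (congrArg (((Spec (.of R)).isoOfEq
    ((Spec (.of R)).toSpecΓ_preimage_basicOpen r)).inv ≫ ·)
    (morphismRestrict_ι (Spec (.of R)).toSpecΓ (PrimeSpectrum.basicOpen r))).symm
  simp [Scheme.isoOfEq_inv, SpecMap_ΓSpecIso_hom]

/-- The general construction glues over the basic opens of all homogeneous elements. As `r` becomes
a unit, its basic open is everything, and this single piece already determines the morphism. The
result makes the chart `lineChart` computable. -/
lemma fromOfGlobalSections_eq_projPoint (φ : A →+* R) {r : A} {d : ℕ} (hr : IsUnit (φ r))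
    (hd : r ∈ 𝒜 d) (h0 : 0 < d)
    (hf : (HomogeneousIdeal.irrelevant 𝒜).toIdeal.map
      ((Scheme.ΓSpecIso (.of R)).inv.hom.comp φ) = ⊤) :
    Proj.fromOfGlobalSections 𝒜 ((Scheme.ΓSpecIso (.of R)).inv.hom.comp φ) hf =
      projPoint 𝒜 φ hr hd h0 := by
  generalize hf' : (Scheme.ΓSpecIso (.of R)).inv.hom.comp φ = f at hf ⊢
  have hfφ : (Scheme.ΓSpecIso (.of R)).hom.hom.comp f = φ := by
    ext x; simp [← hf']
  have hu : IsUnit (f r) := by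
    rw [← hf']; exact hr.map (Scheme.ΓSpecIso (.of R)).inv.hom
  have htop : (Spec (.of R)).basicOpen (f r) = ⊤ := Scheme.basicOpen_of_isUnit _ hu
  have : IsIso ((Spec (.of R)).basicOpen (f r)).ι := by
    rw [htop]; exact inferInstanceAs (IsIso (Spec (.of R)).topIso.hom)
  rw [← cancel_epi ((Spec (.of R)).basicOpen (f r)).ι]
  have key : ((Spec (.of R)).basicOpen (f r)).ι ≫ Proj.fromOfGlobalSections 𝒜 f hf =
      Proj.toBasicOpenOfGlobalSections 𝒜 f rfl h0 hd ≫ Scheme.Opens.ι _ :=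
    (Proj.openCoverOfMapIrrelevantEqTop 𝒜 f hf).ι_glueMorphisms _ _ ⟨_, _, h0, hd⟩
  rw [key, projPoint]
  let g : Localization.Away (f r) →+* R :=
    IsLocalization.Away.lift (f r) (g := (Scheme.ΓSpecIso (.of R)).hom.hom) (hu.map _)
  have hg : g.comp (algebraMap _ _) = (Scheme.ΓSpecIso (.of R)).hom.hom :=
    IsLocalization.Away.lift_comp (f r) _
  have hm : Submonoid.powers r ≤ (Submonoid.powers (f r)).comap f := by
    rw [← Submonoid.map_le_iff_le_comap, Submonoid.map_powers]
  let m : HomogeneousLocalization.Away 𝒜 r →+* Localization.Away (f r) :=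
    (IsLocalization.map (M := .powers r) (T := .powers (f r))
      (Localization.Away (f r)) f hm).comp (algebraMap _ (Localization.Away r))
  have h1 : awayEval 𝒜 φ r hr = g.comp m := by
    rw [awayEval, ← RingHom.comp_assoc]
    congr 1
    refine IsLocalization.ringHom_ext (.powers r) ?_
    rw [RingHom.comp_assoc, IsLocalization.map_comp, ← RingHom.comp_assoc, hg, hfφ]
    exact IsLocalization.Away.lift_comp r hr
  have h3 : Spec.map (CommRingCat.ofHom (awayEval 𝒜 φ r hr)) =
      Spec.map (CommRingCat.ofHom g) ≫ Spec.map (CommRingCat.ofHom m) := by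
    rw [h1, ← Spec.map_comp, ← CommRingCat.ofHom_comp]
  rw [h3]
  simp only [Proj.toBasicOpenOfGlobalSections, Category.assoc, Proj.basicOpenIsoSpec_inv_ι]
  have h2 := congrArg (· ≫ Spec.map (CommRingCat.ofHom m) ≫ Proj.awayι 𝒜 r hd h0)
    (basicOpen_ι_SpecMap (f r) g hg)
  simp only [Category.assoc] at h2
  exact h2.symm

end ProjPoints

/-! ### Charts and automorphisms of the projective line -/

section ProjectiveLine

variable {k : Type u} [Field k]

/-- The grading of `k[X₀, X₁]` by degree. -/
abbrev forms (k : Type u) [Field k] : ℕ → Submodule k (MvPolynomial (Fin 2) k) :=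
  MvPolynomial.homogeneousSubmodule (Fin 2) k

variable {R : Type u} [CommRing R] [Algebra k R]

/-- Evaluation of forms at `(a, b)`. -/
def coordHom (k : Type u) [Field k] {R : Type u} [CommRing R] [Algebra k R] (a b : R) :
    MvPolynomial (Fin 2) k →+* R :=
  (MvPolynomial.aeval ![a, b]).toRingHom

@[simp] lemma coordHom_X0 (a b : R) : coordHom k a b (MvPolynomial.X 0) = a := by simp [coordHom]
@[simp] lemma coordHom_X1 (a b : R) : coordHom k a b (MvPolynomial.X 1) = b := by simp [coordHom]
@[simp] lemma coordHom_C (a b : R) (c : k) :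
    coordHom k a b (MvPolynomial.C c) = algebraMap k R c := by simp [coordHom]

lemma coordHom_ext (φ : MvPolynomial (Fin 2) k →+* R) (a b : R)
    (hC : ∀ c, φ (MvPolynomial.C c) = algebraMap k R c) (h0 : φ (MvPolynomial.X 0) = a)
    (h1 : φ (MvPolynomial.X 1) = b) : φ = coordHom k a b := by
  refine MvPolynomial.ringHom_ext (fun c ↦ by simp [hC]) fun i ↦ ?_
  fin_cases i <;> simp [h0, h1]

lemma coordHom_smul (a b c : R) (n : ℕ) (p : MvPolynomial (Fin 2) k) (hp : p ∈ forms k n) :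
    coordHom k (c * a) (c * b) p = c ^ n * coordHom k a b p := by
  have hp' : p.IsHomogeneous n := hp
  have : (![c * a, c * b] : Fin 2 → R) = c • ![a, b] := by ext i; fin_cases i <;> simp
  simp only [coordHom, AlgHom.toRingHom_eq_coe, RingHom.coe_coe, this]
  simp only [MvPolynomial.aeval_eq_eval₂Hom, MvPolynomial.coe_eval₂Hom, MvPolynomial.eval₂_eq,
    Finset.mul_sum]
  refine Finset.sum_congr rfl fun d hd ↦ ?_
  have hdeg : ∑ i ∈ d.support, d i = n := by
    have := hp' (MvPolynomial.mem_support_iff.mp hd)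
    rw [← this, Finsupp.weight_apply, Finsupp.sum]; simp
  simp only [Pi.smul_apply, smul_eq_mul, mul_pow, Finset.prod_mul_distrib,
    Finset.prod_pow_eq_pow_sum, hdeg]
  ring

lemma X_mem_forms (i : Fin 2) : (MvPolynomial.X i : MvPolynomial (Fin 2) k) ∈ forms k 1 :=
  MvPolynomial.isHomogeneous_X k i

variable (k) in
/-- The morphism `Spec R ⟶ ℙ¹` given by a homomorphism `k[X₀, X₁] → R` that maps a form of
positive degree to a unit. -/
def formPoint {R : Type u} [CommRing R] (φ : MvPolynomial (Fin 2) k →+* R)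
    {r : MvPolynomial (Fin 2) k} {d : ℕ} (hr : IsUnit (φ r)) (hd : r ∈ forms k d) (h0 : 0 < d) :
    Spec (.of R) ⟶ P1 k :=
  projPoint (forms k) φ hr hd h0

lemma SpecMap_formPoint {R R' : Type u} [CommRing R] [CommRing R'] (g : R →+* R')
    (φ : MvPolynomial (Fin 2) k →+* R) (φ' : MvPolynomial (Fin 2) k →+* R') (h : g.comp φ = φ')
    {r : MvPolynomial (Fin 2) k} {d : ℕ} (hr : IsUnit (φ r)) (hr' : IsUnit (φ' r))
    (hd : r ∈ forms k d) (h0 : 0 < d) :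
    Spec.map (CommRingCat.ofHom g) ≫ formPoint k φ hr hd h0 = formPoint k φ' hr' hd h0 := by
  subst h
  exact SpecMap_projPoint (forms k) g φ hr hr' hd h0

lemma formPoint_toSpec (φ : MvPolynomial (Fin 2) k →+* R)
    (hφ : ∀ c, φ (MvPolynomial.C c) = algebraMap k R c)
    {r : MvPolynomial (Fin 2) k} {d : ℕ} (hr : IsUnit (φ r)) (hd : r ∈ forms k d) (h0 : 0 < d) :
    formPoint k φ hr hd h0 ≫ P1.toSpec k =
      Spec.map (CommRingCat.ofHom (algebraMap k R)) := by
  have h1 : formPoint k φ hr hd h0 ≫ P1.toSpec k =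
      Spec.map (CommRingCat.ofHom (awayEval (forms k) φ r hr)) ≫ (Proj.awayι (forms k) r hd h0 ≫
        Proj.toSpecZero (forms k)) ≫ Spec.map (CommRingCat.ofHom (algebraMap k (forms k 0))) := by
    rw [Category.assoc]; exact Category.assoc _ _ _
  rw [h1, Proj.awayι_toSpecZero, ← Spec.map_comp, ← Spec.map_comp,
    ← CommRingCat.ofHom_comp, ← CommRingCat.ofHom_comp]
  congr 2
  ext c
  have : ∀ x : forms k 0, awayEval (forms k) φ r hr (HomogeneousLocalization.fromZeroRingHom
      (forms k) (Submonoid.powers r) x) = φ x := by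
    intro x
    simp only [awayEval, RingHom.comp_apply, HomogeneousLocalization.algebraMap_apply]
    rw [show (HomogeneousLocalization.fromZeroRingHom (forms k) (Submonoid.powers r) x).val =
      algebraMap _ (Localization.Away r) (x : MvPolynomial (Fin 2) k) from
        Localization.mk_one_eq_algebraMap _, IsLocalization.Away.lift_eq]
  simp only [RingHom.comp_apply, this]
  rw [← hφ]
  rfl

lemma lineChart_eq_formPoint :
    lineChart k = formPoint k (coordHom k (X : k[X]) 1)
      (r := MvPolynomial.X 1) (by simp) (X_mem_forms 1) one_pos :=
  fromOfGlobalSections_eq_projPoint (forms k) (coordHom k (X : k[X]) 1) (by simp) (X_mem_forms 1)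
    one_pos (lineCoords_irrelevant k)

/-- Dehomogenization at `X₁ = 1`: a form of known degree is recovered from its dehomogenization,
which gives injectivity, and homogenizing a polynomial in its own degree gives a preimage. -/
lemma awayEval_coordHom_bijective :
    Function.Bijective (awayEval (forms k) (coordHom k (X : k[X]) 1) (MvPolynomial.X 1)
      (by simp)) := by
  have key := fun n a ha ↦ awayEval_mk (forms k) (coordHom k (X : k[X]) 1)
    (r := MvPolynomial.X 1) (by simp) (X_mem_forms 1) n a ha
  constructor
  · rw [injective_iff_map_eq_zero]
    intro x hx
    obtain ⟨n, a, ha, rfl⟩ := HomogeneousLocalization.Away.mk_surjective (forms k) (X_mem_forms 1) x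
    have h := key n a ha
    rw [hx, zero_mul] at h
    have h2 : a = 0 := by
      have ha' : a.IsHomogeneous n := by simpa using ha
      simpa using (homogenize_eq_of_isHomogeneous ha' h.symm).symm
    subst h2
    exact HomogeneousLocalization.mk_eq_zero_of_num _ rfl
  · intro p
    refine ⟨.mk (forms k) (X_mem_forms 1) p.natDegree (p.homogenize p.natDegree) ?_, ?_⟩
    · simp
    · have h := key p.natDegree (p.homogenize p.natDegree) (by simp)
      simp only [coordHom_X1, one_pow, mul_one] at h
      exact h.trans (aeval_homogenize_X_one p le_rfl)

lemma lineChart_eq : ∃ e : Spec (.of k[X]) ≅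
      Spec (.of (HomogeneousLocalization.Away (forms k) (MvPolynomial.X 1))),
    lineChart k = e.hom ≫ Proj.awayι (forms k) _ (X_mem_forms 1) one_pos := by
  have : IsIso (CommRingCat.ofHom (awayEval (forms k) (coordHom k (X : k[X]) 1) (MvPolynomial.X 1)
      (by simp))) := by
    rw [ConcreteCategory.isIso_iff_bijective]
    exact awayEval_coordHom_bijective
  exact ⟨asIso (Spec.map _), lineChart_eq_formPoint⟩

instance : IsOpenImmersion (lineChart k) := by
  obtain ⟨e, he⟩ := lineChart_eq (k := k)
  rw [he]
  exact inferInstanceAs (IsOpenImmersion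
    (e.hom ≫ Proj.awayι (forms k) _ (X_mem_forms 1) one_pos))

/-- The standard open subset `X_i ≠ 0` of the projective line. -/
def standardOpen (k : Type u) [Field k] (i : Fin 2) : (P1 k).Opens :=
  Proj.basicOpen (forms k) (MvPolynomial.X i)

lemma lineChart_opensRange : (lineChart k).opensRange = standardOpen k 1 := by
  obtain ⟨e, he⟩ := lineChart_eq (k := k)
  refine TopologicalSpace.Opens.ext ?_
  rw [Scheme.Hom.coe_opensRange, he]
  refine Eq.trans ?_ congr(($(Proj.opensRange_awayι (forms k) _ (X_mem_forms 1) one_pos)).1)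
  exact (congrArg (fun U ↦ (U : TopologicalSpace.Opens _).1)
    (Scheme.Hom.opensRange_comp_of_isIso e.hom (Proj.awayι (forms k) _ (X_mem_forms 1) one_pos)) :)

lemma lineChart_preimage_standardOpen_zero :
    lineChart k ⁻¹ᵁ standardOpen k 0 = PrimeSpectrum.basicOpen (X : k[X]) := by
  have h : lineChart k ⁻¹ᵁ standardOpen k 0 = (Spec (.of k[X])).basicOpen _ :=
    Proj.fromOfGlobalSections_preimage_basicOpen (forms k) (lineCoords k)
      (lineCoords_irrelevant k) one_pos (X_mem_forms 0)
  refine h.trans ?_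
  have h2 : lineCoords k (MvPolynomial.X 0) = (Scheme.ΓSpecIso (.of k[X])).inv X := by
    simp [lineCoords]
  rw [h2]
  exact basicOpen_eq_of_affine _

lemma iSup_standardOpen : ⨆ i, standardOpen k i = ⊤ := by
  refine Proj.iSup_basicOpen_eq_top' (forms k) MvPolynomial.X (fun i ↦ ⟨1, X_mem_forms i⟩) ?_
  refine eq_top_iff.mpr fun p _ ↦ ?_
  induction p using MvPolynomial.induction_on with
  | C c => exact Subalgebra.algebraMap_mem _ (⟨.C c, MvPolynomial.isHomogeneous_C _ c⟩ : forms k 0)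
  | add p q hp hq => exact add_mem (hp trivial) (hq trivial)
  | mul_X p i hp => exact mul_mem (hp trivial) (Algebra.subset_adjoin ⟨i, rfl⟩)

/-- The morphism `Spec R ⟶ ℙ¹` with affine coordinate `u`. -/
def linePoint (k : Type u) [Field k] {R : Type u} [CommRing R] [Algebra k R] (u : R) :
    Spec (.of R) ⟶ P1 k :=
  Spec.map (CommRingCat.ofHom (aeval (R := k) u).toRingHom) ≫ lineChart k

lemma linePoint_eq_formPoint (u : R) :
    linePoint k u = formPoint k (coordHom k u 1) (r := MvPolynomial.X 1) (by simp)
      (X_mem_forms 1) one_pos := by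
  have h : (aeval (R := k) u).toRingHom.comp (coordHom k (X : k[X]) 1) = coordHom k u 1 :=
    coordHom_ext _ _ _ (by simp) (by simp) (by simp)
  rw [linePoint, lineChart_eq_formPoint, SpecMap_formPoint _ _ _ h]

lemma lineChart_eq_linePoint : lineChart k = linePoint k (X : k[X]) := by
  rw [linePoint_eq_formPoint, lineChart_eq_formPoint]

lemma linePoint_toSpec (u : R) :
    linePoint k u ≫ P1.toSpec k = Spec.map (CommRingCat.ofHom (algebraMap k R)) := by
  rw [linePoint_eq_formPoint, formPoint_toSpec _ (by simp)]

/-- The graded endomorphism of `k[X₀, X₁]` given by two linear forms. -/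
def linearHom (p q : MvPolynomial (Fin 2) k) (hp : p ∈ forms k 1) (hq : q ∈ forms k 1) :
    forms k →+*ᵍ forms k where
  __ := coordHom k p q
  map_mem {n a} ha := by
    have h : ∀ i, (![p, q] i).IsHomogeneous 1 := by
      intro i; fin_cases i
      exacts [hp, hq]
    have := MvPolynomial.IsHomogeneous.aeval (R := k) (S := k) (show a.IsHomogeneous n from ha)
      (g := ![p, q]) (n := 1) h
    rwa [one_mul] at this

@[simp] lemma linearHom_apply (p q : MvPolynomial (Fin 2) k) (hp : p ∈ forms k 1)
    (hq : q ∈ forms k 1) (a : MvPolynomial (Fin 2) k) :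
    linearHom p q hp hq a = coordHom k p q a := rfl

/-- This is the condition for `Proj.map f` to be defined everywhere; a right inverse shows that `f`
hits every form of positive degree. -/
lemma irrelevant_le_map_of_rightInverse (f g : forms k →+*ᵍ forms k) (h : f.comp g = .id _) :
    HomogeneousIdeal.irrelevant (forms k) ≤ (HomogeneousIdeal.irrelevant (forms k)).map f := by
  rw [HomogeneousIdeal.irrelevant_le]
  intro i hi x hx
  have hx' : f (g x) = x := congr($h x)
  rw [← hx']
  exact Ideal.mem_map_of_mem _ (HomogeneousIdeal.mem_irrelevant_of_mem _ hi (g.2 hx))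

lemma projMap_eq_id (f : forms k →+*ᵍ forms k) (hf) (h : f = .id _) :
    Proj.map f hf = 𝟙 (Proj (forms k)) := by
  subst h; exact Proj.map_id

/-- The automorphism of the projective line given by an automorphism of `k[X₀, X₁]` that preserves
degrees. -/
def lineIso (f g : forms k →+*ᵍ forms k) (hfg : f.comp g = .id _) (hgf : g.comp f = .id _) :
    P1 k ≅ P1 k where
  hom := Proj.map f (irrelevant_le_map_of_rightInverse f g hfg)
  inv := Proj.map g (irrelevant_le_map_of_rightInverse g f hgf)
  hom_inv_id := (Proj.map_comp g f (irrelevant_le_map_of_rightInverse g f hgf)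
    (irrelevant_le_map_of_rightInverse f g hfg)).symm.trans (projMap_eq_id _ _ hfg)
  inv_hom_id := (Proj.map_comp f g (irrelevant_le_map_of_rightInverse f g hfg)
    (irrelevant_le_map_of_rightInverse g f hgf)).symm.trans (projMap_eq_id _ _ hgf)

lemma formPoint_lineIso {R : Type u} [CommRing R] (f g : forms k →+*ᵍ forms k) (hfg : f.comp g = .id _)
    (hgf : g.comp f = .id _) (φ φ' : MvPolynomial (Fin 2) k →+* R)
    (hφ : φ.comp (f : MvPolynomial (Fin 2) k →+* MvPolynomial (Fin 2) k) = φ')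
    {r r' : MvPolynomial (Fin 2) k} {d : ℕ} (hr : IsUnit (φ r)) (hr' : IsUnit (φ' r'))
    (hd : r ∈ forms k d) (hd' : r' ∈ forms k d) (h0 : 0 < d) :
    formPoint k φ hr hd h0 ≫ (lineIso f g hfg hgf).hom = formPoint k φ' hr' hd' h0 := by
  subst hφ
  have h1 : formPoint k φ hr hd h0 = formPoint k φ (r := f r') hr' (f.2 hd') h0 :=
    projPoint_eq_projPoint (forms k) φ hr hd h0 hr' (f.2 hd') h0
  rw [h1]
  exact projPoint_map (forms k) (forms k) f _ φ hr' hd' (f.2 hd') h0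

lemma awayι_map_toSpec (f : forms k →+*ᵍ forms k) (hf)
    (hC : ∀ c, f (MvPolynomial.C c) = MvPolynomial.C c) {d : ℕ} (r : MvPolynomial (Fin 2) k)
    (h0 : 0 < d) (hr : r ∈ forms k d) :
    Proj.awayι (forms k) (f r) (f.2 hr) h0 ≫ Proj.map f hf ≫
      Proj.toSpecZero (forms k) ≫ Spec.map (CommRingCat.ofHom (algebraMap k (forms k 0))) =
      Proj.awayι (forms k) (f r) (f.2 hr) h0 ≫
      Proj.toSpecZero (forms k) ≫ Spec.map (CommRingCat.ofHom (algebraMap k (forms k 0))) := by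
  rw [Proj.awayι_comp_map_assoc _ _ h0 _ hr, Proj.awayι_toSpecZero_assoc,
    Proj.awayι_toSpecZero_assoc, ← Spec.map_comp, ← Spec.map_comp, ← Spec.map_comp,
    ← CommRingCat.ofHom_comp, ← CommRingCat.ofHom_comp, ← CommRingCat.ofHom_comp]
  congr 2
  ext c
  have h2 : f ((algebraMap k (forms k 0) c : forms k 0) : MvPolynomial (Fin 2) k) =
    (algebraMap k (forms k 0) c : forms k 0) := hC c
  change (Localization.mk (f (algebraMap k (forms k 0) c : forms k 0)) ⟨f 1, _⟩ :
    Localization (Submonoid.powers (f r))) =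
    Localization.mk ((algebraMap k (forms k 0) c : forms k 0) : MvPolynomial (Fin 2) k) ⟨1, _⟩
  congr 1
  simp

/-- Fixing the constants makes the automorphism one over `k`; the check is made on the affine pieces
that define `Proj.map`. -/
lemma lineIso_toSpec (f g : forms k →+*ᵍ forms k) (hfg : f.comp g = .id _)
    (hgf : g.comp f = .id _) (hC : ∀ c, f (MvPolynomial.C c) = MvPolynomial.C c) :
    (lineIso f g hfg hgf).hom ≫ P1.toSpec k = P1.toSpec k := by
  have hf := irrelevant_le_map_of_rightInverse f g hfg
  refine (Proj.mapAffineOpenCover f hf).openCover.hom_ext _ _ fun s ↦ ?_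
  exact awayι_map_toSpec f hf hC s.2.1 s.1.2 s.2.2

/-- The linear form `X₀ + c X₁`. -/
def translationForm (c : k) : MvPolynomial (Fin 2) k :=
  MvPolynomial.X 0 + MvPolynomial.C c * MvPolynomial.X 1

lemma translationForm_mem_forms (c : k) : translationForm c ∈ forms k 1 :=
  add_mem (X_mem_forms 0) (by
    have := (MvPolynomial.isHomogeneous_C (Fin 2) c).mul (MvPolynomial.isHomogeneous_X k 1)
    rwa [zero_add] at this)

lemma linearHom_comp_eq_id (p q p' q' : MvPolynomial (Fin 2) k) (hp : p ∈ forms k 1)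
    (hq : q ∈ forms k 1) (hp' : p' ∈ forms k 1) (hq' : q' ∈ forms k 1)
    (h0 : coordHom k p q p' = .X 0) (h1 : coordHom k p q q' = .X 1) :
    (linearHom p q hp hq).comp (linearHom p' q' hp' hq') = .id _ := by
  have h : (coordHom k p q).comp (coordHom k p' q') = .id _ :=
    MvPolynomial.ringHom_ext (fun c ↦ by simp [MvPolynomial.algebraMap_eq]) fun i ↦ by
      fin_cases i
      · simpa using h0
      · simpa using h1
  exact GradedRingHom.ext fun x ↦ congr($h x)

/-- The substitution `X₀ ↦ X₀ + c X₁`. -/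
def translationHom (c : k) : forms k →+*ᵍ forms k :=
  linearHom (translationForm c) (.X 1) (translationForm_mem_forms c) (X_mem_forms 1)

lemma translationHom_comp (c d : k) (h : c + d = 0) :
    (translationHom c).comp (translationHom d) = .id _ := by
  refine linearHom_comp_eq_id _ _ _ _ _ _ _ _ ?_ (by simp)
  rw [translationForm, translationForm, map_add, map_mul, coordHom_X0, coordHom_X1, coordHom_C, MvPolynomial.algebraMap_eq,
    add_assoc, ← add_mul, ← map_add, h, map_zero, zero_mul, add_zero]

/-- The translation `x ↦ x + c` of the projective line. -/
def translation (c : k) : P1 k ≅ P1 k :=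
  lineIso (translationHom c) (translationHom (-c)) (translationHom_comp _ _ (add_neg_cancel c))
    (translationHom_comp _ _ (neg_add_cancel c))

/-- The substitution `X₀ ↦ X₁`, `X₁ ↦ X₀`. -/
def inversionHom (k : Type u) [Field k] : forms k →+*ᵍ forms k :=
  linearHom (.X 1) (.X 0) (X_mem_forms 1) (X_mem_forms 0)

lemma inversionHom_comp : (inversionHom k).comp (inversionHom k) = .id _ :=
  linearHom_comp_eq_id _ _ _ _ _ _ _ _ (coordHom_X1 _ _) (coordHom_X0 _ _)

/-- The inversion `x ↦ 1 / x` of the projective line. -/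
def inversion (k : Type u) [Field k] : P1 k ≅ P1 k :=
  lineIso (inversionHom k) (inversionHom k) inversionHom_comp inversionHom_comp

@[simp] lemma translationHom_apply (c : k) (a : MvPolynomial (Fin 2) k) :
    translationHom c a = coordHom k (translationForm c) (.X 1) a := rfl

@[simp] lemma inversionHom_apply (a : MvPolynomial (Fin 2) k) :
    inversionHom k a = coordHom k (.X 1) (.X 0) a := rfl

lemma linePoint_translation (u : R) (c : k) :
    linePoint k u ≫ (translation c).hom = linePoint k (u + algebraMap k R c) := by
  rw [linePoint_eq_formPoint, linePoint_eq_formPoint]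
  refine formPoint_lineIso _ _ _ _ _ _ (coordHom_ext _ _ _ ?_ ?_ ?_) ..
  · intro c; simp [MvPolynomial.algebraMap_eq]
  · simp [translationForm]
  · simp

lemma linePoint_inversion (u v : R) (huv : u * v = 1) :
    linePoint k u ≫ (inversion k).hom = linePoint k v := by
  have hu : IsUnit u := IsUnit.of_mul_eq_one v huv
  rw [linePoint_eq_formPoint, linePoint_eq_formPoint]
  refine (formPoint_lineIso _ _ _ _ _ (coordHom k 1 u) (coordHom_ext _ _ _ ?_ ?_ ?_)
    (r' := MvPolynomial.X 1) _ (by simpa using hu) _ (X_mem_forms 1) _).trans ?_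
  · intro c; simp
  · simp
  · simp
  -- The coordinates `(1 : u)` rescaled by `v = 1/u` are `(v : 1)`.
  · refine projPoint_eq_of_smul (forms k) _ _ v (fun n a ha ↦ ?_) ..
    rw [← coordHom_smul _ _ _ _ _ ha, mul_one, mul_comm v u, huv]

lemma translation_toSpec (c : k) : (translation c).hom ≫ P1.toSpec k = P1.toSpec k :=
  lineIso_toSpec _ _ _ _ (by simp [MvPolynomial.algebraMap_eq])

lemma inversion_toSpec : (inversion k).hom ≫ P1.toSpec k = P1.toSpec k :=
  lineIso_toSpec _ _ _ _ (by simp [MvPolynomial.algebraMap_eq])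

end ProjectiveLine

lemma isDominant_SpecMap_of_injective {R S : Type u} [CommRing R] [CommRing S] (φ : R →+* S)
    (h : Function.Injective φ) : IsDominant (Spec.map (CommRingCat.ofHom φ)) := by
  refine ⟨(PrimeSpectrum.denseRange_comap_iff_ker_le_nilRadical φ).mpr ?_⟩
  rw [(RingHom.injective_iff_ker_eq_bot φ).mp h]
  exact bot_le

/-! ### The squaring map of the projective line -/

section Squaring

variable {k : Type u} [Field k]

/-- The two standard affine charts of the projective line: the coordinate is `1 / x` on the chart
`0` and `x` on the chart `1`. -/
def chart (k : Type u) [Field k] : Fin 2 → (Spec (.of k[X]) ⟶ P1 k)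
  | 0 => lineChart k ≫ (inversion k).hom
  | 1 => lineChart k

instance (i : Fin 2) : IsOpenImmersion (chart k i) := by
  fin_cases i
  · exact inferInstanceAs (IsOpenImmersion (lineChart k ≫ (inversion k).hom))
  · exact inferInstanceAs (IsOpenImmersion (lineChart k))

lemma inversion_preimage_standardOpen (i : Fin 2) :
    (inversion k).hom ⁻¹ᵁ standardOpen k i = standardOpen k (1 - i) := by
  refine (Proj.map_preimage_basicOpen (inversionHom k) _ (MvPolynomial.X i)).trans ?_
  rw [standardOpen, inversionHom_apply]
  fin_cases i
  · exact congrArg _ (coordHom_X0 _ _)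
  · exact congrArg _ (coordHom_X1 _ _)

lemma chart_opensRange (i : Fin 2) : (chart k i).opensRange = standardOpen k i := by
  fin_cases i
  · have h : (inversion k).hom ⁻¹ᵁ standardOpen k 0 = standardOpen k 1 :=
      inversion_preimage_standardOpen 0
    have h2 : (lineChart k ≫ (inversion k).hom).opensRange = standardOpen k 0 := by
      rw [Scheme.Hom.opensRange_comp, lineChart_opensRange, ← h]
      rw [Scheme.Hom.image_preimage_eq_opensRange_inf, Scheme.Hom.opensRange_of_isIso, top_inf_eq]
    exact h2
  · exact lineChart_opensRange

lemma chart_preimage_standardOpen (i j : Fin 2) (h : i ≠ j) :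
    chart k i ⁻¹ᵁ standardOpen k j = PrimeSpectrum.basicOpen (X : k[X]) := by
  have h1 : (lineChart k ≫ (inversion k).hom) ⁻¹ᵁ standardOpen k 1 =
      PrimeSpectrum.basicOpen (X : k[X]) := by
    rw [Scheme.Hom.comp_preimage, inversion_preimage_standardOpen]
    exact lineChart_preimage_standardOpen_zero
  fin_cases i <;> fin_cases j
  · exact absurd rfl h
  · exact h1
  · exact lineChart_preimage_standardOpen_zero
  · exact absurd rfl h

lemma exists_chart_eq (p : P1 k) : ∃ i y, chart k i y = p := by
  have h : p ∈ ⨆ i, standardOpen k i := by rw [iSup_standardOpen]; trivial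
  obtain ⟨i, hi⟩ := TopologicalSpace.Opens.mem_iSup.mp h
  rw [← chart_opensRange] at hi
  exact ⟨i, hi⟩

/-- The cover of the projective line by the two standard charts. -/
def chartCover (k : Type u) [Field k] : (P1 k).OpenCover :=
  Scheme.Cover.mkOfCovers (Fin 2) (fun _ ↦ Spec (.of k[X])) (chart k) exists_chart_eq

lemma SpecMap_chart {K : Type u} [Field K] [Algebra k K] (i : Fin 2) (u v : K) (huv : u * v = 1) :
    Spec.map (CommRingCat.ofHom (aeval (R := k) u).toRingHom) ≫ chart k i =
      linePoint k (![v, u] i) := by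
  fin_cases i
  · exact (Category.assoc _ _ _).symm.trans (linePoint_inversion u v huv)
  · rfl

/-- The squaring map of the affine line. -/
def affineSquaring (k : Type u) [Field k] : Spec (.of k[X]) ⟶ Spec (.of k[X]) :=
  Spec.map (CommRingCat.ofHom (aeval (R := k) (X ^ 2 : k[X])).toRingHom)

lemma SpecMap_affineSquaring {R : Type u} [CommRing R] [Algebra k R] (u : R) :
    Spec.map (CommRingCat.ofHom (aeval (R := k) u).toRingHom) ≫ affineSquaring k =
      Spec.map (CommRingCat.ofHom (aeval (R := k) (u ^ 2)).toRingHom) := by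
  rw [affineSquaring, ← Spec.map_comp, ← CommRingCat.ofHom_comp]
  congr 2
  ext <;> simp

/-- The overlap of the two charts is reduced and `Spec k(X)` is dense in it, so agreement may be
tested at the generic point, where it says that the inverse of `(1/u)²` is `u²`. -/
lemma pullback_fst_affineSquaring (i j : Fin 2) :
    pullback.fst (chart k i) (chart k j) ≫ affineSquaring k ≫ chart k i =
      pullback.snd (chart k i) (chart k j) ≫ affineSquaring k ≫ chart k j := by
  by_cases h : i = j
  · subst h
    have : pullback.fst (chart k i) (chart k i) = pullback.snd (chart k i) (chart k i) := by
      rw [← cancel_mono (chart k i), pullback.condition]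
    rw [this]
  let K := FractionRing k[X]
  let u : K := algebraMap k[X] K X
  have hu : u ≠ 0 := by
    rw [Ne, map_eq_zero_iff _ (IsFractionRing.injective k[X] K)]
    exact X_ne_zero
  -- The value of the coordinate of chart `i` at the generic point.
  let w : Fin 2 → K := ![u⁻¹, u]
  have hw : ∀ i, ∃ v, w i * v = 1 := fun i ↦ ⟨(w i)⁻¹, by
    refine mul_inv_cancel₀ ?_
    fin_cases i
    · exact inv_ne_zero hu
    · exact hu⟩
  let η := fun i ↦ Spec.map (CommRingCat.ofHom (aeval (R := k) (w i)).toRingHom)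
  have hη : ∀ i, η i ≫ chart k i = linePoint k u := by
    intro i
    fin_cases i
    · exact SpecMap_chart 0 _ u (inv_mul_cancel₀ hu)
    · exact SpecMap_chart 1 _ u⁻¹ (mul_inv_cancel₀ hu)
  have hη2 : ∀ i, η i ≫ affineSquaring k ≫ chart k i = linePoint k (u ^ 2) := by
    intro i
    rw [← Category.assoc, SpecMap_affineSquaring]
    fin_cases i
    · exact SpecMap_chart 0 _ (u ^ 2) (by
        change u⁻¹ ^ 2 * u ^ 2 = 1
        rw [← mul_pow, inv_mul_cancel₀ hu, one_pow])
    · exact SpecMap_chart 1 _ (u⁻¹ ^ 2) (by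
        change u ^ 2 * u⁻¹ ^ 2 = 1
        rw [← mul_pow, mul_inv_cancel₀ hu, one_pow])
  have hdom : ∀ i, IsDominant (η i) := by
    intro i
    refine isDominant_SpecMap_of_injective _ (transcendental_iff_injective.mp ?_)
    have hX : Transcendental k u :=
      (transcendental_algebraMap_iff (IsFractionRing.injective k[X] K)).mpr (transcendental_X k)
    fin_cases i
    · exact fun h ↦ hX (IsAlgebraic.inv_iff.mp h)
    · exact hX
  let ι : Spec (.of K) ⟶ pullback (chart k i) (chart k j) :=
    pullback.lift (η i) (η j) (by rw [hη, hη])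
  have : IsDominant (ι ≫ pullback.fst (chart k i) (chart k j)) := by
    rw [pullback.lift_fst]; exact hdom i
  have : IsDominant ι := IsDominant.of_comp_of_isOpenImmersion ι (pullback.fst _ _)
  have : IsReduced (pullback (chart k i) (chart k j)) :=
    isReduced_of_isOpenImmersion (pullback.fst (chart k i) (chart k j))
  refine ext_of_isDominant ι ?_
  rw [pullback.lift_fst_assoc, pullback.lift_snd_assoc, hη2, hη2]

/-- The squaring map `x ↦ x²` of the projective line. -/
def squaring (k : Type u) [Field k] : P1 k ⟶ P1 k :=
  (chartCover k).glueMorphisms (fun i ↦ affineSquaring k ≫ chart k i) pullback_fst_affineSquaring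

lemma chart_squaring (i : Fin 2) : chart k i ≫ squaring k = affineSquaring k ≫ chart k i :=
  (chartCover k).ι_glueMorphisms _ _ i

lemma linePoint_squaring {R : Type u} [CommRing R] [Algebra k R] (u : R) :
    linePoint k u ≫ squaring k = linePoint k (u ^ 2) := by
  rw [linePoint, Category.assoc, linePoint, ← SpecMap_affineSquaring, Category.assoc]
  exact congrArg _ (chart_squaring 1)

lemma chart_toSpec (i : Fin 2) :
    chart k i ≫ P1.toSpec k = Spec.map (CommRingCat.ofHom (algebraMap k k[X])) := by
  have h : lineChart k ≫ P1.toSpec k = Spec.map (CommRingCat.ofHom (algebraMap k k[X])) := by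
    rw [lineChart_eq_linePoint, linePoint_toSpec]
  fin_cases i
  · refine (Category.assoc _ _ _).trans ?_
    rw [inversion_toSpec, h]
  · exact h

lemma squaring_toSpec : squaring k ≫ P1.toSpec k = P1.toSpec k := by
  have key : ∀ i, chart k i ≫ squaring k ≫ P1.toSpec k = chart k i ≫ P1.toSpec k := by
    intro i
    rw [reassoc_of% chart_squaring, chart_toSpec, affineSquaring, ← Spec.map_comp, ← CommRingCat.ofHom_comp]
    congr 2
    ext
    simp [Polynomial.algebraMap_eq]
  exact (chartCover k).hom_ext _ _ key

/-- The function `x²` vanishes, or is infinite, exactly where `x` is. Hence squaring is the base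
change of `affineSquaring` over each chart, which gives integrality of the global map. -/
lemma squaring_preimage_standardOpen (i : Fin 2) :
    squaring k ⁻¹ᵁ standardOpen k i = standardOpen k i := by
  have key : ∀ j, chart k j ⁻¹ᵁ (squaring k ⁻¹ᵁ standardOpen k i) =
      chart k j ⁻¹ᵁ standardOpen k i := by
    intro j
    rw [← Scheme.Hom.comp_preimage, chart_squaring, Scheme.Hom.comp_preimage]
    by_cases h : j = i
    · subst h
      rw [← chart_opensRange, Scheme.Hom.preimage_opensRange]
      rfl
    · rw [chart_preimage_standardOpen j i h]
      refine (SpecMap_preimage_basicOpen _ _).trans ?_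
      have : (CommRingCat.ofHom (aeval (R := k) (X ^ 2 : k[X])).toRingHom).hom X = X ^ 2 := by simp
      rw [this]
      exact PrimeSpectrum.basicOpen_pow _ 2 two_pos
  ext p
  obtain ⟨j, y, rfl⟩ := exists_chart_eq p
  exact congr(y ∈ $(key j)).to_iff

instance : IsIntegralHom (affineSquaring k) := by
  refine (IsIntegralHom.SpecMap_iff).mpr ?_
  intro p
  induction p using Polynomial.induction_on' with
  | add p q hp hq => exact hp.add _ hq
  | monomial n a =>
    rw [← C_mul_X_pow_eq_monomial]
    refine RingHom.IsIntegralElem.mul _ ?_ ?_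
    · have : (C a : k[X]) = (aeval (R := k) (X ^ 2 : k[X])).toRingHom (C a) := by simp
      rw [this]
      exact RingHom.isIntegralElem_map _
    -- The coordinate `x` is a root of the monic polynomial `T² - x²`, whose coefficients lie in the
    -- image `k[x²]`.
    · have hX : (aeval (R := k) (X ^ 2 : k[X])).toRingHom.IsIntegralElem X :=
        ⟨X ^ 2 - C X, monic_X_pow_sub_C _ two_ne_zero, by simp⟩
      induction n with
      | zero => simpa using RingHom.isIntegralElem_one _
      | succ n ih => exact ih.mul _ hX

instance : IsIntegralHom (squaring k) := by
  have key : ∀ i, IsIntegralHom (pullback.snd (squaring k) (chart k i)) := by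
    intro i
    have h : IsPullback (affineSquaring k) (chart k i) (chart k i) (squaring k) :=
      IsOpenImmersion.isPullback _ _ _ _ (chart_squaring i) (by
        rw [chart_opensRange, squaring_preimage_standardOpen])
    rw [← h.flip.isoPullback_inv_snd]
    infer_instance
  have : IsZariskiLocalAtTarget @IsIntegralHom :=
    (HasAffineProperty.iff.mp IsIntegralHom.hasAffineProperty).1
  exact IsZariskiLocalAtTarget.of_openCover (chartCover k) key

end Squaring

/-! ### Generic points and lifting isomorphisms to normalizations -/

section GenericPoint

variable {X Y Z : Scheme.{u}}

lemma exists_iso_fromSpecStalk (f : X ⟶ Y) [IsOpenImmersion f] (x : X) (y : Y) (h : f x = y) :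
    ∃ e : Spec (X.presheaf.stalk x) ≅ Spec (Y.presheaf.stalk y),
      e.hom ≫ Y.fromSpecStalk y = X.fromSpecStalk x ≫ f := by
  subst h
  exact ⟨asIso (Spec.map (f.stalkMap x)), Scheme.SpecMap_stalkMap_fromSpecStalk f⟩

lemma exists_iso_genericInclusion [IrreducibleSpace X] [IrreducibleSpace Y] (f : X ⟶ Y)
    [IsOpenImmersion f] :
    ∃ e : Spec (X.presheaf.stalk (genericPoint X)) ≅ Spec (Y.presheaf.stalk (genericPoint Y)),
      e.hom ≫ genericInclusion Y = genericInclusion X ≫ f :=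
  exists_iso_fromSpecStalk f _ _ (genericPoint_eq_of_isOpenImmersion f)

lemma exists_iso_SpecMap_algebraMap (A : CommRingCat.{u}) (K : Type u) [IsDomain A] [Field K]
    [Algebra A K] [IsFractionRing A K] :
    ∃ e : Spec (.of K) ≅ Spec ((Spec A).presheaf.stalk (genericPoint (Spec A))),
      e.hom ≫ genericInclusion (Spec A) = Spec.map (CommRingCat.ofHom (algebraMap A K)) := by
  let e : (Spec A).functionField ≃ₐ[A] K :=
    IsLocalization.algEquiv (nonZeroDivisors A) (Spec A).functionField K
  have h : genericInclusion (Spec A) =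
      Spec.map (CommRingCat.ofHom (algebraMap A (Spec A).functionField)) :=
    Spec.fromSpecStalk_eq' ..
  refine ⟨Scheme.Spec.mapIso (e.toRingEquiv.toCommRingCatIso).op, ?_⟩
  rw [h]
  refine (Spec.map_comp _ _).symm.trans ?_
  congr 1
  ext a
  exact e.commutes a

/-- The function field of an integral scheme is the fraction field of any affine chart. -/
lemma exists_iso_of_chart {A : Type u} (K : Type u) [CommRing A] [IsDomain A] [Field K]
    [Algebra A K] [IsFractionRing A K] [IrreducibleSpace X] (j : Spec (.of A) ⟶ X)
    [IsOpenImmersion j] :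
    ∃ e : Spec (.of K) ≅ Spec (X.presheaf.stalk (genericPoint X)),
      e.hom ≫ genericInclusion X = Spec.map (CommRingCat.ofHom (algebraMap A K)) ≫ j := by
  have : IsDomain (CommRingCat.of A) := ‹IsDomain A›
  obtain ⟨e, he⟩ := exists_iso_SpecMap_algebraMap (.of A) K
  obtain ⟨d, hd⟩ := exists_iso_genericInclusion j
  exact ⟨e ≪≫ d, by simp [hd, reassoc_of% he]⟩

instance [IrreducibleSpace X] : Mono (genericInclusion X) :=
  inferInstanceAs (Mono (X.fromSpecStalk (genericPoint X)))

instance [IsIntegral X] : IsIntegral (Spec (X.presheaf.stalk (genericPoint X))) := inferInstance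

instance [IsIntegral X] [X.IsSeparated] : IsIntegral (normalization X) :=
  inferInstanceAs (IsIntegral (genericInclusion X).normalization)

instance [IsIntegral X] [X.IsSeparated] : IsIntegralHom (normalizationMap X) :=
  inferInstanceAs (IsIntegralHom (genericInclusion X).fromNormalization)

/-- The inclusion of the generic point in the normalization. -/
def toNormalization (X : Scheme.{u}) [IsIntegral X] [X.IsSeparated] :
    Spec (X.presheaf.stalk (genericPoint X)) ⟶ normalization X :=
  (genericInclusion X).toNormalization

instance [IsIntegral X] [X.IsSeparated] : IsDominant (toNormalization X) :=
  inferInstanceAs (IsDominant (genericInclusion X).toNormalization)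

@[simp]
lemma toNormalization_normalizationMap [IsIntegral X] [X.IsSeparated] :
    toNormalization X ≫ normalizationMap X = genericInclusion X :=
  Scheme.Hom.toNormalization_fromNormalization _

lemma isSeparated_of_isAffineHom (f : X ⟶ Y) [IsAffineHom f] [Y.IsSeparated] : X.IsSeparated :=
  have : IsSeparated (f ≫ terminal.from Y) := inferInstance
  ⟨(terminal.hom_ext _ _ : f ≫ terminal.from Y = terminal.from X) ▸ this⟩

instance [IsIntegral X] [X.IsSeparated] : (normalization X).IsSeparated :=
  isSeparated_of_isAffineHom (normalizationMap X)

/-- `m` is the morphism of normalizations induced by the morphism `α`. -/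
def IsNormalizationLift [IsIntegral X] [X.IsSeparated] [IsIntegral Y] [Y.IsSeparated]
    (α : X ⟶ Y) (m : normalization X ⟶ normalization Y) : Prop :=
  m ≫ normalizationMap Y = normalizationMap X ≫ α ∧
    ∃ e : Spec (X.presheaf.stalk (genericPoint X)) ⟶ Spec (Y.presheaf.stalk (genericPoint Y)),
      e ≫ genericInclusion Y = genericInclusion X ≫ α ∧
      toNormalization X ≫ m = e ≫ toNormalization Y

section

variable [IsIntegral X] [X.IsSeparated] [IsIntegral Y] [Y.IsSeparated] [IsIntegral Z]
  [Z.IsSeparated]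

lemma IsNormalizationLift.id : IsNormalizationLift (𝟙 X) (𝟙 _) :=
  ⟨by simp, 𝟙 _, by simp, by simp⟩

lemma IsNormalizationLift.comp {α : X ⟶ Y} {β : Y ⟶ Z} {m : normalization X ⟶ normalization Y}
    {n : normalization Y ⟶ normalization Z} (h : IsNormalizationLift α m)
    (h' : IsNormalizationLift β n) : IsNormalizationLift (α ≫ β) (m ≫ n) := by
  obtain ⟨h1, e, h2, h3⟩ := h
  obtain ⟨h1', e', h2', h3'⟩ := h'
  refine ⟨?_, e ≫ e', ?_, ?_⟩
  · rw [Category.assoc, h1', reassoc_of% h1]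
  · rw [Category.assoc, h2', reassoc_of% h2]
  · rw [reassoc_of% h3, h3', Category.assoc]

/-- The map `e` of generic points is forced because the inclusion of the generic point is a
monomorphism, and the generic point is dense in the normalization. -/
lemma IsNormalizationLift.unique {α : X ⟶ Y} {m n : normalization X ⟶ normalization Y}
    (h : IsNormalizationLift α m) (h' : IsNormalizationLift α n) : m = n := by
  obtain ⟨-, e, h2, h3⟩ := h
  obtain ⟨-, e', h2', h3'⟩ := h'
  have he : e = e' := by rw [← cancel_mono (genericInclusion Y), h2, h2']
  refine ext_of_isDominant (toNormalization X) ?_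
  rw [h3, h3', he]

/-- The normalization map is dominant, since its image contains the generic point; so distinct
morphisms cannot have a common lift. -/
lemma IsNormalizationLift.injective {α β : X ⟶ Y} {m : normalization X ⟶ normalization Y}
    (h : IsNormalizationLift α m) (h' : IsNormalizationLift β m) : α = β := by
  have : IsDominant (normalizationMap X) := by
    have : IsDominant (toNormalization X ≫ normalizationMap X) := by
      rw [toNormalization_normalizationMap]
      refine ⟨dense_iff_closure_eq.mpr (Set.eq_univ_of_univ_subset ?_)⟩
      rw [← (genericPoint_spec X).def]
      exact closure_mono (Set.singleton_subset_iff.mpr ⟨_, Scheme.fromSpecStalk_closedPoint⟩)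
    exact IsDominant.of_comp (toNormalization X) _
  refine ext_of_isDominant (normalizationMap X) ?_
  rw [← h.1, ← h'.1]

/-- Both normalizations are the normalization of `Y` along the generic point of `X`: by transitivity
along the integral morphism `α` on one side, by the identification of generic points on the other.
-/
lemma exists_isNormalizationLift (α : X ⟶ Y) [IsIso α] : ∃ m, IsNormalizationLift α m := by
  obtain ⟨e, he⟩ := exists_iso_genericInclusion α
  have h1 : IsAffineHom (genericInclusion X ≫ α) := inferInstance
  let a : (genericInclusion X ≫ α).normalization ≅ normalization X :=
    normalizationCompIso (genericInclusion X ≫ α) (genericInclusion X) α rfl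
  let b : (genericInclusion X ≫ α).normalization ≅ normalization Y :=
    normalizationIsoOfIso (genericInclusion X ≫ α) (genericInclusion Y) e he.symm
  have ha : a.hom ≫ normalizationMap X ≫ α = (genericInclusion X ≫ α).fromNormalization :=
    normalizationCompIso_hom_comp ..
  have ha' : (genericInclusion X ≫ α).toNormalization ≫ a.hom = toNormalization X :=
    toNormalization_normalizationCompIso_hom ..
  have hb : b.hom ≫ normalizationMap Y = (genericInclusion X ≫ α).fromNormalization :=
    normalizationIsoOfIso_hom_comp ..
  have hb' : (genericInclusion X ≫ α).toNormalization ≫ b.hom = e.hom ≫ toNormalization Y :=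
    toNormalization_normalizationIsoOfIso_hom ..
  exact ⟨a.inv ≫ b.hom, by rw [Category.assoc, Iso.inv_comp_eq, hb, ha], e.hom, he, by
    rw [← ha', Category.assoc, Iso.hom_inv_id_assoc, hb']⟩

end

end GenericPoint

/-- Here `K` may be larger than the fraction field of `R`. The equation `h` places `w` in the copy
of `Frac R` inside `K`, where integral closedness applies. -/
lemma exists_algebraMap_eq_of_isIntegral_of_mul_eq {R K : Type*} [CommRing R] [IsDomain R]
    [IsIntegrallyClosed R] [Field K] [Algebra R K]
    (inj : Function.Injective (algebraMap R K)) {p e : R} (he : e ≠ 0) {w : K}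
    (h : w * algebraMap R K e = algebraMap R K p) (hw : IsIntegral R w) :
    ∃ r, algebraMap R K r = w := by
  let K₀ := FractionRing R
  let j : K₀ →ₐ[R] K := IsFractionRing.liftAlgHom (g := Algebra.ofId R K) inj
  have hj : j (algebraMap R K₀ p / algebraMap R K₀ e) = w := by
    have he' : algebraMap R K e ≠ 0 := fun h0 ↦ he (inj (by rw [h0, map_zero]))
    rw [map_div₀, AlgHom.commutes, AlgHom.commutes, div_eq_iff he', h]
  rw [← hj, isIntegral_algHom_iff j j.injective, IsIntegrallyClosed.isIntegral_iff] at hw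
  obtain ⟨r, hr⟩ := hw
  exact ⟨r, by rw [← hj, ← hr, AlgHom.commutes]⟩

/-! ### The coordinate ring and the function field of `y² = f(x)` -/

section AffineRing

variable {k : Type u} [Field k]

lemma affineRing_monic (f : k[X]) : ((X : k[X][X]) ^ 2 - C f).Monic :=
  monic_X_pow_sub_C f two_ne_zero

lemma affineRing_root_sq (f : k[X]) :
    AdjoinRoot.root ((X : k[X][X]) ^ 2 - C f) ^ 2 = AdjoinRoot.of _ f := by
  have := AdjoinRoot.eval₂_root ((X : k[X][X]) ^ 2 - C f)
  simpa [sub_eq_zero] using this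

lemma exists_affineRing_eq {f : k[X]} (a : affineRing f) :
    ∃ p q : k[X], a = AdjoinRoot.of _ p + AdjoinRoot.of _ q * AdjoinRoot.root _ := by
  obtain ⟨P, rfl⟩ := AdjoinRoot.mk_surjective a
  have hm := affineRing_monic f
  rw [← AdjoinRoot.mk_leftInverse hm (AdjoinRoot.mk _ P)]
  set Q := AdjoinRoot.modByMonicHom hm (AdjoinRoot.mk _ P) with hQ
  have hd : Q.natDegree ≤ 1 := by
    rw [hQ, AdjoinRoot.modByMonicHom_mk]
    have := natDegree_modByMonic_lt P hm (by
      intro h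
      have := congrArg natDegree h
      rw [natDegree_X_pow_sub_C] at this
      simp at this)
    rw [natDegree_X_pow_sub_C] at this
    omega
  refine ⟨Q.coeff 0, Q.coeff 1, ?_⟩
  conv_lhs => rw [eq_X_add_C_of_natDegree_le_one hd]
  simp [add_comm]

lemma affineRing_add_mul_root_eq_zero {f p q : k[X]}
    (h : AdjoinRoot.of ((X : k[X][X]) ^ 2 - C f) p + AdjoinRoot.of _ q * AdjoinRoot.root _ = 0) :
    p = 0 ∧ q = 0 := by
  have h2 : AdjoinRoot.mk ((X : k[X][X]) ^ 2 - C f) (C q * X + C p) = 0 := by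
    simpa [add_comm] using h
  rw [AdjoinRoot.mk_eq_zero] at h2
  have h3 : (C q * X + C p : k[X][X]) = 0 := by
    by_contra h0
    refine (affineRing_monic f).not_dvd_of_natDegree_lt h0 ?_ h2
    rw [natDegree_X_pow_sub_C]
    exact lt_of_le_of_lt natDegree_linear_le one_lt_two
  exact ⟨by simpa using congrArg (coeff · 0) h3, by simpa using congrArg (coeff · 1) h3⟩

lemma not_sq_of_squarefree {f : k[X]} (hf : Squarefree f) (hd : 0 < f.natDegree) (a : k[X]) :
    a ^ 2 ≠ f := by
  rintro rfl
  have := natDegree_eq_zero_of_isUnit (hf a (by rw [sq]))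
  rw [natDegree_pow, this] at hd
  simp at hd

/-- A monic quadratic without roots is irreducible, and a nonconstant square-free `f` is not a
square. -/
lemma affineRing_isDomain {f : k[X]} (hf : Squarefree f) (hd : 0 < f.natDegree) :
    IsDomain (affineRing f) := by
  refine AdjoinRoot.isDomain_of_prime (Irreducible.prime ?_)
  rw [(affineRing_monic f).irreducible_iff_roots_eq_zero_of_degree_le_three
    (by rw [natDegree_X_pow_sub_C]) (by rw [natDegree_X_pow_sub_C]; norm_num)]
  refine Multiset.eq_zero_of_forall_notMem fun a ha ↦ ?_
  have := (mem_roots'.mp ha).2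
  exact not_sq_of_squarefree hf hd a (by simpa [sub_eq_zero] using this)

/-- Dividing `e` and `q` by their gcd gives coprime `a`, `b` with `a² ∣ b² f`, hence `a² ∣ f`, so
`a` is a unit. -/
lemma dvd_of_sq_dvd_sq_mul {f : k[X]} (hf : Squarefree f) {e q : k[X]} (he : e ≠ 0)
    (h : e ^ 2 ∣ q ^ 2 * f) : e ∣ q := by
  classical
  obtain ⟨a, ha⟩ := EuclideanDomain.gcd_dvd_left e q
  obtain ⟨b, hb⟩ := EuclideanDomain.gcd_dvd_right e q
  set g := EuclideanDomain.gcd e q with hg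
  have hg0 : g ≠ 0 := fun h0 ↦ he (by rw [ha, h0, zero_mul])
  have hab : IsCoprime a b := by
    refine ⟨EuclideanDomain.gcdA e q, EuclideanDomain.gcdB e q, mul_left_cancel₀ hg0 ?_⟩
    have := EuclideanDomain.gcd_eq_gcd_ab e q
    rw [← hg] at this
    linear_combination -this + EuclideanDomain.gcdA e q * (-ha) + EuclideanDomain.gcdB e q * (-hb)
  have h3 : a ^ 2 ∣ b ^ 2 * f := by
    rw [ha, hb, mul_pow, mul_pow, mul_assoc] at h
    exact (mul_dvd_mul_iff_left (pow_ne_zero 2 hg0)).mp h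
  have h4 : a ^ 2 ∣ f := (hab.pow (m := 2) (n := 2)).dvd_of_dvd_mul_left h3
  have hu : IsUnit a := hf a (by rwa [← sq])
  rw [ha, hb]
  exact mul_dvd_mul_left g hu.dvd

/-- `x` and `y` generate the field `K` over `k` with the single relation `y² = f(x)`. -/
structure IsHyperellipticPair (f : k[X]) {K : Type u} [Field K] [Algebra k K] (x y : K) :
    Prop where
  sq : y ^ 2 = aeval x f
  indep : ∀ p q : k[X], aeval x p + aeval x q * y = 0 → p = 0 ∧ q = 0
  gen : ∀ z : K, ∃ p q e : k[X], e ≠ 0 ∧ z * aeval x e = aeval x p + aeval x q * y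

variable {K L : Type u} [Field K] [Algebra k K] [Field L] [Algebra k L]

/-- Multiplying the relation by its conjugate gives `p² = q² f`, which would make `f` a square
unless `q = 0`. -/
lemma indep_of_squarefree {f : k[X]} (hf : Squarefree f) (hd : 0 < f.natDegree) {x y : K}
    (hx : Transcendental k x) (hy : y ^ 2 = aeval x f) (p q : k[X])
    (h : aeval x p + aeval x q * y = 0) : p = 0 ∧ q = 0 := by
  have inj := transcendental_iff_injective.mp hx
  have h2 : p ^ 2 = q ^ 2 * f := by
    refine inj ?_
    rw [map_mul, map_pow, map_pow, ← hy]
    linear_combination (aeval x p - aeval x q * y) * h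
  have hq : q = 0 := by
    by_contra hq
    obtain ⟨r, rfl⟩ := (UniqueFactorizationMonoid.pow_dvd_pow_iff_dvd two_ne_zero).mp
      (Dvd.intro _ h2.symm)
    rw [mul_pow] at h2
    exact not_sq_of_squarefree hf hd r (mul_left_cancel₀ (pow_ne_zero 2 hq) h2)
  subst hq
  refine ⟨?_, rfl⟩
  simpa using h2

/-- Evaluation of the coordinate ring of `y² = f(x)` at a point. -/
def evalPoint (f : k[X]) (x y : K) (h : y ^ 2 = aeval x f) : affineRing f →ₐ[k] K :=
  AdjoinRoot.liftAlgHom _ (aeval x) y (by simp [h])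

@[simp] lemma evalPoint_of (f : k[X]) (x y : K) (h : y ^ 2 = aeval x f) (p : k[X]) :
    evalPoint f x y h (AdjoinRoot.of _ p) = aeval x p := by
  simp [evalPoint]

@[simp] lemma evalPoint_root (f : k[X]) (x y : K) (h : y ^ 2 = aeval x f) :
    evalPoint f x y h (AdjoinRoot.root _) = y := by
  simp [evalPoint]

lemma evalPoint_injective (f : k[X]) (x y : K) (h : y ^ 2 = aeval x f)
    (hi : ∀ p q : k[X], aeval x p + aeval x q * y = 0 → p = 0 ∧ q = 0) :
    Function.Injective (evalPoint f x y h) := by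
  rw [injective_iff_map_eq_zero]
  intro a ha
  obtain ⟨p, q, rfl⟩ := exists_affineRing_eq a
  obtain ⟨rfl, rfl⟩ := hi p q (by simpa using ha)
  simp

namespace IsHyperellipticPair

variable {f : k[X]} {x y : K}

lemma transcendental (h : IsHyperellipticPair f x y) : Transcendental k x :=
  transcendental_iff.mpr fun p hp ↦ (h.indep p 0 (by simp [hp])).1

lemma aeval_ne_zero (h : IsHyperellipticPair f x y) {p : k[X]} (hp : p ≠ 0) : aeval x p ≠ 0 :=
  fun h0 ↦ hp (transcendental_iff.mp h.transcendental p h0)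

lemma isFractionRing (h : IsHyperellipticPair f x y) :
    letI := (evalPoint f x y h.sq).toAlgebra
    IsFractionRing (affineRing f) K := by
  let := (evalPoint f x y h.sq).toAlgebra
  have inj : Function.Injective (algebraMap (affineRing f) K) :=
    evalPoint_injective f x y h.sq h.indep
  have : FaithfulSMul (affineRing f) K := (faithfulSMul_iff_algebraMap_injective _ _).mpr inj
  refine IsFractionRing.of_field _ _ fun z ↦ ?_
  obtain ⟨p, q, e, he, hz⟩ := h.gen z
  refine ⟨AdjoinRoot.of _ p + AdjoinRoot.of _ q * AdjoinRoot.root _, AdjoinRoot.of _ e, ?_⟩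
  have h1 : algebraMap (affineRing f) K (AdjoinRoot.of _ e) = aeval x e := evalPoint_of ..
  have h2 : algebraMap (affineRing f) K (AdjoinRoot.of _ p + AdjoinRoot.of _ q *
      AdjoinRoot.root _) = aeval x p + aeval x q * y := by
    change evalPoint f x y h.sq _ = _
    simp
  rw [h1, h2, ← hz, mul_div_cancel_right₀ _ (h.aeval_ne_zero he)]

lemma exists_algHom (h : IsHyperellipticPair f x y) {x' y' : L} (hsq : y' ^ 2 = aeval x' f)
    (hi : ∀ p q : k[X], aeval x' p + aeval x' q * y' = 0 → p = 0 ∧ q = 0) :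
    ∃ φ : K →ₐ[k] L, φ x = x' ∧ φ y = y' := by
  let := (evalPoint f x y h.sq).toAlgebra
  have := h.isFractionRing
  have : IsScalarTower k (affineRing f) K :=
    IsScalarTower.of_algebraMap_eq fun c ↦ ((evalPoint f x y h.sq).commutes c).symm
  have inj := evalPoint_injective f x' y' hsq hi
  let φ : K →ₐ[k] L := IsFractionRing.liftAlgHom (g := evalPoint f x' y' hsq) inj
  have key : ∀ a : affineRing f, φ (evalPoint f x y h.sq a) = evalPoint f x' y' hsq a := fun a ↦
    IsFractionRing.lift_algebraMap inj a
  refine ⟨φ, ?_, ?_⟩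
  · simpa using key (AdjoinRoot.of _ X)
  · simpa using key (AdjoinRoot.root _)

lemma exists_conj (h : IsHyperellipticPair f x y) :
    ∃ φ : K →ₐ[k] K, φ x = x ∧ φ y = -y :=
  h.exists_algHom (by rw [neg_sq, h.sq]) fun p q hpq ↦ by
    simpa using h.indep p (-q) (by simpa using hpq)

lemma map (h : IsHyperellipticPair f x y) (φ : K ≃ₐ[k] L) : IsHyperellipticPair f (φ x) (φ y) where
  sq := by rw [← map_pow, h.sq, aeval_algHom_apply]
  indep p q hpq := h.indep p q (φ.injective (by simpa [aeval_algHom_apply] using hpq))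
  gen z := by
    obtain ⟨p, q, e, he, hz⟩ := h.gen (φ.symm z)
    refine ⟨p, q, e, he, ?_⟩
    have := congrArg φ hz
    simpa [aeval_algHom_apply] using this

/-- The affine curve `y² = f(x)` is normal. -/
lemma exists_evalPoint_eq_of_isIntegral (h : IsHyperellipticPair f x y) (hf : Squarefree f)
    (h2 : (2 : k) ≠ 0) (z : K) (hz : (aeval (R := k) x).toRingHom.IsIntegralElem z) :
    ∃ a, evalPoint f x y h.sq a = z := by
  let : Algebra k[X] K := (aeval (R := k) x).toRingHom.toAlgebra
  have hmap : ∀ p, algebraMap k[X] K p = aeval x p := fun _ ↦ rfl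
  have h2K : (2 : K) ≠ 0 := by
    rw [← map_ofNat (algebraMap k K) 2]
    exact (_root_.map_ne_zero _).mpr h2
  have inj : Function.Injective (algebraMap k[X] K) :=
    transcendental_iff_injective.mp h.transcendental
  obtain ⟨φ, hφx, hφy⟩ := h.exists_conj
  have hφ : ∀ p : k[X], φ (aeval x p) = aeval x p := fun p ↦ by
    rw [← aeval_algHom_apply, hφx]
  let φ' : K →ₐ[k[X]] K := { φ with commutes' := hφ }
  have hzi : IsIntegral k[X] z := hz
  have hz' : IsIntegral k[X] (φ z) := hzi.map φ'
  obtain ⟨p, q, e, he, hzpq⟩ := h.gen z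
  have he' := h.aeval_ne_zero he
  have hφz : φ z * aeval x e = aeval x p - aeval x q * y := by
    have := congrArg φ hzpq
    simpa [hφ, hφy, sub_eq_add_neg] using this
  -- The trace `z + φ z = 2p/e` is integral over `k[x]` and rational in `x`, hence a polynomial.
  obtain ⟨r, hr⟩ := exists_algebraMap_eq_of_isIntegral_of_mul_eq inj he (p := 2 * p)
    (w := z + φ z) (by
      rw [hmap, hmap, map_mul, map_ofNat]
      linear_combination hzpq + hφz) (hzi.add hz')
  -- So is `(z - φ z)² = 4 q² f / e²`. As `4` is a unit and `f` is square-free, this forces `e ∣ q`.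
  obtain ⟨s, hs⟩ := exists_algebraMap_eq_of_isIntegral_of_mul_eq inj (pow_ne_zero 2 he)
    (p := 4 * q ^ 2 * f) (w := (z - φ z) ^ 2) (by
      simp only [hmap, map_mul, map_ofNat, map_pow, ← h.sq]
      linear_combination ((z - φ z) * aeval x e + 2 * aeval x q * y) * (hzpq - hφz))
      ((hzi.sub hz').pow 2)
  rw [hmap] at hr hs
  have h4 : s * e ^ 2 = 4 * q ^ 2 * f := by
    refine inj ?_
    simp only [hmap, map_mul, map_ofNat, map_pow, ← h.sq, hs]
    linear_combination ((z - φ z) * aeval x e + 2 * aeval x q * y) * (hzpq - hφz)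
  obtain ⟨t, rfl⟩ : e ∣ q := by
    have hu : IsUnit (4 : k[X]) := by
      have : (4 : k[X]) = C 4 := (map_ofNat C 4).symm
      rw [this]
      refine isUnit_C.mpr (IsUnit.mk0 _ ?_)
      rw [show (4 : k) = 2 * 2 by norm_num]
      exact mul_ne_zero h2 h2
    have hdvd : e ^ 2 ∣ q ^ 2 * f := by
      have : e ^ 2 ∣ 4 * (q ^ 2 * f) := ⟨s, by linear_combination -h4⟩
      exact hu.dvd_mul_left.mp this
    exact dvd_of_sq_dvd_sq_mul hf he hdvd
  -- Half the trace plus half the difference: `z = r/2 + t y`.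
  refine ⟨AdjoinRoot.of _ (C 2⁻¹ * r) + AdjoinRoot.of _ t * AdjoinRoot.root _, ?_⟩
  have hc : algebraMap k K 2⁻¹ * 2 = 1 := by
    rw [← map_ofNat (algebraMap k K) 2, ← map_mul, inv_mul_cancel₀ h2, map_one]
  simp only [map_add, map_mul, evalPoint_of, evalPoint_root, aeval_C, hr]
  refine mul_right_cancel₀ (mul_ne_zero he' h2K) ?_
  simp only [map_mul] at hzpq hφz
  linear_combination (algebraMap k K 2⁻¹ * 2 - 2) * hzpq + algebraMap k K 2⁻¹ * 2 * hφz +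
    (2 * aeval x p) * hc

end IsHyperellipticPair

/-- The denominator `r + s y` is rationalized by its conjugate `r - s y`; the norm `r² - s² f` is
nonzero by independence. -/
lemma IsHyperellipticPair.of_div {f : k[X]} {x y : K} (hsq : y ^ 2 = aeval x f)
    (hi : ∀ p q : k[X], aeval x p + aeval x q * y = 0 → p = 0 ∧ q = 0)
    (hdiv : ∀ z, ∃ a b : affineRing f, evalPoint f x y hsq b ≠ 0 ∧
      z * evalPoint f x y hsq b = evalPoint f x y hsq a) : IsHyperellipticPair f x y := by
  refine ⟨hsq, hi, fun z ↦ ?_⟩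
  obtain ⟨a, b, hb0, hz⟩ := hdiv z
  obtain ⟨p, q, rfl⟩ := exists_affineRing_eq a
  obtain ⟨r, s, rfl⟩ := exists_affineRing_eq b
  simp only [map_add, map_mul, evalPoint_of, evalPoint_root] at hb0 hz
  have hne : r ^ 2 - s ^ 2 * f ≠ 0 := by
    intro h0
    have h1 : (aeval x r + aeval x s * y) * (aeval x r - aeval x s * y) = 0 := by
      have := congrArg (aeval x) h0
      simp only [map_sub, map_mul, map_pow, ← hsq, map_zero] at this
      linear_combination this
    obtain ⟨rfl, hs⟩ := hi r (-s) (by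
      rw [map_neg, neg_mul, ← sub_eq_add_neg]
      exact (mul_eq_zero.mp h1).resolve_left hb0)
    rw [neg_eq_zero] at hs
    subst hs
    exact hb0 (by simp)
  refine ⟨p * r - q * s * f, q * r - p * s, r ^ 2 - s ^ 2 * f, hne, ?_⟩
  simp only [map_sub, map_mul, map_pow, ← hsq]
  linear_combination (aeval x r - aeval x s * y) * hz

lemma exists_isHyperellipticPair {f : k[X]} (hf : Squarefree f) (hd : 0 < f.natDegree) :
    ∃ (K : Type u) (_ : Field K) (_ : Algebra k K) (x y : K), IsHyperellipticPair f x y := by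
  have := affineRing_isDomain hf hd
  let K := FractionRing (affineRing f)
  let x : K := algebraMap (affineRing f) K (AdjoinRoot.of _ X)
  let y : K := algebraMap (affineRing f) K (AdjoinRoot.root _)
  have inj : Function.Injective (algebraMap (affineRing f) K) := IsFractionRing.injective _ _
  have hx : ∀ p : k[X], aeval x p = algebraMap (affineRing f) K (AdjoinRoot.of _ p) := fun p ↦ by
    have : (aeval x).toRingHom = (algebraMap (affineRing f) K).comp (AdjoinRoot.of _) :=
      Polynomial.ringHom_ext (fun c ↦ (aeval_C x c).trans
        (IsScalarTower.algebraMap_apply k (affineRing f) K c)) (by simp [x])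
    exact congr($this p)
  have hsq : y ^ 2 = aeval x f := by rw [hx, ← affineRing_root_sq, map_pow]
  have hi : ∀ p q : k[X], aeval x p + aeval x q * y = 0 → p = 0 ∧ q = 0 := fun p q hpq ↦ by
    refine affineRing_add_mul_root_eq_zero (inj ?_)
    simpa [hx] using hpq
  have hev : ∀ a, evalPoint f x y hsq a = algebraMap (affineRing f) K a := fun a ↦ by
    obtain ⟨p, q, rfl⟩ := exists_affineRing_eq a
    simp [hx, y]
  refine ⟨K, inferInstance, inferInstance, x, y, .of_div hsq hi fun z ↦ ?_⟩
  obtain ⟨a, b, hb, rfl⟩ := IsFractionRing.div_surjective (affineRing f) z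
  have hb0 : algebraMap (affineRing f) K b ≠ 0 := fun h0 ↦
    nonZeroDivisors.ne_zero hb (inj (by rw [h0, map_zero]))
  exact ⟨a, b, by rwa [hev], by rw [hev, hev, div_mul_cancel₀ _ hb0]⟩

end AffineRing

/-! ### Normalization along a normal source -/

section NormalSource

variable {X W S : Scheme.{u}}

/-- If every integral morphism to `W` with a section over `X` has a section over `W`, then the
relative normalizations of `S` in `X` and in `W` agree. -/
lemma exists_iso_normalization_comp (g : X ⟶ W) [IsDominant g] [IsReduced W] (a : W ⟶ S)
    [QuasiCompact a] [QuasiSeparated a] (f : X ⟶ S) [QuasiCompact f] [QuasiSeparated f]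
    (hf : f = g ≫ a)
    (U : ∀ (T : Scheme.{u}) (p : T ⟶ W) (_ : IsIntegralHom p) (s : X ⟶ T), s ≫ p = g →
      ∃ r : W ⟶ T, r ≫ p = 𝟙 W ∧ g ≫ r = s) :
    ∃ e : f.normalization ≅ a.normalization,
      e.hom ≫ a.fromNormalization = f.fromNormalization := by
  -- The hypothesis is applied to the base change to `W` of the normalization in `X`. Its section
  -- extends `f.toNormalization` from `X` to `W`, and this extension is the map behind `inv`.
  obtain ⟨r, hr, hgr⟩ := U (pullback f.fromNormalization a) (pullback.snd _ _) inferInstance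
    (pullback.lift f.toNormalization g (f.toNormalization_fromNormalization.trans hf))
    (pullback.lift_snd _ _ _)
  let w := r ≫ pullback.fst f.fromNormalization a
  have hw : w ≫ f.fromNormalization = a := by
    rw [Category.assoc, pullback.condition, reassoc_of% hr]
  have hgw : g ≫ w = f.toNormalization := by
    rw [reassoc_of% hgr, pullback.lift_fst]
  let hom := f.normalizationDesc (g ≫ a.toNormalization) a.fromNormalization (by simp [hf])
  let inv := a.normalizationDesc w f.fromNormalization hw.symm
  have h1 : f.toNormalization ≫ hom = g ≫ a.toNormalization := by simp [hom]
  have h2 : a.toNormalization ≫ inv = w := by simp [inv]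
  have h3 : w ≫ hom = a.toNormalization := by
    refine ext_of_isDominant_of_isSeparated a.fromNormalization ?_ g ?_
    · simp [hom, hw]
    · rw [reassoc_of% hgw, h1]
  refine ⟨⟨hom, inv, ?_, ?_⟩, by simp [hom]⟩
  · refine Scheme.Hom.normalization.hom_ext f _ _ f.fromNormalization ?_ ?_ (by simp)
    · rw [reassoc_of% h1, h2, hgw, Category.comp_id]
    · simp [hom, inv]
  · refine Scheme.Hom.normalization.hom_ext a _ _ a.fromNormalization ?_ ?_ (by simp)
    · rw [reassoc_of% h2, h3, Category.comp_id]
    · simp [hom, inv]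

/-- Since `B` is integral over `A`, its image in `K` consists of elements integral over `A`, which
all come from `A`. -/
lemma exists_section_SpecMap {A B K : CommRingCat.{u}} (φ : A ⟶ K)
    (inj : Function.Injective φ) (hφ : ∀ z : K, φ.hom.IsIntegralElem z → ∃ a, φ a = z)
    (a : A ⟶ B) (ha : a.hom.IsIntegral) (b : B ⟶ K) (h : a ≫ b = φ) :
    ∃ ρ : B ⟶ A, a ≫ ρ = 𝟙 A ∧ ρ ≫ φ = b := by
  have hb : ∀ t : B, b t ∈ φ.hom.range := fun t ↦ hφ _ (by
    have := (ha t).map b.hom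
    rwa [← CommRingCat.hom_comp, h] at this)
  let e := RingEquiv.ofBijective φ.hom.rangeRestrict
    ⟨fun x y hxy ↦ inj (congrArg Subtype.val hxy), φ.hom.rangeRestrict_surjective⟩
  let ρ : B ⟶ A := CommRingCat.ofHom ((e.symm : φ.hom.range →+* A).comp (b.hom.codRestrict _ hb))
  have hρ : ρ ≫ φ = b := by
    ext t
    have : e (e.symm (b.hom.codRestrict _ hb t)) = b.hom.codRestrict _ hb t :=
      e.apply_symm_apply _
    exact congrArg Subtype.val this
  refine ⟨ρ, ?_, hρ⟩
  ext x
  refine inj ?_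
  change (a ≫ ρ ≫ φ) x = φ x
  rw [hρ, h]

/-- This supplies hypothesis `U` of `exists_iso_normalization_comp` when the ring is integrally
closed in `K`; a scheme integral over an affine one is affine, so only rings are involved. -/
lemma exists_section_of_isIntegralHom {A K : CommRingCat.{u}} (φ : A ⟶ K)
    (inj : Function.Injective φ) (hφ : ∀ z : K, φ.hom.IsIntegralElem z → ∃ a, φ a = z)
    (T : Scheme.{u}) (p : T ⟶ Spec A) (hp : IsIntegralHom p) (s : Spec K ⟶ T)
    (h : s ≫ p = Spec.map φ) : ∃ r : Spec A ⟶ T, r ≫ p = 𝟙 _ ∧ Spec.map φ ≫ r = s := by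
  have : IsAffine T := isAffine_of_isAffineHom p
  obtain ⟨a, ha⟩ := Spec.map_surjective (T.isoSpec.inv ≫ p)
  obtain ⟨b, hb⟩ := Spec.map_surjective (s ≫ T.isoSpec.hom)
  have hai : a.hom.IsIntegral := by
    rw [← IsIntegralHom.SpecMap_iff, ha]
    infer_instance
  obtain ⟨ρ, h1, h2⟩ := exists_section_SpecMap φ inj hφ a hai b (by
    refine Spec.map_injective ?_
    rw [Spec.map_comp, ha, hb, Category.assoc, Iso.hom_inv_id_assoc, h])
  refine ⟨Spec.map ρ ≫ T.isoSpec.inv, ?_, ?_⟩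
  · rw [Category.assoc, ← ha, ← Spec.map_comp, h1, Spec.map_id]
  · rw [← Category.assoc, ← Spec.map_comp, h2, hb, Category.assoc, Iso.hom_inv_id,
      Category.comp_id]

end NormalSource

/-! ### Complete curves as normalizations of `ℙ¹` in a function field -/

section Model

variable {k : Type u} [Field k] {K L : Type u} [Field K] [Algebra k K] [Field L] [Algebra k L]

instance (R : Type u) [CommRing R] [Algebra k R] (u : R) : IsAffineHom (linePoint k u) :=
  isAffineHom_to_separated _

/-- The complete curve with function field `K`, as a cover of the projective line by means of the
function `u`. -/
def model (k : Type u) [Field k] {K : Type u} [Field K] [Algebra k K] (u : K) :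
    Over (Spec (.of k)) :=
  Over.mk ((linePoint k u).fromNormalization ≫ P1.toSpec k)

/-- Transitivity of normalization along `T`: the curve depends on the function only up to integral
self-maps of `ℙ¹` over `k`, not only up to automorphisms. -/
lemma nonempty_model_iso_of_comp (u v : K) (T : P1 k ⟶ P1 k) [IsIntegralHom T]
    (hT : T ≫ P1.toSpec k = P1.toSpec k) (h : linePoint k u ≫ T = linePoint k v) :
    Nonempty (model k u ≅ model k v) :=
  ⟨(Over.isoMk (normalizationCompIso (linePoint k v) (linePoint k u) T h.symm) (by
    change _ ≫ (linePoint k u).fromNormalization ≫ P1.toSpec k =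
      (linePoint k v).fromNormalization ≫ P1.toSpec k
    rw [← reassoc_of% (normalizationCompIso_hom_comp _ _ T h.symm), hT])).symm⟩

lemma nonempty_model_iso_add (u : K) (c : k) :
    Nonempty (model k u ≅ model k (u + algebraMap k K c)) :=
  nonempty_model_iso_of_comp _ _ (translation c).hom (translation_toSpec c)
    (linePoint_translation u c)

lemma nonempty_model_iso_inv (u : K) (hu : u ≠ 0) : Nonempty (model k u ≅ model k u⁻¹) :=
  nonempty_model_iso_of_comp _ _ (inversion k).hom inversion_toSpec
    (linePoint_inversion u u⁻¹ (mul_inv_cancel₀ hu))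

lemma nonempty_model_iso_sq (u : K) : Nonempty (model k u ≅ model k (u ^ 2)) :=
  nonempty_model_iso_of_comp _ _ (squaring k) squaring_toSpec (linePoint_squaring u)

/-- The affine part of the curve `y² = f(x)`. -/
def affineChart (f : k[X]) : Spec (.of (affineRing f)) ⟶ curve f :=
  (affineCover f).toNormalization

@[simp]
lemma affineChart_cover (f : k[X]) : affineChart f ≫ cover f = affineCover f :=
  Scheme.Hom.toNormalization_fromNormalization _

/-- The projection `(x, y) ↦ x` of the affine curve. -/
def affineProj (f : k[X]) : Spec (.of (affineRing f)) ⟶ Spec (.of k[X]) :=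
  Spec.map (CommRingCat.ofHom (AdjoinRoot.of ((X : k[X][X]) ^ 2 - C f)))

instance (f : k[X]) : IsIntegralHom (affineProj f) := by
  refine IsIntegralHom.SpecMap_iff.mpr ?_
  have := (affineRing_monic f).finite_adjoinRoot
  exact algebraMap_isIntegral_iff.mpr inferInstance

/-- Normalization commutes with restriction to the open `𝔸¹`, and the affine curve, being integral
over `𝔸¹`, is its own relative normalization there. -/
lemma isPullback_affineChart (f : k[X]) :
    IsPullback (affineChart f) (affineProj f) (cover f) (lineChart k) := by
  obtain ⟨m, hm, hm'⟩ := exists_isPullback_normalization (affineProj f) (lineChart k)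
    (affineCover f) rfl
  let m' : (affineProj f).normalization ⟶ curve f := m
  have hm1 : IsPullback m' (affineProj f).fromNormalization (cover f) (lineChart k) := hm
  have hm2 : (affineProj f).toNormalization ≫ m' = affineChart f := hm'
  exact IsPullback.of_iso hm1 (asIso (affineProj f).toNormalization).symm (Iso.refl _) (Iso.refl _)
    (Iso.refl _) (by simp [← hm2]) (by simp) (by simp) (by simp)

instance (f : k[X]) : IsOpenImmersion (affineChart f) :=
  MorphismProperty.of_isPullback (P := @IsOpenImmersion) (isPullback_affineChart f).flip
    inferInstance

lemma curve_isIntegral {f : k[X]} (hf : Squarefree f) (hd : 0 < f.natDegree) :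
    IsIntegral (curve f) := by
  have := affineRing_isDomain hf hd
  exact inferInstanceAs (IsIntegral (affineCover f).normalization)

instance (f : k[X]) : (curve f).IsSeparated := isSeparated_of_isAffineHom (cover f)

lemma SpecMap_evalPoint (f : k[X]) (x y : K) (h : y ^ 2 = aeval x f) :
    Spec.map (CommRingCat.ofHom (evalPoint f x y h).toRingHom) ≫ affineCover f =
      linePoint k x := by
  rw [affineCover, ← Category.assoc, ← Spec.map_comp, ← CommRingCat.ofHom_comp, linePoint]
  congr 4
  ext <;> simp [evalPoint]

/-- Because the affine curve is normal, normalizing `ℙ¹` in the curve or in its generic point gives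
the same scheme. -/
lemma nonempty_curveOver_iso_model {f : k[X]} (hf : Squarefree f) (hd : 0 < f.natDegree)
    (h2 : (2 : k) ≠ 0) {x y : K} (h : IsHyperellipticPair f x y) :
    Nonempty (curveOver f ≅ model k x) := by
  have := affineRing_isDomain hf hd
  have inj := evalPoint_injective f x y h.sq h.indep
  have : IsDominant (Spec.map (CommRingCat.ofHom (evalPoint f x y h.sq).toRingHom)) :=
    isDominant_SpecMap_of_injective _ inj
  obtain ⟨e, he⟩ := exists_iso_normalization_comp
    (Spec.map (CommRingCat.ofHom (evalPoint f x y h.sq).toRingHom)) (affineCover f)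
    (linePoint k x) (SpecMap_evalPoint f x y h.sq).symm
    (exists_section_of_isIntegralHom _ inj fun z hz ↦
      -- An element integral over the coordinate ring is integral over `k[x]`, by transitivity.
      h.exists_evalPoint_eq_of_isIntegral hf h2 z (by
        let : Algebra (affineRing f) K := (evalPoint f x y h.sq).toRingHom.toAlgebra
        let : Algebra k[X] K := (aeval (R := k) x).toRingHom.toAlgebra
        have : IsScalarTower k[X] (affineRing f) K :=
          IsScalarTower.of_algebraMap_eq fun p ↦ (evalPoint_of f x y h.sq p).symm
        have : Algebra.IsIntegral k[X] (affineRing f) :=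
          have := (affineRing_monic f).finite_adjoinRoot
          inferInstance
        exact isIntegral_trans (R := k[X]) (A := affineRing f) z hz))
  exact ⟨(Over.isoMk e (by
    change e.hom ≫ (affineCover f).fromNormalization ≫ P1.toSpec k =
      (linePoint k x).fromNormalization ≫ P1.toSpec k
    rw [reassoc_of% he])).symm⟩

end Model

/-! ### Klein four-subgroups as pairs of commuting involutions -/

section KleinFour

/-- `a` and `b` are two commuting distinct involutions. -/
structure IsKleinPair {G : Type*} [Group G] (a b : G) : Prop where
  left : a * a = 1
  right : b * b = 1
  comm : a * b = b * a
  left_ne : a ≠ 1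
  right_ne : b ≠ 1
  ne : a ≠ b

lemma IsKleinPair.map {G G' : Type*} [Group G] [Group G'] {a b : G} (h : IsKleinPair a b)
    (φ : G →* G') (hφ : Function.Injective φ) : IsKleinPair (φ a) (φ b) where
  left := by rw [← map_mul, h.left, map_one]
  right := by rw [← map_mul, h.right, map_one]
  comm := by rw [← map_mul, h.comm, map_mul]
  left_ne := fun h0 ↦ h.left_ne (hφ (by rw [h0, map_one]))
  right_ne := fun h0 ↦ h.right_ne (hφ (by rw [h0, map_one]))
  ne := fun h0 ↦ h.ne (hφ h0)

/-- Pairs of elements are easier than subgroups to carry along isomorphisms and group actions. -/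
lemma exists_isKleinFour_iff {G : Type*} [Group G] :
    (∃ H : Subgroup G, IsKleinFour H) ↔ ∃ a b : G, IsKleinPair a b := by
  constructor
  · rintro ⟨H, hH⟩
    have : Finite H := Nat.finite_of_card_ne_zero (by rw [hH.card_four]; norm_num)
    have := Fintype.ofFinite H
    classical
    have hc : (Finset.univ : Finset H).card = 4 := by
      rw [Finset.card_univ, ← Nat.card_eq_fintype_card, hH.card_four]
    obtain ⟨a, ha⟩ := Finset.exists_mem_notMem_of_card_lt_card (s := {1})
      (t := (Finset.univ : Finset H)) (by rw [hc]; simp)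
    obtain ⟨b, hb⟩ := Finset.exists_mem_notMem_of_card_lt_card (s := {1, a})
      (t := (Finset.univ : Finset H)) (by
        rw [hc]; exact lt_of_le_of_lt Finset.card_le_two (by norm_num))
    simp only [Finset.mem_univ, Finset.mem_singleton, Finset.mem_insert, not_or, true_and]
      at ha hb
    refine ⟨a, b, IsKleinPair.map (a := a) (b := b) ⟨IsKleinFour.mul_self a,
      IsKleinFour.mul_self b, ?_, ha, hb.1, fun h ↦ hb.2 h.symm⟩ H.subtype H.subtype_injective⟩
    have h := IsKleinFour.mul_self (a * b)
    have h1 := IsKleinFour.mul_self a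
    have h2 := IsKleinFour.mul_self b
    calc a * b = a * (a * b * (a * b)) * b := by rw [h, mul_one]
      _ = (a * a) * (b * a) * (b * b) := by group
      _ = b * a := by rw [h1, h2, one_mul, mul_one]
  · rintro ⟨a, b, h⟩
    have ha := h.left
    have hb := h.right
    have hab := h.comm
    have e1 : a * (a * b) = b := by rw [← mul_assoc, ha, one_mul]
    have e2 : b * (a * b) = a := by rw [hab, ← mul_assoc, hb, one_mul]
    have e3 : a * b * a = b := by rw [hab, mul_assoc, ha, mul_one]
    have e4 : a * b * b = a := by rw [mul_assoc, hb, mul_one]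
    have e5 : a * b * (a * b) = 1 := by rw [mul_assoc, e2, ha]
    have ia : a⁻¹ = a := inv_eq_of_mul_eq_one_left ha
    have ib : b⁻¹ = b := inv_eq_of_mul_eq_one_left hb
    have iab : (a * b)⁻¹ = a * b := inv_eq_of_mul_eq_one_left e5
    let H : Subgroup G :=
      { carrier := {1, a, b, a * b}
        mul_mem' := by
          rintro x y (rfl | rfl | rfl | rfl) (rfl | rfl | rfl | rfl) <;>
            simp [ha, hb, e1, e2, e3, e4, e5, ← hab]
        one_mem' := by simp
        inv_mem' := by
          rintro x (rfl | rfl | rfl | rfl)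
          · simp
          · simp [ia]
          · simp [ib]
          · rw [iab]; simp }
    have hsq : ∀ x : H, x ^ 2 = 1 := by
      rintro ⟨x, (rfl | rfl | rfl | rfl)⟩ <;> refine Subtype.ext ?_ <;> simp [sq, ha, hb, e5]
    refine ⟨H, ?_, ?_⟩
    · have n1 : a * b ≠ 1 := fun h0 ↦ h.ne (by rw [← e4, h0, one_mul])
      have n2 : a * b ≠ a := fun h0 ↦ h.right_ne (by simpa using h0)
      have n3 : a * b ≠ b := fun h0 ↦ h.left_ne (by simpa using h0)
      have : Nat.card H = ({1, a, b, a * b} : Set G).ncard := rfl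
      rw [this, Set.ncard_insert_of_notMem, Set.ncard_insert_of_notMem, Set.ncard_pair n3.symm]
      · simp [h.ne, n2.symm]
      · simp [h.left_ne.symm, h.right_ne.symm, n1.symm]
    · have : Nontrivial H := ⟨⟨a, by simp [H]⟩, 1, fun h0 ↦ h.left_ne (congrArg Subtype.val h0)⟩
      exact (Monoid.exponent_eq_prime_iff Nat.prime_two).mpr fun x hx ↦
        orderOf_eq_prime (hsq x) hx

lemma exists_isKleinPair_of_iso {C : Type*} [Category C] {Y Z : C} (e : Y ≅ Z)
    (h : ∃ a b : Aut Y, IsKleinPair a b) : ∃ a b : Aut Z, IsKleinPair a b := by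
  obtain ⟨a, b, h⟩ := h
  exact ⟨_, _, h.map (Aut.autMulEquivOfIso e).toMonoidHom (Aut.autMulEquivOfIso e).injective⟩

end KleinFour

/-! ### The sign involutions on the fiber product and their lifts -/

section

variable {k : Type u} [Field k]

/-- Both `u` and `1/u` are transcendental, so the point is dense in each of the two charts. -/
lemma isDominant_linePoint {K : Type u} [Field K] [Algebra k K] {u : K} (hu : Transcendental k u) :
    IsDominant (linePoint k u) := by
  have hu0 : u ≠ 0 := fun h0 ↦ hu (h0 ▸ isAlgebraic_zero)
  have key : ∀ i : Fin 2, ∃ w : K, Transcendental k w ∧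
      Spec.map (CommRingCat.ofHom (aeval (R := k) w).toRingHom) ≫ chart k i = linePoint k u := by
    intro i
    fin_cases i
    · exact ⟨u⁻¹, fun h ↦ hu (IsAlgebraic.inv_iff.mp h),
        SpecMap_chart 0 u⁻¹ u (inv_mul_cancel₀ hu0)⟩
    · exact ⟨u, hu, SpecMap_chart 1 u u⁻¹ (mul_inv_cancel₀ hu0)⟩
  refine ⟨dense_iff_closure_eq.mpr (Set.eq_univ_of_forall fun p ↦ ?_)⟩
  obtain ⟨i, y, rfl⟩ := exists_chart_eq p
  obtain ⟨w, hw, hwu⟩ := key i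
  have hd : IsDominant (Spec.map (CommRingCat.ofHom (aeval (R := k) w).toRingHom)) :=
    isDominant_SpecMap_of_injective _ (transcendental_iff_injective.mp hw)
  have h1 : y ∈ closure (Set.range (Spec.map (CommRingCat.ofHom (aeval (R := k) w).toRingHom))) := by
    rw [hd.1.closure_range]; trivial
  refine map_mem_closure (chart k i).continuous h1 ?_
  rintro _ ⟨z, rfl⟩
  exact ⟨z, by rw [← hwu]; rfl⟩

instance : IsDominant (lineChart k) := by
  have h := isDominant_linePoint (k := k) (K := FractionRing k[X])
    (u := algebraMap k[X] _ X) ((transcendental_algebraMap_iff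
      (IsFractionRing.injective k[X] _)).mpr (transcendental_X k))
  rw [linePoint] at h
  exact IsDominant.of_comp (Spec.map (CommRingCat.ofHom (aeval (R := k)
    (algebraMap k[X] (FractionRing k[X]) X)).toRingHom)) _

instance (f : k[X]) : IsDominant (affineProj f) :=
  isDominant_SpecMap_of_injective _ fun p q h ↦ by
    have := affineRing_add_mul_root_eq_zero (f := f) (p := p - q) (q := 0) (by simp [h])
    exact sub_eq_zero.mp this.1

instance (f : k[X]) : IsDominant (affineCover f) :=
  inferInstanceAs (IsDominant (affineProj f ≫ lineChart k))

instance (f : k[X]) : IsDominant (affineChart f) :=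
  inferInstanceAs (IsDominant (affineCover f).toNormalization)

/-- A dominant integral morphism is surjective, its image being closed. -/
instance (f : k[X]) : Surjective (cover f) := by
  have : IsDominant (affineChart f ≫ cover f) := by
    rw [affineChart_cover]; infer_instance
  have : IsDominant (cover f) := IsDominant.of_comp (affineChart f) _
  infer_instance

/-- The ring homomorphism `(x, y) ↦ (x, -y)`. -/
def signHom (f : k[X]) : affineRing f →+* affineRing f :=
  AdjoinRoot.lift (AdjoinRoot.of _) (-AdjoinRoot.root _) (by simp [affineRing_root_sq])

lemma signHom_comp_of (f : k[X]) : (signHom f).comp (AdjoinRoot.of _) = AdjoinRoot.of _ := by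
  ext <;> simp [signHom]

lemma signHom_root (f : k[X]) : signHom f (AdjoinRoot.root _) = -AdjoinRoot.root _ := by
  simp [signHom]

lemma signHom_comp_signHom (f : k[X]) : (signHom f).comp (signHom f) = .id _ := by
  ext a <;> simp [signHom]

/-- Otherwise `2y = 0`, although `1, y` are independent over `k[x]` and `2 ≠ 0`. -/
lemma signHom_ne_id (f : k[X]) (h2 : (2 : k) ≠ 0) : signHom f ≠ .id _ := by
  intro h
  have h1 := signHom_root f
  rw [h, RingHom.id_apply] at h1
  have := affineRing_add_mul_root_eq_zero (f := f) (p := 0) (q := 2) (by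
    rw [map_zero, zero_add, map_ofNat]
    linear_combination h1)
  refine h2 (C_injective ?_)
  rw [map_ofNat, this.2, C_0]

/-- The involution `(x, y) ↦ (x, -y)` of the affine curve. -/
def affineSign (f : k[X]) : Spec (.of (affineRing f)) ≅ Spec (.of (affineRing f)) where
  hom := Spec.map (CommRingCat.ofHom (signHom f))
  inv := Spec.map (CommRingCat.ofHom (signHom f))
  hom_inv_id := by
    rw [← Spec.map_comp, ← CommRingCat.ofHom_comp, signHom_comp_signHom, CommRingCat.ofHom_id,
      Spec.map_id]
  inv_hom_id := by
    rw [← Spec.map_comp, ← CommRingCat.ofHom_comp, signHom_comp_signHom, CommRingCat.ofHom_id,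
      Spec.map_id]

lemma affineSign_hom_comp (f : k[X]) : (affineSign f).hom ≫ affineCover f = affineCover f := by
  rw [affineCover, affineSign, ← Category.assoc, ← Spec.map_comp, ← CommRingCat.ofHom_comp,
    signHom_comp_of]

/-- The hyperelliptic involution of the curve `y² = f(x)`. -/
def curveSign (f : k[X]) : curve f ≅ curve f :=
  normalizationIsoOfIso (affineCover f) (affineCover f) (affineSign f)
    (affineSign_hom_comp f).symm

@[simp]
lemma curveSign_hom_cover (f : k[X]) : (curveSign f).hom ≫ cover f = cover f :=
  normalizationIsoOfIso_hom_comp ..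

lemma affineChart_curveSign_hom (f : k[X]) :
    affineChart f ≫ (curveSign f).hom = (affineSign f).hom ≫ affineChart f :=
  toNormalization_normalizationIsoOfIso_hom ..

@[simp]
lemma curveSign_hom_curveSign_hom (f : k[X]) : (curveSign f).hom ≫ (curveSign f).hom = 𝟙 _ := by
  refine Scheme.Hom.normalization.hom_ext (affineCover f) _ _ (cover f) ?_ ?_ ?_
  · change affineChart f ≫ _ = affineChart f ≫ _
    rw [reassoc_of% affineChart_curveSign_hom, affineChart_curveSign_hom, ← Category.assoc]
    have : (affineSign f).hom ≫ (affineSign f).hom = 𝟙 _ := (affineSign f).hom_inv_id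
    rw [this, Category.id_comp, Category.comp_id]
  · change ((curveSign f).hom ≫ (curveSign f).hom) ≫ cover f = cover f
    rw [Category.assoc, curveSign_hom_cover, curveSign_hom_cover]
  · exact Category.id_comp _

lemma curveSign_hom_ne_id (f : k[X]) (h2 : (2 : k) ≠ 0) : (curveSign f).hom ≠ 𝟙 _ := by
  intro h
  have h1 := affineChart_curveSign_hom f
  rw [h, Category.comp_id] at h1
  have h3 : (affineSign f).hom = 𝟙 _ := by
    rw [← cancel_mono (affineChart f), ← h1, Category.id_comp]
  refine signHom_ne_id f h2 ?_
  have h4 : CommRingCat.ofHom (signHom f) = 𝟙 _ := Spec.map_injective (h3.trans (Spec.map_id _).symm)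
  exact congrArg CommRingCat.Hom.hom h4

section

variable {f₁ f₂ : k[X]}

/-- The first projection of the fiber product. -/
def fiberFst (f₁ f₂ : k[X]) : fiberProduct f₁ f₂ ⟶ curve f₁ := pullback.fst _ _

/-- The second projection of the fiber product. -/
def fiberSnd (f₁ f₂ : k[X]) : fiberProduct f₁ f₂ ⟶ curve f₂ := pullback.snd _ _

lemma fiberProduct_hom_ext {T : Scheme.{u}} {a b : T ⟶ fiberProduct f₁ f₂}
    (h₁ : a ≫ fiberFst f₁ f₂ = b ≫ fiberFst f₁ f₂)
    (h₂ : a ≫ fiberSnd f₁ f₂ = b ≫ fiberSnd f₁ f₂) : a = b :=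
  pullback.hom_ext h₁ h₂

lemma fiberProduct_condition : fiberFst f₁ f₂ ≫ cover f₁ = fiberSnd f₁ f₂ ≫ cover f₂ :=
  pullback.condition

/-- The automorphism of the fiber product induced by automorphisms of the factors over `ℙ¹`. -/
def fiberMap (α : curve f₁ ⟶ curve f₁) (hα : α ≫ cover f₁ = cover f₁)
    (β : curve f₂ ⟶ curve f₂) (hβ : β ≫ cover f₂ = cover f₂) :
    fiberProduct f₁ f₂ ⟶ fiberProduct f₁ f₂ :=
  pullback.lift (fiberFst f₁ f₂ ≫ α) (fiberSnd f₁ f₂ ≫ β) (by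
    rw [Category.assoc, Category.assoc, hα, hβ, fiberProduct_condition])

instance : Surjective (fiberFst f₁ f₂) :=
  inferInstanceAs (Surjective (pullback.fst (cover f₁) (cover f₂)))

instance : Surjective (fiberSnd f₁ f₂) :=
  inferInstanceAs (Surjective (pullback.snd (cover f₁) (cover f₂)))

variable (α α' : curve f₁ ⟶ curve f₁) (hα : α ≫ cover f₁ = cover f₁)
  (hα' : α' ≫ cover f₁ = cover f₁) (β β' : curve f₂ ⟶ curve f₂) (hβ : β ≫ cover f₂ = cover f₂)
  (hβ' : β' ≫ cover f₂ = cover f₂)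

@[simp]
lemma fiberMap_fiberFst : fiberMap α hα β hβ ≫ fiberFst f₁ f₂ = fiberFst f₁ f₂ ≫ α :=
  pullback.lift_fst _ _ _

@[simp]
lemma fiberMap_fiberSnd : fiberMap α hα β hβ ≫ fiberSnd f₁ f₂ = fiberSnd f₁ f₂ ≫ β :=
  pullback.lift_snd _ _ _

@[simp]
lemma fiberMap_fiberFst_assoc {Z : Scheme.{u}} (h : curve f₁ ⟶ Z) :
    fiberMap α hα β hβ ≫ fiberFst f₁ f₂ ≫ h = fiberFst f₁ f₂ ≫ α ≫ h := by
  rw [← Category.assoc, fiberMap_fiberFst, Category.assoc]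

@[simp]
lemma fiberMap_fiberSnd_assoc {Z : Scheme.{u}} (h : curve f₂ ⟶ Z) :
    fiberMap α hα β hβ ≫ fiberSnd f₁ f₂ ≫ h = fiberSnd f₁ f₂ ≫ β ≫ h := by
  rw [← Category.assoc, fiberMap_fiberSnd, Category.assoc]

lemma fiberMap_comp_fiberMap : fiberMap α hα β hβ ≫ fiberMap α' hα' β' hβ' =
    fiberMap (α ≫ α') (by rw [Category.assoc, hα', hα]) (β ≫ β')
      (by rw [Category.assoc, hβ', hβ]) :=
  fiberProduct_hom_ext (by simp) (by simp)

lemma fiberMap_id : fiberMap (𝟙 (curve f₁)) (Category.id_comp _) (𝟙 (curve f₂))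
    (Category.id_comp _) = 𝟙 _ :=
  fiberProduct_hom_ext (by simp) (by simp)

lemma fiberMap_fiberProductCover :
    fiberMap α hα β hβ ≫ fiberProductCover f₁ f₂ = fiberProductCover f₁ f₂ := by
  change fiberMap α hα β hβ ≫ fiberFst f₁ f₂ ≫ cover f₁ = fiberFst f₁ f₂ ≫ cover f₁
  rw [fiberMap_fiberFst_assoc, hα]

/-- The projections are surjective onto the reduced curves, so each factor is determined by the
action on the fiber product. -/
lemma fiberMap_injective [IsReduced (curve f₁)] [IsReduced (curve f₂)]
    (h : fiberMap α hα β hβ = fiberMap α' hα' β' hβ') : α = α' ∧ β = β' := by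
  constructor
  · refine ext_of_isDominant (fiberFst f₁ f₂) ?_
    rw [← fiberMap_fiberFst α hα β hβ, h, fiberMap_fiberFst]
  · refine ext_of_isDominant (fiberSnd f₁ f₂) ?_
    rw [← fiberMap_fiberSnd α hα β hβ, h, fiberMap_fiberSnd]

end

/-- The normalization of an integral fiber product of two covers `y² = f(x)` has two commuting
distinct involutions. -/
lemma exists_isKleinPair_of_isNormalizedFiberProduct {f₁ f₂ : k[X]} (hf₁ : Squarefree f₁)
    (hd₁ : 0 < f₁.natDegree) (hf₂ : Squarefree f₂) (hd₂ : 0 < f₂.natDegree) (h2 : (2 : k) ≠ 0)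
    {Y : Over (Spec (.of k))} (hY : IsNormalizedFiberProduct f₁ f₂ Y) :
    ∃ a b : Aut Y, IsKleinPair a b := by
  obtain ⟨hF, ⟨e⟩⟩ := hY
  have := curve_isIntegral hf₁ hd₁
  have := curve_isIntegral hf₂ hd₂
  refine exists_isKleinPair_of_iso e.symm ?_
  let a := fiberMap (curveSign f₁).hom (curveSign_hom_cover f₁) (𝟙 (curve f₂))
    (Category.id_comp _)
  let b := fiberMap (𝟙 (curve f₁)) (Category.id_comp _) (curveSign f₂).hom
    (curveSign_hom_cover f₂)
  have haa : a ≫ a = 𝟙 _ := by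
    rw [← fiberMap_id, fiberMap_comp_fiberMap]; congr 1; simp
  have hbb : b ≫ b = 𝟙 _ := by
    rw [← fiberMap_id, fiberMap_comp_fiberMap]; congr 1; simp
  have hab : a ≫ b = b ≫ a := by
    rw [fiberMap_comp_fiberMap, fiberMap_comp_fiberMap]; congr 1
  have ha1 : a ≠ 𝟙 _ := fun h ↦ curveSign_hom_ne_id f₁ h2
    (fiberMap_injective _ _ _ _ _ _ _ _ (h.trans fiberMap_id.symm)).1
  have hb1 : b ≠ 𝟙 _ := fun h ↦ curveSign_hom_ne_id f₂ h2
    (fiberMap_injective _ _ _ _ _ _ _ _ (h.trans fiberMap_id.symm)).2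
  have hne : a ≠ b := fun h ↦ curveSign_hom_ne_id f₁ h2
    (fiberMap_injective _ _ _ _ _ _ _ _ h).1
  -- An involution over `ℙ¹` lifts to a `k`-automorphism of the normalization, and the lift is again
  -- an involution by uniqueness.
  have key : ∀ c : fiberProduct f₁ f₂ ⟶ fiberProduct f₁ f₂, c ≫ c = 𝟙 _ →
      c ≫ fiberProductCover f₁ f₂ = fiberProductCover f₁ f₂ → ∃ σ : Aut (Over.mk
        (normalizationMap (fiberProduct f₁ f₂) ≫ fiberProductCover f₁ f₂ ≫ P1.toSpec k)),
        IsNormalizationLift c σ.hom.left := by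
    intro c hc hc'
    have : IsIso c := ⟨c, hc, hc⟩
    obtain ⟨m, hm⟩ := exists_isNormalizationLift c
    have hmm : m ≫ m = 𝟙 _ := by
      have h1 := hm.comp hm
      rw [hc] at h1
      exact h1.unique .id
    refine ⟨Over.isoMk ⟨m, m, hmm, hmm⟩ ?_, hm⟩
    change m ≫ normalizationMap _ ≫ fiberProductCover f₁ f₂ ≫ P1.toSpec k = _
    rw [reassoc_of% hm.1, reassoc_of% hc']
    rfl
  obtain ⟨σ, hσ⟩ := key a haa (fiberMap_fiberProductCover ..)
  obtain ⟨τ, hτ⟩ := key b hbb (fiberMap_fiberProductCover ..)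
  have hext : ∀ (ρ ρ' : Aut (Over.mk
      (normalizationMap (fiberProduct f₁ f₂) ≫ fiberProductCover f₁ f₂ ≫ P1.toSpec k)))
      (c : fiberProduct f₁ f₂ ⟶ fiberProduct f₁ f₂), IsNormalizationLift c ρ.hom.left →
      IsNormalizationLift c ρ'.hom.left → ρ = ρ' :=
    fun ρ ρ' c h h' ↦ Iso.ext (Over.OverMorphism.ext (h.unique h'))
  have hone : IsNormalizationLift (𝟙 (fiberProduct f₁ f₂)) (1 : Aut (Over.mk
      (normalizationMap (fiberProduct f₁ f₂) ≫ fiberProductCover f₁ f₂ ≫ P1.toSpec k))).hom.left :=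
    .id
  -- Uniqueness of lifts transfers the group relations; `IsNormalizationLift.injective` transfers
  -- the inequalities.
  refine ⟨σ, τ, hext _ _ _ (hσ.comp hσ) (haa ▸ hone), hext _ _ _ (hτ.comp hτ) (hbb ▸ hone),
    hext _ _ _ (hτ.comp hσ) (hab ▸ hσ.comp hτ), fun h ↦ ?_, fun h ↦ ?_, fun h ↦ ?_⟩
  · subst h; exact ha1 (hσ.injective hone)
  · subst h; exact hb1 (hτ.injective hone)
  · subst h; exact hne (hσ.injective hτ)

end

/-! ### The action of automorphisms on the function field -/

section Automorphisms

variable {k : Type u} [Field k] {K : Type u} [Field K] [Algebra k K] {f : k[X]} {x y : K}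

/-- The generic point of the curve `y² = f(x)`. -/
def curvePoint (f : k[X]) (x y : K) (h : y ^ 2 = aeval x f) : Spec (.of K) ⟶ curve f :=
  Spec.map (CommRingCat.ofHom (evalPoint f x y h).toRingHom) ≫ affineChart f

lemma curvePoint_cover (h : y ^ 2 = aeval x f) : curvePoint f x y h ≫ cover f = linePoint k x := by
  rw [curvePoint, Category.assoc, affineChart_cover, SpecMap_evalPoint]

lemma IsHyperellipticPair.isDominant_curvePoint (h : IsHyperellipticPair f x y) :
    IsDominant (curvePoint f x y h.sq) := by
  have : IsDominant (Spec.map (CommRingCat.ofHom (evalPoint f x y h.sq).toRingHom)) :=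
    isDominant_SpecMap_of_injective _ (evalPoint_injective f x y h.sq h.indep)
  unfold curvePoint
  infer_instance

lemma IsHyperellipticPair.exists_iso_curvePoint (h : IsHyperellipticPair f x y)
    (hf : Squarefree f) (hd : 0 < f.natDegree) [IrreducibleSpace (curve f)] :
    ∃ e : Spec (.of K) ≅ Spec ((curve f).presheaf.stalk (genericPoint (curve f))),
      e.hom ≫ genericInclusion (curve f) = curvePoint f x y h.sq := by
  have := affineRing_isDomain hf hd
  let := (evalPoint f x y h.sq).toAlgebra
  have := h.isFractionRing
  exact exists_iso_of_chart K (affineChart f)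

/-- The automorphism of schemes underlying an automorphism of the `k`-scheme `y² = f(x)`. -/
def autHom (α : Aut (curveOver f)) : curve f ⟶ curve f := Over.Hom.left (Iso.hom α)

lemma autHom_mul (α β : Aut (curveOver f)) : autHom (α * β) = autHom β ≫ autHom α := rfl

lemma autHom_one : autHom (1 : Aut (curveOver f)) = 𝟙 _ := rfl

lemma autHom_injective : Function.Injective (autHom (f := f)) :=
  fun _ _ h ↦ Iso.ext (Over.OverMorphism.ext h)

/-- `φ` is the action of the automorphism `α` on the function field. -/
def IsFunctionFieldMap (h : IsHyperellipticPair f x y) (α : Aut (curveOver f))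
    (φ : K ≃ₐ[k] K) : Prop :=
  Spec.map (CommRingCat.ofHom (φ : K →+* K)) ≫ curvePoint f x y h.sq =
    curvePoint f x y h.sq ≫ autHom α

/-- An automorphism fixes the generic point, so it acts on the stalk there, which is `K`; the action
is `k`-linear because the automorphism lies over `Spec k`. -/
lemma exists_isFunctionFieldMap (h : IsHyperellipticPair f x y) (hf : Squarefree f)
    (hd : 0 < f.natDegree) (α : Aut (curveOver f)) : ∃ φ, IsFunctionFieldMap h α φ := by
  have := curve_isIntegral hf hd
  obtain ⟨d, hd'⟩ := h.exists_iso_curvePoint hf hd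
  let a : curve f ≅ curve f := (Over.forget _).mapIso α
  have ha : a.hom ≫ cover f ≫ P1.toSpec k = cover f ≫ P1.toSpec k := Over.w α.hom
  obtain ⟨e, he⟩ := exists_iso_genericInclusion a.hom
  let E : Spec (.of K) ≅ Spec (.of K) := d ≪≫ e ≪≫ d.symm
  have hE : E.hom ≫ curvePoint f x y h.sq = curvePoint f x y h.sq ≫ a.hom := by
    simp only [E, Iso.trans_hom, Category.assoc, ← hd', Iso.symm_hom, Iso.inv_hom_id_assoc, he]
  obtain ⟨ψ, hψ⟩ := Spec.map_surjective E.hom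
  have : IsIso (Spec.map ψ) := by rw [hψ]; infer_instance
  have hi : IsIso ψ := by
    rwa [← isIso_op_iff, ← isIso_iff_of_reflects_iso _ Scheme.Spec]
  let φ : K ≃+* K := (asIso ψ).commRingCatIsoToRingEquiv
  have hto : curvePoint f x y h.sq ≫ cover f ≫ P1.toSpec k =
      Spec.map (CommRingCat.ofHom (algebraMap k K)) := by
    rw [reassoc_of% curvePoint_cover, linePoint_toSpec]
  have hk : ∀ c, φ (algebraMap k K c) = algebraMap k K c := by
    have h1 : Spec.map ψ ≫ Spec.map (CommRingCat.ofHom (algebraMap k K)) =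
        Spec.map (CommRingCat.ofHom (algebraMap k K)) := by
      rw [← hto, hψ, reassoc_of% hE, ha]
    rw [← Spec.map_comp] at h1
    exact fun c ↦ congr($(Spec.map_injective h1) c)
  refine ⟨AlgEquiv.ofRingEquiv (f := φ) hk, ?_⟩
  change Spec.map ψ ≫ _ = _
  rw [hψ, hE]
  rfl

/-- Pullback of functions is contravariant, hence the reversed product. -/
lemma IsFunctionFieldMap.comp {h : IsHyperellipticPair f x y} {α β : Aut (curveOver f)}
    {φ ψ : K ≃ₐ[k] K} (hφ : IsFunctionFieldMap h α φ) (hψ : IsFunctionFieldMap h β ψ) :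
    IsFunctionFieldMap h (α * β) (ψ * φ) := by
  have h1 : CommRingCat.ofHom ((ψ * φ : K ≃ₐ[k] K) : K →+* K) =
      CommRingCat.ofHom (φ : K →+* K) ≫ CommRingCat.ofHom (ψ : K →+* K) := rfl
  unfold IsFunctionFieldMap at *
  rw [h1, autHom_mul, Spec.map_comp, Category.assoc, hφ, reassoc_of% hψ]

lemma IsFunctionFieldMap.one {h : IsHyperellipticPair f x y} : IsFunctionFieldMap h 1 1 := by
  have h1 : CommRingCat.ofHom ((1 : K ≃ₐ[k] K) : K →+* K) = 𝟙 _ := rfl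
  unfold IsFunctionFieldMap
  rw [h1, Spec.map_id, Category.id_comp, autHom_one, Category.comp_id]

lemma IsFunctionFieldMap.injective {h : IsHyperellipticPair f x y} [IsReduced (curve f)]
    {α β : Aut (curveOver f)} {φ : K ≃ₐ[k] K} (hφ : IsFunctionFieldMap h α φ)
    (hψ : IsFunctionFieldMap h β φ) : α = β := by
  have := h.isDominant_curvePoint
  exact autHom_injective (ext_of_isDominant (curvePoint f x y h.sq) (hφ.symm.trans hψ))

lemma IsFunctionFieldMap.unique {h : IsHyperellipticPair f x y} (hf : Squarefree f)
    (hd : 0 < f.natDegree) {α : Aut (curveOver f)} {φ ψ : K ≃ₐ[k] K}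
    (hφ : IsFunctionFieldMap h α φ) (hψ : IsFunctionFieldMap h α ψ) : φ = ψ := by
  have := curve_isIntegral hf hd
  obtain ⟨d, hd'⟩ := h.exists_iso_curvePoint hf hd
  have : Mono (curvePoint f x y h.sq) := by rw [← hd']; infer_instance
  have h1 : Spec.map (CommRingCat.ofHom (φ : K →+* K)) = Spec.map (CommRingCat.ofHom (ψ : K →+* K)) := by
    rw [← cancel_mono (curvePoint f x y h.sq)]
    exact hφ.trans hψ.symm
  ext z
  exact congr($(Spec.map_injective h1) z)

lemma exists_isKleinPair_algEquiv (h : IsHyperellipticPair f x y) (hf : Squarefree f)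
    (hd : 0 < f.natDegree) (H : ∃ a b : Aut (curveOver f), IsKleinPair a b) :
    ∃ σ τ : K ≃ₐ[k] K, IsKleinPair σ τ := by
  have := curve_isIntegral hf hd
  obtain ⟨a, b, hab⟩ := H
  obtain ⟨σ, hσ⟩ := exists_isFunctionFieldMap h hf hd a
  obtain ⟨τ, hτ⟩ := exists_isFunctionFieldMap h hf hd b
  have hone : IsFunctionFieldMap h 1 1 := .one
  refine ⟨σ, τ, (hσ.comp hσ).unique hf hd (hab.left ▸ hone),
    (hτ.comp hτ).unique hf hd (hab.right ▸ hone),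
    (hτ.comp hσ).unique hf hd (hab.comm ▸ hσ.comp hτ), ?_, ?_, ?_⟩
  · rintro rfl; exact hab.left_ne (hσ.injective .one)
  · rintro rfl; exact hab.right_ne (hτ.injective .one)
  · rintro rfl; exact hab.ne (hσ.injective hτ)

end Automorphisms

/-! ### Polynomial relations between two functions of small degree -/

section PlaneRelations

open Polynomial.Bivariate

variable {k : Type u} [Field k] {K : Type u} [Field K] [Algebra k K]

/-- Let `x` be transcendental. The polynomial relations between `x` and `x'`, if there are any, are
the multiples of an irreducible one. -/
lemma exists_irreducible_relation {x x' : K} (hx : Transcendental k x) {M : k[X][X]}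
    (hM : M ≠ 0) (h : aevalAeval x x' M = 0) : ∃ P : k[X][X], Irreducible P ∧ P ∣ M ∧
      aevalAeval x x' P = 0 ∧ ∀ Q : k[X][X], aevalAeval x x' Q = 0 → P ∣ Q := by
  obtain ⟨s, hs, hsM⟩ := WfDvdMonoid.exists_factors M hM
  have hprod : aevalAeval x x' s.prod = 0 := by
    obtain ⟨v, hv⟩ := hsM
    rw [← hv, map_mul] at h
    exact (mul_eq_zero.mp h).resolve_right (v.isUnit.map (aevalAeval x x')).ne_zero
  rw [map_multiset_prod, Multiset.prod_eq_zero_iff, Multiset.mem_map] at hprod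
  obtain ⟨P, hPs, hP0⟩ := hprod
  have hPi := hs P hPs
  refine ⟨P, hPi, (Multiset.dvd_prod hPs).trans hsM.dvd, hP0, fun Q hQ ↦ ?_⟩
  have inj := transcendental_iff_injective.mp hx
  let : Algebra k[X] K := (aeval (R := k) x).toRingHom.toAlgebra
  have inj' : Function.Injective (algebraMap k[X] K) := inj
  let F := FractionRing k[X]
  let j : F →ₐ[k[X]] K := IsFractionRing.liftAlgHom (g := Algebra.ofId k[X] K) inj'
  let : Algebra F K := j.toRingHom.toAlgebra
  have : IsScalarTower k[X] F K := IsScalarTower.of_algebraMap_eq fun p ↦ (j.commutes p).symm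
  have hev : ∀ R : k[X][X], aeval x' (R.map (algebraMap k[X] F)) = aevalAeval x x' R := fun R ↦ by
    rw [aeval_map_algebraMap]
    have : (aeval (R := k[X]) x').toRingHom = (aevalAeval (R := k) x x').toRingHom := by
      refine Polynomial.ringHom_ext (fun p ↦ ?_) (by simp)
      rw [AlgHom.toRingHom_eq_coe, RingHom.coe_coe, aeval_C, AlgHom.toRingHom_eq_coe,
        RingHom.coe_coe, aevalAeval_C]
      rfl
    exact congr($this R)
  -- As `x` is transcendental, `P` involves the outer variable. By Gauss's lemma it stays
  -- irreducible over `k(x)`, so it is associated there to the minimal polynomial of `x'`.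
  have hdeg : P.natDegree ≠ 0 := by
    intro h0
    rw [eq_C_of_natDegree_eq_zero h0] at hP0 hPi
    have : aeval x (P.coeff 0) = 0 := by simpa using hP0
    rw [inj (this.trans (map_zero _).symm), C_0] at hPi
    exact hPi.ne_zero rfl
  have hprim := hPi.isPrimitive hdeg
  have hPF := (hprim.irreducible_iff_irreducible_map_fraction_map (K := F)).mp hPi
  have h1 : minpoly F x' ∣ P.map (algebraMap k[X] F) := minpoly.dvd _ _ (by rw [hev, hP0])
  have h2 : minpoly F x' ∣ Q.map (algebraMap k[X] F) := minpoly.dvd _ _ (by rw [hev, hQ])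
  have h3 : Associated (minpoly F x') (P.map (algebraMap k[X] F)) :=
    ((hPF.dvd_iff.mp h1).resolve_left (minpoly.not_isUnit F x')).symm
  exact hprim.dvd_of_fraction_map_dvd_fraction_map (h3.symm.dvd.trans h2)

/-- A divisor has smaller degree in the inner variable. -/
lemma natDegree_coeff_le_of_dvd {P Q : k[X][X]} (hQ : Q ≠ 0) (h : P ∣ Q) {n : ℕ}
    (hn : (swap Q).natDegree ≤ n) (i : ℕ) : (P.coeff i).natDegree ≤ n := by
  have h1 : (swap P).natDegree ≤ n :=
    (natDegree_le_of_dvd (map_dvd swap h) (by simpa using hQ)).trans hn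
  have h2 : ∀ (R : k[X][X]) i j, ((swap R).coeff i).coeff j = (R.coeff j).coeff i := by
    intro R i j
    induction R using Polynomial.induction_on' with
    | add p q hp hq => simp only [map_add, coeff_add, hp, hq]
    | monomial n p =>
      induction p using Polynomial.induction_on' with
      | add p q hp hq => simp only [map_add, coeff_add, hp, hq]
      | monomial m c =>
        rw [swap_monomial_monomial]
        simp only [coeff_monomial]
        split_ifs <;> simp_all [coeff_monomial]
  rw [natDegree_le_iff_coeff_eq_zero]
  intro m hm
  rw [← h2, coeff_eq_zero_of_natDegree_lt (h1.trans_lt hm), coeff_zero]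

lemma aevalAeval_quadratic (x x' : K) (a b c : k[X]) :
    aevalAeval x x' (C a * X ^ 2 + C b * X + C c : k[X][X]) =
      aeval x a * x' ^ 2 + aeval x b * x' + aeval x c := by
  simp only [map_add, map_mul, map_pow, aevalAeval_C, aevalAeval_Y]

/-- If `x` and `x'` satisfy a relation of degree at most `m` in `x'`, and a relation of degree at
most `n` in `x`, then they satisfy an irreducible relation with both bounds on the degrees. -/
lemma exists_irreducible_relation_natDegree_le {x x' : K} (hx : Transcendental k x)
    {M N : k[X][X]} (hM : M ≠ 0) (hN : N ≠ 0) (h : aevalAeval x x' M = 0)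
    (h' : aevalAeval x' x N = 0) : ∃ P : k[X][X], P ≠ 0 ∧ P ∣ M ∧ aevalAeval x x' P = 0 ∧
      ∀ i, (P.coeff i).natDegree ≤ N.natDegree := by
  obtain ⟨P, hP, hPM, hP0, hQ⟩ := exists_irreducible_relation hx hM h
  refine ⟨P, hP.ne_zero, hPM, hP0, fun i ↦ ?_⟩
  -- With its variables exchanged, `N` is a relation between `x` and `x'`, hence a multiple of `P`,
  -- and bounds the degree of `P` in `x`.
  refine natDegree_coeff_le_of_dvd (Q := swap N) (by simpa using hN)
    (hQ (swap N) (by rw [aevalAeval_swap, h'])) ?_ i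
  rw [swap_swap_apply]

lemma natDegree_quadratic_le' (a b c : k[X]) :
    (C a * X ^ 2 + C b * X + C c : k[X][X]).natDegree ≤ 2 := natDegree_quadratic_le

/-- The quadratic equation of an element of the function field of `y² = f(x)`. -/
lemma IsHyperellipticPair.exists_quadratic {f : k[X]} {x y : K} (h : IsHyperellipticPair f x y)
    (z : K) : ∃ p q e : k[X], e ≠ 0 ∧ z * aeval x e = aeval x p + aeval x q * y ∧
      aevalAeval x z (C (e ^ 2) * X ^ 2 + C (-(2 * p * e)) * X + C (p ^ 2 - q ^ 2 * f)) = 0 := by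
  obtain ⟨p, q, e, he, hz⟩ := h.gen z
  refine ⟨p, q, e, he, hz, ?_⟩
  rw [aevalAeval_quadratic]
  simp only [map_sub, map_mul, map_pow, map_neg, map_ofNat, ← h.sq]
  linear_combination (z * aeval x e - aeval x p + aeval x q * y) * hz

lemma coeff_quadratic (a b c : k[X]) :
    (C a * X ^ 2 + C b * X + C c : k[X][X]).coeff 2 = a ∧
    (C a * X ^ 2 + C b * X + C c : k[X][X]).coeff 1 = b ∧
    (C a * X ^ 2 + C b * X + C c : k[X][X]).coeff 0 = c := by
  refine ⟨?_, ?_, ?_⟩ <;> simp [coeff_X, coeff_C]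

lemma quadratic_ne_zero {a : k[X]} (ha : a ≠ 0) (b c : k[X]) :
    (C a * X ^ 2 + C b * X + C c : k[X][X]) ≠ 0 := by
  intro h
  rw [← (coeff_quadratic a b c).1, h, coeff_zero] at ha
  exact ha rfl

lemma eq_linear_of_natDegree_le_one {p : k[X]} (hp : p.natDegree ≤ 1) (z : K) :
    aeval z p = algebraMap k K (p.coeff 1) * z + algebraMap k K (p.coeff 0) := by
  conv_lhs => rw [eq_X_add_C_of_natDegree_le_one hp]
  simp

/-- The subfield `k(x)` of the function field of a hyperelliptic curve `y² = f(x)` contains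
every other function `x'` of degree two. -/
lemma IsHyperellipticPair.exists_mul_aeval_eq {f f' : k[X]} {x y x' y' : K}
    (h : IsHyperellipticPair f x y) (h' : IsHyperellipticPair f' x' y') (hf : Squarefree f)
    (hd : 5 ≤ f.natDegree) (h2 : (2 : k) ≠ 0) :
    ∃ p e : k[X], e ≠ 0 ∧ x' * aeval x e = aeval x p := by
  obtain ⟨p, q, e, he, hz, hM⟩ := h.exists_quadratic x'
  by_cases hq : q = 0
  · exact ⟨p, e, he, by simpa [hq] using hz⟩
  obtain ⟨p', q', e', he', hz', hN⟩ := h'.exists_quadratic x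
  obtain ⟨P, hP, ⟨R, hR⟩, hP0, hPd⟩ := exists_irreducible_relation_natDegree_le h.transcendental
    (quadratic_ne_zero (pow_ne_zero 2 he) _ _) (quadratic_ne_zero (pow_ne_zero 2 he') _ _) hM hN
  replace hPd := fun i ↦ (hPd i).trans (natDegree_quadratic_le' _ _ _)
  have hR0 : R ≠ 0 := by
    rintro rfl
    exact quadratic_ne_zero (pow_ne_zero 2 he) _ _ (hR.trans (mul_zero _))
  have hdeg : P.natDegree + R.natDegree = 2 := by
    rw [← natDegree_mul hP hR0, ← hR, natDegree_quadratic (pow_ne_zero 2 he)]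
  -- Linear in `x'`, the irreducible relation solves for `x'` as a fraction in `x`. The quadratic
  -- case is excluded by its discriminant.
  by_cases hPle : P.natDegree ≤ 1
  · rw [eq_X_add_C_of_natDegree_le_one hPle] at hP0 hP
    rw [map_add, map_mul, aevalAeval_C, aevalAeval_C, aevalAeval_Y] at hP0
    refine ⟨-P.coeff 0, P.coeff 1, fun h0 ↦ ?_, ?_⟩
    · rw [h0, map_zero, zero_mul, zero_add] at hP0
      refine hP ?_
      rw [h0, (h.indep (P.coeff 0) 0 (by simpa using hP0)).1]
      simp
    · rw [map_neg]
      linear_combination hP0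
  · exfalso
    have hR1 : R.natDegree = 0 := by omega
    have hP2 : P.natDegree ≤ 2 := by omega
    rw [eq_C_of_natDegree_eq_zero hR1] at hR hR0
    set r := R.coeff 0
    have hr : r ≠ 0 := fun h0 ↦ hR0 (by rw [h0, C_0])
    obtain ⟨c2, c1, c0⟩ := coeff_quadratic (e ^ 2) (-(2 * p * e)) (p ^ 2 - q ^ 2 * f)
    have e2 : e ^ 2 = P.coeff 2 * r := by rw [← coeff_mul_C, ← hR, c2]
    have e1 : -(2 * p * e) = P.coeff 1 * r := by rw [← coeff_mul_C, ← hR, c1]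
    have e0 : p ^ 2 - q ^ 2 * f = P.coeff 0 * r := by rw [← coeff_mul_C, ← hR, c0]
    -- Up to the factor `r`, free of the outer variable, `P` is the quadratic equation of `x'`, so
    -- the discriminants differ by `r²`.
    have hdisc : r ^ 2 * (P.coeff 1 ^ 2 - 4 * P.coeff 2 * P.coeff 0) = (2 * e * q) ^ 2 * f := by
      linear_combination (P.coeff 1 * r - 2 * p * e) * (-e1) + 4 * (p ^ 2 - q ^ 2 * f) * e2 +
        4 * (P.coeff 2 * r) * e0
    obtain ⟨w, hw⟩ := dvd_of_sq_dvd_sq_mul hf hr (Dvd.intro _ hdisc)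
    have hw0 : w ≠ 0 := by
      rintro rfl
      have h2' : (2 : k[X]) ≠ 0 := by
        rw [← map_ofNat C 2]
        exact C_ne_zero.mpr h2
      rw [mul_zero] at hw
      exact mul_ne_zero (mul_ne_zero h2' he) hq hw
    have hf0 : f ≠ 0 := hf.ne_zero
    have hdisc' : P.coeff 1 ^ 2 - 4 * P.coeff 2 * P.coeff 0 = w ^ 2 * f := by
      refine mul_left_cancel₀ (pow_ne_zero 2 hr) ?_
      rw [hdisc, hw]
      ring
    -- All coefficients of `P` have degree at most 2, whereas `w² f` has degree at least 5.
    have hle : (P.coeff 1 ^ 2 - 4 * P.coeff 2 * P.coeff 0).natDegree ≤ 4 := by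
      refine (natDegree_sub_le _ _).trans (max_le ?_ ?_)
      · exact natDegree_pow_le.trans (by have := hPd 1; omega)
      · have h4 : (4 : k[X]) = C 4 := (map_ofNat C 4).symm
        refine natDegree_mul_le.trans ?_
        rw [h4]
        have := natDegree_C_mul_le (4 : k) (P.coeff 2)
        have := hPd 2
        have := hPd 0
        omega
    rw [hdisc', natDegree_mul (pow_ne_zero 2 hw0) hf0] at hle
    omega

/-- Two functions of degree one with the same field of definition differ by a homography. -/
lemma exists_homography {x x' : K} (hx : Transcendental k x)
    {p e p' e' : k[X]} (he : e ≠ 0) (he' : e' ≠ 0) (h : x' * aeval x e = aeval x p)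
    (h' : x * aeval x' e' = aeval x' p') : ∃ α β γ δ : k, (γ ≠ 0 ∨ δ ≠ 0) ∧
      x' * (algebraMap k K γ * x + algebraMap k K δ) = algebraMap k K α * x + algebraMap k K β := by
  have key : ∀ (z z' : K) (a b : k[X]), aevalAeval z z' (C a * X + C b : k[X][X]) =
      aeval z a * z' + aeval z b := fun z z' a b ↦ by
    simp only [map_add, map_mul, aevalAeval_C, aevalAeval_Y]
  have hne : ∀ a b : k[X], a ≠ 0 → (C a * X + C b : k[X][X]) ≠ 0 := fun a b ha h0 ↦ by
    have := congrArg (coeff · 1) h0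
    simp at this
    exact ha this
  -- Both given relations are linear in one of the functions, so `P` has degree at most 1 in each
  -- variable; such an equation is a homography.
  obtain ⟨P, hP, hPM, hP0, hPd⟩ := exists_irreducible_relation_natDegree_le hx
    (M := C e * X + C (-p)) (N := C e' * X + C (-p')) (hne _ _ he) (hne _ _ he')
    (by rw [key x x', map_neg]; linear_combination h)
    (by rw [key x' x, map_neg]; linear_combination h')
  have hPle : P.natDegree ≤ 1 :=
    (natDegree_le_of_dvd hPM (hne _ _ he)).trans natDegree_linear_le
  replace hPd := fun i ↦ (hPd i).trans natDegree_linear_le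
  rw [eq_X_add_C_of_natDegree_le_one hPle] at hP0 hP
  rw [key x x', eq_linear_of_natDegree_le_one (hPd 1), eq_linear_of_natDegree_le_one (hPd 0)] at hP0
  refine ⟨-(P.coeff 0).coeff 1, -(P.coeff 0).coeff 0, (P.coeff 1).coeff 1, (P.coeff 1).coeff 0,
    ?_, ?_⟩
  · by_contra! h0
    have hc1 : P.coeff 1 = 0 := by
      rw [eq_X_add_C_of_natDegree_le_one (hPd 1), h0.1, h0.2]; simp
    have hc0 : P.coeff 0 = 0 := by
      refine transcendental_iff.mp hx _ ?_
      rw [eq_linear_of_natDegree_le_one (hPd 0)]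
      simpa [h0.1, h0.2] using hP0
    exact hP (by rw [hc1, hc0]; simp)
  · simp only [map_neg]
    linear_combination hP0

end PlaneRelations

/-! ### Normal form of an involution, and the equation `y² = F(x²)` -/

section Involution

variable {k : Type u} [Field k] {K : Type u} [Field K] [Algebra k K]

lemma aeval_mem_intermediateField (F : IntermediateField k K) {x : K} (hx : x ∈ F) (p : k[X]) :
    aeval x p ∈ F := by
  have := IntermediateField.aeval_coe F (⟨x, hx⟩ : F) p
  rw [this]
  exact SetLike.coe_mem _

lemma IsHyperellipticPair.adjoin_eq_top {f : k[X]} {x y : K} (h : IsHyperellipticPair f x y) :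
    IntermediateField.adjoin k {x, y} = ⊤ := by
  refine eq_top_iff.mpr fun z _ ↦ ?_
  have hx : x ∈ IntermediateField.adjoin k {x, y} := IntermediateField.subset_adjoin _ _ (by simp)
  have hy : y ∈ IntermediateField.adjoin k {x, y} := IntermediateField.subset_adjoin _ _ (by simp)
  obtain ⟨p, q, e, he, hz⟩ := h.gen z
  rw [eq_div_of_mul_eq (h.aeval_ne_zero he) hz]
  exact div_mem (add_mem (aeval_mem_intermediateField _ hx p)
    (mul_mem (aeval_mem_intermediateField _ hx q) hy)) (aeval_mem_intermediateField _ hx e)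

lemma IsHyperellipticPair.of_adjoin {f : k[X]} {x y : K} (hf : Squarefree f)
    (hd : 0 < f.natDegree) (hx : Transcendental k x) (hsq : y ^ 2 = aeval x f)
    (hgen : IntermediateField.adjoin k {x, y} = ⊤) : IsHyperellipticPair f x y := by
  refine .of_div hsq (indep_of_squarefree hf hd hx hsq) fun z ↦ ?_
  have hz : z ∈ IntermediateField.adjoin k {x, y} := hgen ▸ IntermediateField.mem_top
  obtain ⟨a, ha, b, hb, rfl⟩ := IntermediateField.mem_adjoin_iff_div.mp hz
  have hle : Algebra.adjoin k {x, y} ≤ (evalPoint f x y hsq).range := by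
    refine Algebra.adjoin_le ?_
    rintro _ (rfl | rfl)
    · exact ⟨AdjoinRoot.of _ X, by simp⟩
    · exact ⟨AdjoinRoot.root _, by simp⟩
  by_cases hb0 : b = 0
  · exact ⟨0, 1, by simp, by simp [hb0]⟩
  · obtain ⟨a', rfl⟩ := hle ha
    obtain ⟨b', rfl⟩ := hle hb
    exact ⟨a', b', hb0, div_mul_cancel₀ _ hb0⟩

lemma IsModelOfGenus.natDegree_pos {g : ℕ} {f : k[X]} (hg : IsModelOfGenus g f) :
    0 < f.natDegree := by
  have := hg.2
  omega

lemma squarefree_comp_X_add_C {f : k[X]} (hf : Squarefree f) (c : k) :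
    Squarefree (f.comp (X + C c)) := by
  have h : f.comp (X + C c) = Polynomial.algEquivAevalXAddC c f := by
    simp [aeval_def, comp]
  rw [h]
  intro d hd
  have h1 := map_dvd (Polynomial.algEquivAevalXAddC c).symm hd
  rw [map_mul, AlgEquiv.symm_apply_apply] at h1
  have := (hf _ h1).map (Polynomial.algEquivAevalXAddC c)
  rwa [AlgEquiv.apply_symm_apply] at this

lemma IsModelOfGenus.comp_X_add_C {g : ℕ} {f : k[X]} (hg : IsModelOfGenus g f) (c : k) :
    IsModelOfGenus g (f.comp (X + C c)) :=
  ⟨squarefree_comp_X_add_C hg.1 c, by rw [natDegree_comp, natDegree_X_add_C, mul_one]; exact hg.2⟩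

lemma transcendental_add_algebraMap {x : K} (hx : Transcendental k x) (c : k) :
    Transcendental k (x + algebraMap k K c) := fun h ↦ hx (by
  have := h.sub (isAlgebraic_algebraMap c)
  rwa [add_sub_cancel_right] at this)

lemma IsHyperellipticPair.add_algebraMap {g : ℕ} {f : k[X]} {x y : K}
    (h : IsHyperellipticPair f x y) (hg : IsModelOfGenus g f) (c : k) :
    IsHyperellipticPair (f.comp (X + C (-c))) (x + algebraMap k K c) y := by
  have hg' := hg.comp_X_add_C (-c)
  refine .of_adjoin hg'.1 hg'.natDegree_pos (transcendental_add_algebraMap h.transcendental c) ?_ ?_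
  · rw [h.sq, aeval_comp]
    simp
  · refine eq_top_iff.mpr (h.adjoin_eq_top.symm.le.trans ?_)
    set F := IntermediateField.adjoin k {x + algebraMap k K c, y}
    have h1 : x + algebraMap k K c ∈ F := IntermediateField.subset_adjoin _ _ (by simp)
    have h2 : y ∈ F := IntermediateField.subset_adjoin _ _ (by simp)
    refine IntermediateField.adjoin_le_iff.mpr ?_
    rintro _ (rfl | rfl)
    · simpa using sub_mem h1 (F.algebraMap_mem c)
    · exact h2

/-- Reflection in degree `2g + 2` exchanges the branch points `0` and `∞`; degree `2g + 1` means a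
branch point at `∞`. A square factor `d²` reflects back to a square factor of `f`, so `d` is a
constant times a power of `X`; but `X²` divides the reflection only if the top two coefficients of
`f` vanish. Dually, a degree below `2g + 1` would force `X² ∣ f`. -/
lemma isModelOfGenus_reflect {g : ℕ} {f : k[X]} (hg : IsModelOfGenus g f) :
    IsModelOfGenus g (f.reflect (2 * g + 2)) := by
  have hle : f.natDegree ≤ 2 * g + 2 := by have := hg.2; omega
  have hle' : (f.reflect (2 * g + 2)).natDegree ≤ 2 * g + 2 :=
    natDegree_reflect_le.trans (max_le le_rfl hle)
  have hne : f.reflect (2 * g + 2) ≠ 0 := by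
    rw [Ne, reflect_eq_zero_iff]; exact hg.1.ne_zero
  refine ⟨fun d ⟨s, hs⟩ ↦ ?_, ?_⟩
  · have hd0 : d ≠ 0 := by rintro rfl; simp at hs; exact hg.1.ne_zero hs
    have hs0 : s ≠ 0 := by rintro rfl; simp at hs; exact hg.1.ne_zero hs
    have hdeg : d.natDegree + d.natDegree + s.natDegree ≤ 2 * g + 2 := by
      rw [hs, natDegree_mul (mul_ne_zero hd0 hd0) hs0, natDegree_mul hd0 hd0] at hle'
      exact hle'
    have h1 : f = (d.reflect d.natDegree * d.reflect d.natDegree) *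
        s.reflect (2 * g + 2 - (d.natDegree + d.natDegree)) := by
      rw [← reflect_mul _ _ le_rfl le_rfl, ← reflect_mul _ _ natDegree_mul_le (by omega),
        Nat.add_sub_cancel' (by omega), ← hs, reflect_reflect]
    have hu := hg.1 _ (Dvd.intro _ h1.symm)
    obtain ⟨c, hc, hdc⟩ := Polynomial.isUnit_iff.mp hu
    have hd : d = C c * X ^ d.natDegree := by
      rw [← reflect_C, hdc, reflect_reflect]
    by_cases hm : d.natDegree = 0
    · rw [hm, pow_zero, mul_one] at hd
      rw [hd]; exact hc.map C
    · exfalso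
      have hX : X ∣ d := by
        rw [hd]; exact (dvd_pow_self X hm).mul_left _
      have hX2 : X ^ 2 ∣ f.reflect (2 * g + 2) := by
        rw [hs, sq]; exact (mul_dvd_mul hX hX).mul_right s
      rw [X_pow_dvd_iff] at hX2
      have e0 := hX2 0 (by norm_num)
      have e1 := hX2 1 (by norm_num)
      rw [coeff_reflect, revAt_le (by omega)] at e0 e1
      rcases hg.2 with h | h
      · refine hg.1.ne_zero (leadingCoeff_eq_zero.mp ?_)
        rw [leadingCoeff, h]; exact e1
      · refine hg.1.ne_zero (leadingCoeff_eq_zero.mp ?_)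
        rw [leadingCoeff, h]; exact e0
  · by_contra! hlt
    have hX2 : X ^ 2 ∣ f := by
      rw [X_pow_dvd_iff]
      intro d hd
      have h1 : (f.reflect (2 * g + 2)).coeff (2 * g + 2 - d) = 0 :=
        coeff_eq_zero_of_natDegree_lt (by omega)
      rw [coeff_reflect, revAt_le (by omega)] at h1
      rwa [show 2 * g + 2 - (2 * g + 2 - d) = d by omega] at h1
    have := hg.1 X (by rwa [← sq])
    exact not_isUnit_X this

lemma aeval_inv_reflect {x : K} (hx : x ≠ 0) {f : k[X]} {N : ℕ} (hN : f.natDegree ≤ N) :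
    aeval x⁻¹ (f.reflect N) * x ^ N = aeval x f := by
  let : Invertible x := invertibleOfNonzero hx
  have := eval₂_reflect_mul_pow (algebraMap k K) x N f hN
  rwa [invOf_eq_inv] at this

/-- Dividing `y² = f(x)` by `x ^ (2g + 2)`, a square, turns the right side into the reflected
polynomial at `1/x`. -/
lemma IsHyperellipticPair.inv {g : ℕ} {f : k[X]} {x y : K}
    (h : IsHyperellipticPair f x y) (hg : IsModelOfGenus g f) :
    IsHyperellipticPair (f.reflect (2 * g + 2)) x⁻¹ (y / x ^ (g + 1)) := by
  have hg' := isModelOfGenus_reflect hg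
  have hx0 : x ≠ 0 := fun h0 ↦ h.transcendental (h0 ▸ isAlgebraic_zero)
  refine .of_adjoin hg'.1 hg'.natDegree_pos
    (fun h0 ↦ h.transcendental (IsAlgebraic.inv_iff.mp h0)) ?_ ?_
  · rw [div_pow, h.sq, div_eq_iff (pow_ne_zero _ (pow_ne_zero _ hx0)), ← pow_mul,
      show (g + 1) * 2 = 2 * g + 2 by ring, aeval_inv_reflect hx0]
    have := hg.2; omega
  · refine eq_top_iff.mpr (h.adjoin_eq_top.symm.le.trans ?_)
    set F := IntermediateField.adjoin k {x⁻¹, y / x ^ (g + 1)}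
    have h1 : x⁻¹ ∈ F := IntermediateField.subset_adjoin _ _ (by simp)
    have h2 : y / x ^ (g + 1) ∈ F := IntermediateField.subset_adjoin _ _ (by simp)
    have h3 : x ∈ F := by simpa using inv_mem h1
    refine IntermediateField.adjoin_le_iff.mpr ?_
    rintro _ (rfl | rfl)
    · exact h3
    · have := mul_mem h2 (pow_mem h3 (g + 1))
      rwa [div_mul_cancel₀ _ (pow_ne_zero _ hx0)] at this

/-- An involution of a hyperelliptic function field that moves `x` is `x ↦ -x` for a suitable
choice of `x`. -/
lemma IsHyperellipticPair.exists_neg [IsAlgClosed k] {g : ℕ} (hg2 : 2 ≤ g) {f : k[X]} {x y : K}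
    (h : IsHyperellipticPair f x y) (hg : IsModelOfGenus g f) (h2 : (2 : k) ≠ 0)
    (σ : K ≃ₐ[k] K) (hσ : σ * σ = 1) (hσx : σ x ≠ x) :
    ∃ (f' : k[X]) (x' y' : K), IsModelOfGenus g f' ∧ IsHyperellipticPair f' x' y' ∧
      σ x' = -x' ∧ Nonempty (model k x ≅ model k x') := by
  have hσσ : ∀ z, σ (σ z) = z := fun z ↦ congr($hσ z)
  have hd : 5 ≤ f.natDegree := by have := hg.2; omega
  have hσc : ∀ c, σ (algebraMap k K c) = algebraMap k K c := σ.commutes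
  have h2K : (2 : K) ≠ 0 := by
    rw [← map_ofNat (algebraMap k K) 2]
    exact (_root_.map_ne_zero _).mpr h2
  have hinj : Function.Injective (algebraMap k K) := (algebraMap k K).injective
  have hnotc : ∀ c, x ≠ algebraMap k K c := fun c hc ↦
    h.transcendental (hc ▸ isAlgebraic_algebraMap c)
  obtain ⟨p, e, he, hp⟩ := h.exists_mul_aeval_eq (h.map σ) hg.1 hd h2
  have hp' : x * aeval (σ x) e = aeval (σ x) p := by
    have := congrArg σ hp
    rwa [map_mul, hσσ, ← aeval_algHom_apply, ← aeval_algHom_apply] at this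
  obtain ⟨α, β, γ, δ, hγδ, hrel⟩ := exists_homography h.transcendental he he hp hp'
  have hrel' : x * (algebraMap k K γ * σ x + algebraMap k K δ) =
      algebraMap k K α * σ x + algebraMap k K β := by
    have := congrArg σ hrel
    simpa only [map_mul, map_add, hσσ, hσc] using this
  -- Applying `σ` to the relation exchanges `x` and `σ x`. Subtracting shows that the matrix of a
  -- homography of order two has trace zero.
  have hδ : algebraMap k K δ = -algebraMap k K α := by
    have h0 : (algebraMap k K δ + algebraMap k K α) * (σ x - x) = 0 := by
      linear_combination hrel - hrel'
    have := (mul_eq_zero.mp h0).resolve_right (sub_ne_zero.mpr hσx)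
    linear_combination this
  -- For `γ = 0` the relation is `x + σ x = β/δ`, and shifting by half of this constant suffices.
  by_cases hγ : γ = 0
  · subst hγ
    have hδ0 : δ ≠ 0 := by simpa using hγδ
    have hδ0' : algebraMap k K δ ≠ 0 := (_root_.map_ne_zero _).mpr hδ0
    refine ⟨_, x + algebraMap k K (-(β / (2 * δ))), y, hg.comp_X_add_C _,
      h.add_algebraMap hg _, ?_, nonempty_model_iso_add x _⟩
    rw [map_add, hσc, map_neg, map_div₀, map_mul, map_ofNat]
    rw [map_zero, zero_mul, zero_add] at hrel
    field_simp
    linear_combination 2 * hrel + 2 * x * hδ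
  -- The fixed points of the homography are `a ± r` with `a = α/γ`. The first is sent to infinity by
  -- `x₁⁻¹` with `x₁ = x - (a + r)`; the second then has coordinate `-1/(2r)` and is moved to `0`.
  -- An involution fixing `0` and `∞` is a sign change.
  · obtain ⟨r, hr⟩ := IsAlgClosed.exists_pow_nat_eq (β / γ + (α / γ) ^ 2) (n := 2) two_pos
    have hγ' : algebraMap k K γ ≠ 0 := (_root_.map_ne_zero _).mpr hγ
    set a := α / γ with ha
    have hαa : algebraMap k K α = algebraMap k K a * algebraMap k K γ := by
      rw [← map_mul, ha, div_mul_cancel₀ _ hγ]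
    have hprod : (x - algebraMap k K a) * (σ x - algebraMap k K a) = algebraMap k K r ^ 2 := by
      have hb : algebraMap k K β = algebraMap k K (β / γ) * algebraMap k K γ := by
        rw [← map_mul, div_mul_cancel₀ _ hγ]
      rw [← map_pow, hr, map_add, map_pow]
      refine mul_left_cancel₀ hγ' ?_
      linear_combination hrel - σ x * hδ + (x + σ x) * hαa + hb
    -- Coinciding fixed points would make `x` or `σ x` constant.
    have hr0 : r ≠ 0 := by
      rintro rfl
      rw [map_zero, zero_pow two_ne_zero, mul_eq_zero, sub_eq_zero, sub_eq_zero] at hprod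
      rcases hprod with h0 | h0
      · exact hnotc _ h0
      · exact hnotc a (by rw [← hσσ x, h0, hσc])
    have hr0' : algebraMap k K r ≠ 0 := (_root_.map_ne_zero _).mpr hr0
    set x₁ := x + algebraMap k K (-(a + r)) with hx₁
    have hx₁0 : x₁ ≠ 0 := fun h0 ↦ hnotc (a + r) (by
      rw [hx₁, map_neg] at h0
      linear_combination h0)
    have hσx₁0 : σ x₁ ≠ 0 := (_root_.map_ne_zero _).mpr hx₁0
    have hσx₁ : σ x₁ = σ x + algebraMap k K (-(a + r)) := by rw [hx₁, map_add, hσc]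
    have hg₁ := hg.comp_X_add_C (-(-(a + r)))
    have h₁ := h.add_algebraMap hg (-(a + r))
    have hg₂ := isModelOfGenus_reflect hg₁
    have h₂ := h₁.inv hg₁
    refine ⟨_, x₁⁻¹ + algebraMap k K (1 / (2 * r)), _, hg₂.comp_X_add_C _,
      h₂.add_algebraMap hg₂ _, ?_, ?_⟩
    · rw [map_add, hσc, map_inv₀, map_div₀, map_mul, map_one, map_ofNat]
      have hsum : x₁ * σ x₁ + algebraMap k K r * (x₁ + σ x₁) = 0 := by
        rw [hσx₁, hx₁, map_neg, map_add]
        linear_combination hprod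
      field_simp
      linear_combination 2 * hsum
    · obtain ⟨i₁⟩ := nonempty_model_iso_add x (-(a + r))
      obtain ⟨i₂⟩ := nonempty_model_iso_inv (k := k) x₁ hx₁0
      obtain ⟨i₃⟩ := nonempty_model_iso_add x₁⁻¹ (1 / (2 * r))
      exact ⟨i₁ ≪≫ i₂ ≪≫ i₃⟩

lemma eq_expand_of_comp_neg {f : k[X]} (h2 : (2 : k) ≠ 0) (hf : f.comp (-X) = f) :
    f = expand k 2 (contract 2 f) := by
  ext n
  rw [coeff_expand two_pos]
  split_ifs with hn
  · rw [coeff_contract two_ne_zero, Nat.div_mul_cancel hn]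
  · have h1 := congrArg (coeff · n) hf
    rw [← neg_one_mul (X : k[X]), ← C_1, ← C_neg, comp_C_mul_X_coeff] at h1
    rw [(Nat.not_even_iff_odd.mp (fun h ↦ hn h.two_dvd)).neg_one_pow] at h1
    refine (mul_eq_zero.mp ?_).resolve_left h2
    linear_combination -h1

/-- Write `σ y = (a + b y)/e`. Its square `f(-x)` lies in `k(x)`, so `ab = 0`, and `b = 0` would
make `f(-x)` a square. Hence `σ y = w y` with `w² f(x) = f(-x)`; by degrees `w` is constant, and `σ²
= 1` gives `w² = 1`. So `f` is even. -/
lemma IsHyperellipticPair.exists_eq_expand {g : ℕ} {f : k[X]} {x y : K}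
    (h : IsHyperellipticPair f x y) (hg : IsModelOfGenus g f) (h2 : (2 : k) ≠ 0)
    (σ : K ≃ₐ[k] K) (hσ : σ * σ = 1) (hσx : σ x = -x) :
    ∃ F : k[X], f = expand k 2 F ∧ F.natDegree = g + 1 ∧ Squarefree F ∧ F.eval 0 ≠ 0 := by
  have hσσ : ∀ z, σ (σ z) = z := fun z ↦ congr($hσ z)
  have inj := transcendental_iff_injective.mp h.transcendental
  have hf0 : f ≠ 0 := hg.1.ne_zero
  have hcomp : ∀ p : k[X], σ (aeval x p) = aeval x (p.comp (-X)) := fun p ↦ by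
    rw [← aeval_algHom_apply, hσx, aeval_comp]; simp
  have hX : (-X : k[X]).natDegree = 1 := by rw [natDegree_neg, natDegree_X]
  obtain ⟨a, b, e, he, hy⟩ := h.gen (σ y)
  have hsq : (σ y) ^ 2 = aeval x (f.comp (-X)) := by rw [← map_pow, h.sq, hcomp]
  obtain ⟨h1, h3⟩ := h.indep (a ^ 2 + b ^ 2 * f - e ^ 2 * f.comp (-X)) (2 * a * b) (by
    simp only [map_add, map_sub, map_mul, map_pow, ← h.sq, ← hsq, map_ofNat]
    linear_combination (-(σ y * aeval x e) - aeval x a - aeval x b * y) * hy)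
  have h2' : (2 : k[X]) ≠ 0 := by
    rw [← map_ofNat C 2]; exact C_ne_zero.mpr h2
  have hfc : Squarefree (f.comp (-X)) := by
    intro d hd
    obtain ⟨s, hs⟩ := hd
    have h4 : f = d.comp (-X) * d.comp (-X) * s.comp (-X) := by
      rw [← mul_comp, ← mul_comp, ← hs, comp_assoc]; simp
    have := natDegree_eq_zero_of_isUnit (hg.1 _ (Dvd.intro _ h4.symm))
    rw [natDegree_comp, hX, mul_one] at this
    rw [eq_C_of_natDegree_eq_zero this, isUnit_C, isUnit_iff_ne_zero]
    intro h0
    rw [eq_C_of_natDegree_eq_zero this, h0] at h4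
    simp at h4
    exact hf0 h4
  have hdc : 0 < (f.comp (-X)).natDegree := by
    rw [natDegree_comp, hX, mul_one]; exact hg.natDegree_pos
  have ha : a = 0 := by
    rcases mul_eq_zero.mp h3 with h4 | rfl
    · exact (mul_eq_zero.mp h4).resolve_left h2'
    · exfalso
      obtain ⟨w, rfl⟩ : e ∣ a := (UniqueFactorizationMonoid.pow_dvd_pow_iff_dvd two_ne_zero).mp
        ⟨f.comp (-X), by linear_combination h1⟩
      refine not_sq_of_squarefree hfc hdc w (mul_left_cancel₀ (pow_ne_zero 2 he) ?_)
      linear_combination h1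
  subst ha
  obtain ⟨w, rfl⟩ := dvd_of_sq_dvd_sq_mul hg.1 (q := b) he
    ⟨f.comp (-X), by linear_combination h1⟩
  have hw : w ^ 2 * f = f.comp (-X) := by
    refine mul_left_cancel₀ (pow_ne_zero 2 he) ?_
    linear_combination h1
  have hyw : σ y = aeval x w * y := by
    refine mul_right_cancel₀ (h.aeval_ne_zero he) ?_
    rw [hy, map_mul]; simp; ring
  have hw0 : w ≠ 0 := by
    rintro rfl
    rw [zero_pow two_ne_zero, zero_mul] at hw
    exact hfc.ne_zero hw.symm
  have hwd : w.natDegree = 0 := by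
    have := congrArg natDegree hw
    rw [natDegree_mul (pow_ne_zero 2 hw0) hf0, natDegree_pow, natDegree_comp, hX] at this
    omega
  rw [eq_C_of_natDegree_eq_zero hwd] at hw hyw
  set c := w.coeff 0
  rw [aeval_C] at hyw
  have hy0 : y ≠ 0 := by
    rintro rfl
    have := (h.indep 0 1 (by simp)).2
    exact one_ne_zero this
  have hc : c ^ 2 = 1 := by
    have h4 := hσσ y
    rw [hyw, map_mul, σ.commutes, hyw, ← mul_assoc, ← map_mul] at h4
    have h5 : algebraMap k K (c * c) = 1 := mul_right_cancel₀ hy0 (by rw [h4, one_mul])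
    rw [pow_two]
    exact FaithfulSMul.algebraMap_injective k K (h5.trans (map_one _).symm)
  have hev : f.comp (-X) = f := by rw [← hw, ← C_pow, hc, C_1, one_mul]
  have hfe := eq_expand_of_comp_neg h2 hev
  set F := contract 2 f
  have hdeg : f.natDegree = F.natDegree * 2 := by
    conv_lhs => rw [hfe, natDegree_expand]
  refine ⟨F, hfe, ?_, fun d ⟨s, hs⟩ ↦ ?_, fun h0 ↦ ?_⟩
  · have := hg.2; omega
  · have h4 := hg.1 (expand k 2 d) ⟨expand k 2 s, by rw [hfe, hs, map_mul, map_mul]⟩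
    have h5 := natDegree_eq_zero_of_isUnit h4
    rw [natDegree_expand] at h5
    have h6 : d.natDegree = 0 := by omega
    rw [eq_C_of_natDegree_eq_zero h6, expand_C] at h4
    rw [eq_C_of_natDegree_eq_zero h6]; exact h4
  -- A root of `F` at `0` would give `X² ∣ F(X²)`, against square-freeness.
  · obtain ⟨s, hs⟩ : X ∣ F := by rw [X_dvd_iff, coeff_zero_eq_eval_zero, h0]
    refine not_isUnit_X (hg.1 X ⟨expand k 2 s, ?_⟩)
    rw [hfe, hs, map_mul, expand_X]; ring

end Involution

/-! ### Biquadratic fields and generalized Howe form -/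

section Biquadratic
open IntermediateField

variable {k : Type u} [Field k] {K : Type u} [Field K] [Algebra k K]

/-- The field `K` is the biquadratic extension `k(s)(z₁, z₂)` with `z₁² = f₁(s)`,
`z₂² = f₂(s)`. -/
structure IsBiquadratic (f₁ f₂ : k[X]) (s z₁ z₂ : K) : Prop where
  transcendental : Transcendental k s
  sq_fst : z₁ ^ 2 = aeval s f₁
  sq_snd : z₂ ^ 2 = aeval s f₂
  indep : ∀ a ∈ k⟮s⟯, ∀ b ∈ k⟮s⟯, ∀ c ∈ k⟮s⟯, ∀ d ∈ k⟮s⟯,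
    a + b * z₁ + c * z₂ + d * (z₁ * z₂) = 0 → a = 0 ∧ b = 0 ∧ c = 0 ∧ d = 0
  adjoin_eq_top : IntermediateField.adjoin k {s, z₁, z₂} = ⊤

/-- The two summands are the even and the odd part. -/
lemma eq_zero_of_expand_add_X_mul_expand {p r : k[X]}
    (h : expand k 2 p + X * expand k 2 r = 0) : p = 0 ∧ r = 0 := by
  constructor
  · ext n
    have h1 := congrArg (coeff · (n * 2)) h
    simp only [coeff_add, coeff_expand_mul two_pos, coeff_zero] at h1
    cases n with
    | zero => simpa using h1
    | succ n =>
      rw [show (n + 1) * 2 = (n * 2 + 1) + 1 by ring, coeff_X_mul, coeff_expand two_pos,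
        if_neg (by omega), add_zero] at h1
      simpa using h1
  · ext n
    have h1 := congrArg (coeff · (n * 2 + 1)) h
    simp only [coeff_add, coeff_X_mul, coeff_expand_mul two_pos, coeff_zero] at h1
    rw [coeff_expand two_pos, if_neg (by omega), zero_add] at h1
    simpa using h1

/-- Clearing denominators reduces coefficients in `k(s)` to polynomial ones. -/
lemma indep_of_indep_polynomial {s z₁ z₂ : K}
    (h : ∀ p q r t : k[X], aeval s p + aeval s q * z₁ + aeval s r * z₂ + aeval s t * (z₁ * z₂) = 0 →
      p = 0 ∧ q = 0 ∧ r = 0 ∧ t = 0) :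
    ∀ a ∈ k⟮s⟯, ∀ b ∈ k⟮s⟯, ∀ c ∈ k⟮s⟯, ∀ d ∈ k⟮s⟯,
      a + b * z₁ + c * z₂ + d * (z₁ * z₂) = 0 → a = 0 ∧ b = 0 ∧ c = 0 ∧ d = 0 := by
  have key : ∀ a ∈ k⟮s⟯, ∃ p e : k[X], aeval s e ≠ 0 ∧ a * aeval s e = aeval s p := by
    intro a ha
    obtain ⟨p, e, rfl⟩ := (mem_adjoin_simple_iff k a).mp ha
    by_cases he : aeval s e = 0
    · exact ⟨0, 1, by simp, by simp [he]⟩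
    · exact ⟨p, e, he, div_mul_cancel₀ _ he⟩
  intro a ha b hb c hc d hd habcd
  obtain ⟨p, e, he, hp⟩ := key a ha
  obtain ⟨q, e', he', hq⟩ := key b hb
  obtain ⟨r, e'', he'', hr⟩ := key c hc
  obtain ⟨t, e''', he''', ht⟩ := key d hd
  have hne : ∀ {e : k[X]}, aeval s e ≠ 0 → e ≠ 0 := by rintro _ h rfl; simp at h
  have hne₀ := hne he
  have hne₁ := hne he'
  have hne₂ := hne he''
  have hne₃ := hne he'''
  obtain ⟨h1, h2, h3, h4⟩ := h (p * e' * e'' * e''') (q * e * e'' * e''') (r * e * e' * e''')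
    (t * e * e' * e'') (by
      simp only [map_mul, ← hp, ← hq, ← hr, ← ht]
      linear_combination aeval s e * aeval s e' * aeval s e'' * aeval s e''' * habcd)
  simp only [mul_eq_zero, hne₀, hne₁, hne₂, hne₃, or_false] at h1 h2 h3 h4
  rw [h1, map_zero] at hp
  rw [h2, map_zero] at hq
  rw [h3, map_zero] at hr
  rw [h4, map_zero] at ht
  exact ⟨(mul_eq_zero.mp hp).resolve_right he, (mul_eq_zero.mp hq).resolve_right he',
    (mul_eq_zero.mp hr).resolve_right he'', (mul_eq_zero.mp ht).resolve_right he'''⟩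

/-- A field `k(x, y)` with `y² = F(x²)` is biquadratic over `k(x²)`. -/
lemma IsHyperellipticPair.isBiquadratic {F : k[X]} {x y : K}
    (h : IsHyperellipticPair (expand k 2 F) x y) :
    IsBiquadratic F (X * F) (x ^ 2) y (x * y) := by
  have hsq : y ^ 2 = aeval (x ^ 2) F := by rw [h.sq, expand_aeval]
  have ht : Transcendental k (x ^ 2) := h.transcendental.pow two_pos
  have hF : F ≠ 0 := by
    rintro rfl
    have h1 := h.sq
    simp only [map_zero, pow_eq_zero_iff two_ne_zero] at h1
    exact one_ne_zero (h.indep 0 1 (by simp [h1])).2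
  have hy0 : y ≠ 0 := by
    rintro rfl
    exact one_ne_zero (h.indep 0 1 (by simp)).2
  refine ⟨ht, hsq, by rw [map_mul, aeval_X, mul_pow, hsq],
    indep_of_indep_polynomial fun p q r t hp ↦ ?_, ?_⟩
  -- Since `y · xy = x F(x²)`, the last term joins the part free of `y`. Independence of `1, y` over
  -- `k[x]`, followed by the even-odd splitting, separates the four coefficients.
  · obtain ⟨h1, h2⟩ := h.indep (expand k 2 p + X * expand k 2 (t * F))
      (expand k 2 q + X * expand k 2 r) (by
        simp only [map_add, map_mul, expand_aeval, aeval_X, ← hsq]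
        linear_combination hp)
    obtain ⟨hp, ht⟩ := eq_zero_of_expand_add_X_mul_expand h1
    obtain ⟨hq, hr⟩ := eq_zero_of_expand_add_X_mul_expand h2
    exact ⟨hp, hq, hr, (mul_eq_zero.mp ht).resolve_right hF⟩
  · rw [← top_le_iff, ← h.adjoin_eq_top, adjoin_le_iff]
    have hy : y ∈ IntermediateField.adjoin k {x ^ 2, y, x * y} := subset_adjoin k _ (by simp)
    have hxy : x * y ∈ IntermediateField.adjoin k {x ^ 2, y, x * y} := subset_adjoin k _ (by simp)
    rintro z (rfl | rfl)
    · have := div_mem hxy hy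
      rwa [mul_div_cancel_right₀ _ hy0] at this
    · exact hy

/-- Change of coordinates on a biquadratic field. -/
lemma IsBiquadratic.of_mem {f₁ f₂ f₁' f₂' : k[X]} {s t y₁ y₂ w₁ w₂ : K}
    (h : IsBiquadratic f₁ f₂ t y₁ y₂) (hs : Transcendental k s) (hst : s ∈ k⟮t⟯) (hts : t ∈ k⟮s⟯)
    (hw₁ : w₁ ∈ k⟮s⟯) (hw₂ : w₂ ∈ k⟮s⟯) (h₁ : w₁ ≠ 0) (h₂ : w₂ ≠ 0)
    (hsq₁ : (w₁ * y₁) ^ 2 = aeval s f₁') (hsq₂ : (w₂ * y₂) ^ 2 = aeval s f₂') :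
    IsBiquadratic f₁' f₂' s (w₁ * y₁) (w₂ * y₂) := by
  have hle : k⟮s⟯ ≤ k⟮t⟯ := adjoin_simple_le_iff.mpr hst
  have hle' : k⟮t⟯ ≤ k⟮s⟯ := adjoin_simple_le_iff.mpr hts
  refine ⟨hs, hsq₁, hsq₂, fun a ha b hb c hc d hd habcd ↦ ?_, ?_⟩
  · obtain ⟨h3, h4, h5, h6⟩ := h.indep a (hle ha) (b * w₁) (hle (mul_mem hb hw₁)) (c * w₂)
      (hle (mul_mem hc hw₂)) (d * w₁ * w₂) (hle (mul_mem (mul_mem hd hw₁) hw₂))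
      (by linear_combination habcd)
    simp only [mul_eq_zero, h₁, h₂, or_false] at h4 h5 h6
    exact ⟨h3, h4, h5, h6⟩
  · rw [← top_le_iff, ← h.adjoin_eq_top, adjoin_le_iff]
    set E := IntermediateField.adjoin k {s, w₁ * y₁, w₂ * y₂}
    have hsE : k⟮s⟯ ≤ E := adjoin_simple_le_iff.mpr (subset_adjoin k _ (by simp))
    have hE₁ : w₁ * y₁ ∈ E := subset_adjoin k _ (by simp)
    have hE₂ : w₂ * y₂ ∈ E := subset_adjoin k _ (by simp)
    rintro z (rfl | rfl | rfl)
    · exact hsE hts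
    · have := div_mem hE₁ (hsE hw₁)
      rwa [mul_div_cancel_left₀ _ h₁] at this
    · have := div_mem hE₂ (hsE hw₂)
      rwa [mul_div_cancel_left₀ _ h₂] at this

lemma aeval_rootPoly (A : Finset k) (z : K) :
    aeval z (rootPoly A) = ∏ a ∈ A, (z - algebraMap k K a) := by
  simp [rootPoly, map_prod]

lemma natDegree_rootPoly (A : Finset k) : (rootPoly A).natDegree = A.card := by
  exact (natDegree_prod_of_monic A (fun a ↦ X - C a) fun a _ ↦ monic_X_sub_C a).trans (by simp)

lemma squarefree_rootPoly_mul {A B : Finset k} (h : Disjoint A B) :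
    Squarefree (rootPoly A * rootPoly B) := by
  classical
  rw [rootPoly, rootPoly, ← Finset.prod_union h]
  refine Separable.squarefree (separable_prod_X_sub_C_iff'.mpr fun _ _ _ _ h ↦ h)

lemma natDegree_rootPoly_mul (A B : Finset k) :
    (rootPoly A * rootPoly B).natDegree = A.card + B.card := by
  rw [natDegree_mul, natDegree_rootPoly, natDegree_rootPoly] <;>
  exact (monic_prod_of_monic _ _ fun a _ ↦ monic_X_sub_C a).ne_zero

lemma exists_eq_C_mul_rootPoly [IsAlgClosed k] {F : k[X]} (hF : Squarefree F) :
    ∃ R : Finset k, R.card = F.natDegree ∧ F = C F.leadingCoeff * rootPoly R := by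
  classical
  have hnd : F.roots.Nodup := nodup_roots (PerfectField.separable_iff_squarefree.mpr hF)
  refine ⟨F.roots.toFinset, ?_, ?_⟩
  · rw [Multiset.toFinset_card_of_nodup hnd]
    exact (IsAlgClosed.splits F).natDegree_eq_card_roots.symm
  · conv_lhs => rw [(IsAlgClosed.splits F).eq_prod_roots]
    rw [rootPoly, Finset.prod_eq_multiset_prod, Multiset.toFinset_val, hnd.dedup]

/-- The polynomial with roots at the images of the points of `R` under `t ↦ (t - p)⁻¹`. -/
lemma exists_aeval_eq_rootPoly [IsAlgClosed k] {F : k[X]} (hF : Squarefree F) {p : k}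
    (hp : F.eval p ≠ 0) {t s : K} (hs : s * (t - algebraMap k K p) = 1) :
    ∃ A : Finset k, A.card = F.natDegree ∧ (∀ a ∈ A, a ≠ 0 ∧ F.eval (p + a⁻¹) = 0) ∧
      s ^ F.natDegree * aeval t F = algebraMap k K (F.eval p) * aeval s (rootPoly A) := by
  classical
  obtain ⟨R, hR, hFR⟩ := exists_eq_C_mul_rootPoly hF
  have hroot : ∀ a ∈ R, F.eval a = 0 := fun a ha ↦ by
    rw [hFR, eval_mul, rootPoly, eval_prod, Finset.prod_eq_zero ha (by simp), mul_zero]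
  have hne : ∀ a ∈ R, a - p ≠ 0 := fun a ha h0 ↦ by
    rw [sub_eq_zero] at h0
    exact hp (h0 ▸ hroot a ha)
  have hinj : Set.InjOn (fun a ↦ (a - p)⁻¹) (R : Set k) := fun a _ b _ hab ↦ by
    simpa using hab
  refine ⟨R.image fun a ↦ (a - p)⁻¹, ?_, ?_, ?_⟩
  · rw [Finset.card_image_of_injOn hinj, hR]
  · intro b hb
    obtain ⟨a, ha, rfl⟩ := Finset.mem_image.mp hb
    exact ⟨inv_ne_zero (hne a ha), by rw [inv_inv, add_sub_cancel]; exact hroot a ha⟩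
  · have h1 : F.eval p = F.leadingCoeff * ∏ a ∈ R, (p - a) := by
      conv_lhs => rw [hFR]
      simp [rootPoly, eval_prod]
    have h2 : aeval t F = algebraMap k K F.leadingCoeff * ∏ a ∈ R, (t - algebraMap k K a) := by
      conv_lhs => rw [hFR]
      rw [map_mul, aeval_C, aeval_rootPoly]
    rw [h1, h2, aeval_rootPoly, Finset.prod_image hinj, ← hR, map_mul, map_prod, mul_left_comm,
      mul_assoc, ← Finset.prod_const, ← Finset.prod_mul_distrib, ← Finset.prod_mul_distrib]
    congr 1
    -- Factor by factor, with `t = p + 1/s`: `s (t - a) = (p - a)(s - (a - p)⁻¹)`.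
    refine Finset.prod_congr rfl fun a ha ↦ ?_
    have h3 : algebraMap k K (a - p) ≠ 0 := (_root_.map_ne_zero _).mpr (hne a ha)
    rw [map_inv₀, map_sub]
    rw [map_sub] at h3 ⊢
    field_simp
    linear_combination (algebraMap k K a - algebraMap k K p) * hs

/-- A biquadratic field `k(t)(√F(t), √(t F(t)))` is the function field of a generalized Howe curve:
put the branch point at infinity in general position. -/
lemma IsBiquadratic.exists_rootPoly [IsAlgClosed k] {g : ℕ} (hg : 2 ≤ g) {F : k[X]} {t y₁ y₂ : K}
    (h : IsBiquadratic F (X * F) t y₁ y₂) (hF : Squarefree F) (hd : F.natDegree = g + 1)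
    (h0 : F.eval 0 ≠ 0) :
    ∃ (g₁ g₂ : ℕ) (A B D : Finset k) (p : k) (z₁ z₂ : K), 1 ≤ g₁ ∧ g₁ ≤ g₂ ∧
      Disjoint A B ∧ Disjoint A D ∧ Disjoint B D ∧
      A.card + B.card = 2 * g₁ + 2 ∧ A.card + D.card = 2 * g₂ + 2 ∧
      IsBiquadratic (rootPoly A * rootPoly B) (rootPoly A * rootPoly D)
        (t - algebraMap k K p)⁻¹ z₁ z₂ := by
  classical
  -- The point `t = p` is to go to infinity, so it must avoid `0` and the roots of `F`.
  obtain ⟨p, hp⟩ : ∃ p, (X * F).eval p ≠ 0 := by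
    by_contra! hall
    refine hF.ne_zero ((mul_eq_zero.mp (funext (q := 0) fun r ↦ ?_)).resolve_left X_ne_zero)
    rw [hall, eval_zero]
  rw [eval_mul, eval_X, mul_ne_zero_iff] at hp
  obtain ⟨hp0, hp⟩ := hp
  have htp : t - algebraMap k K p ≠ 0 := by
    rw [sub_ne_zero]
    rintro rfl
    exact h.transcendental (isAlgebraic_algebraMap p)
  obtain ⟨s, hs⟩ : ∃ s, s = (t - algebraMap k K p)⁻¹ := ⟨_, rfl⟩
  have hst : s * (t - algebraMap k K p) = 1 := hs ▸ inv_mul_cancel₀ htp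
  have hs0 : s ≠ 0 := hs ▸ inv_ne_zero htp
  obtain ⟨A, hA, hAF, hAe⟩ := exists_aeval_eq_rootPoly hF hp hst
  have hAB : Disjoint A {0} := by
    rw [Finset.disjoint_singleton_right]
    exact fun hm ↦ (hAF 0 hm).1 rfl
  have hAp : Disjoint A {-p⁻¹} := by
    rw [Finset.disjoint_singleton_right]
    refine fun hm ↦ h0 ?_
    have := (hAF _ hm).2
    rwa [inv_neg, inv_inv, add_neg_cancel] at this
  have h0p : (0 : k) ≠ -p⁻¹ := (neg_ne_zero.mpr (inv_ne_zero hp0)).symm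
  have hsk : s ∈ k⟮s⟯ := mem_adjoin_simple_self k s
  have hts : t ∈ k⟮s⟯ := by
    have := add_mem (inv_mem hsk) (IntermediateField.algebraMap_mem k⟮s⟯ p)
    rwa [hs, inv_inv, sub_add_cancel, ← hs] at this
  have hst' : s ∈ k⟮t⟯ := hs ▸ inv_mem (sub_mem (mem_adjoin_simple_self k t) (IntermediateField.algebraMap_mem _ p))
  have htr : Transcendental k s := by
    intro ha
    refine h.transcendental ?_
    have := ha.inv.add (isAlgebraic_algebraMap (R := k) (A := K) p)
    rwa [hs, inv_inv, sub_add_cancel] at this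
  -- Square roots of `F(p)` and `p` absorb the constants of the two equations into `z₁` and `z₂`.
  obtain ⟨c, hc⟩ := IsAlgClosed.exists_pow_nat_eq (F.eval p) two_pos
  obtain ⟨d, hdd⟩ := IsAlgClosed.exists_pow_nat_eq p two_pos
  have hc0 : c ≠ 0 := by rintro rfl; exact hp (by rw [← hc]; simp)
  have hd0 : d ≠ 0 := by rintro rfl; exact hp0 (by rw [← hdd]; simp)
  have hcK : algebraMap k K c ≠ 0 := (_root_.map_ne_zero _).mpr hc0
  have hdK : algebraMap k K d ≠ 0 := (_root_.map_ne_zero _).mpr hd0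
  rw [hd, ← hc, map_pow] at hAe
  have htd : s * t = algebraMap k K d ^ 2 * (s - algebraMap k K (-p⁻¹)) := by
    have h3 : algebraMap k K p ≠ 0 := (_root_.map_ne_zero _).mpr hp0
    rw [← map_pow, hdd, map_neg, map_inv₀]
    field_simp
    linear_combination hst
  have hy₁ := h.sq_fst
  have hy₂ := h.sq_snd
  rw [map_mul, aeval_X] at hy₂
  have hmem : ∀ (n : ℕ) (a : k), algebraMap k K a * s ^ n ∈ k⟮s⟯ := fun n a ↦
    mul_mem (IntermediateField.algebraMap_mem _ a) (pow_mem hsk n)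
  have hne : ∀ (n : ℕ) (a : k), a ≠ 0 → algebraMap k K a * s ^ n ≠ 0 := fun n a ha ↦
    mul_ne_zero ((_root_.map_ne_zero _).mpr ha) (pow_ne_zero n hs0)
  rcases Nat.even_or_odd' g with ⟨m, rfl | rfl⟩
  -- For `g = 2m` the set `A` has `2m + 1` points. The first cover is also branched at `t = ∞`,
  -- which is `s = 0`, and the second at `t = 0`, which is `s = -1/p`.
  · refine ⟨m, m, A, {0}, {-p⁻¹}, p, algebraMap k K c⁻¹ * s ^ (m + 1) * y₁,
      algebraMap k K (c * d)⁻¹ * s ^ (m + 1) * y₂, by omega, le_rfl, hAB, hAp, by simpa using hp0,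
      by rw [hA, hd, Finset.card_singleton], by rw [hA, hd, Finset.card_singleton],
      hs ▸ h.of_mem htr hst' hts (hmem _ _) (hmem _ _) (hne _ _ (inv_ne_zero hc0))
        (hne _ _ (inv_ne_zero (mul_ne_zero hc0 hd0))) ?_ ?_⟩
    · rw [map_mul, aeval_rootPoly {0}, Finset.prod_singleton, map_zero, sub_zero, mul_pow, hy₁,
        map_inv₀]
      field_simp
      linear_combination s * hAe
    · rw [map_mul, aeval_rootPoly {-p⁻¹}, Finset.prod_singleton, mul_pow, hy₂,
        map_inv₀, map_mul]
      generalize algebraMap k K (-p⁻¹) = q at htd ⊢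
      field_simp
      linear_combination s * t * hAe + algebraMap k K c ^ 2 * aeval s (rootPoly A) * htd
  -- For `g = 2m + 1` the `2m + 2` points of `A` are all branch points of the first cover; the
  -- second is branched also at both `∞` and `0`.
  · refine ⟨m, m + 1, A, ∅, {0, -p⁻¹}, p, algebraMap k K c⁻¹ * s ^ (m + 1) * y₁,
      algebraMap k K (c * d)⁻¹ * s ^ (m + 2) * y₂, by omega, by omega, by simp, ?_, by simp,
      by rw [hA, hd, Finset.card_empty], by rw [hA, hd, Finset.card_pair h0p]; ring,
      hs ▸ h.of_mem htr hst' hts (hmem _ _) (hmem _ _) (hne _ _ (inv_ne_zero hc0))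
        (hne _ _ (inv_ne_zero (mul_ne_zero hc0 hd0))) ?_ ?_⟩
    · rw [Finset.insert_eq, Finset.disjoint_union_right]
      exact ⟨hAB, hAp⟩
    · rw [map_mul, aeval_rootPoly ∅, Finset.prod_empty, mul_pow, hy₁, map_inv₀]
      field_simp
      linear_combination hAe
    · rw [map_mul, aeval_rootPoly {0, -p⁻¹}, Finset.prod_pair h0p, map_zero, sub_zero, mul_pow, hy₂,
        map_inv₀, map_mul]
      generalize algebraMap k K (-p⁻¹) = q at htd ⊢
      field_simp
      linear_combination s ^ 2 * t * hAe + s * algebraMap k K c ^ 2 * aeval s (rootPoly A) * htd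

end Biquadratic

/-! ### Integrality and normalization of the fiber product -/

section FiberProduct
open scoped TensorProduct
variable {k : Type u} [Field k] {K : Type u} [Field K] [Algebra k K]

instance : IsReduced (P1 k) := by
  have (i : (chartCover k).I₀) : IsReduced ((chartCover k).X i) :=
    inferInstanceAs (IsReduced (Spec (.of k[X])))
  exact IsReduced.of_openCover _ (chartCover k)

instance : IsSchemeTheoreticallyDominant (lineChart k) := .of_isDominant _

instance : QuasiCompact (lineChart k) :=
  have : IsAffineHom (lineChart k) := isAffineHom_to_separated _
  inferInstance

/-- A surjective affine morphism from an integral scheme to the affine line is flat. -/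
lemma flat_of_isAffineHom {Z : Scheme.{u}} [IsIntegral Z] (p : Z ⟶ Spec (.of k[X])) [IsAffineHom p]
    [IsDominant p] : Flat p := by
  have : IsAffine Z := isAffine_of_isAffineHom p
  obtain ⟨φ, hφ⟩ := Spec.map_surjective (Z.isoSpec.inv ≫ p)
  have hdom : IsDominant (Spec.map φ) := by rw [hφ]; infer_instance
  have inj : Function.Injective φ := by
    have h := (PrimeSpectrum.denseRange_comap_iff_ker_le_nilRadical φ.hom).mp hdom.1
    rw [nilradical_eq_zero, Ideal.zero_eq_bot, le_bot_iff] at h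
    exact (RingHom.injective_iff_ker_eq_bot φ.hom).mpr h
  let : Algebra k[X] Γ(Z, ⊤) := φ.hom.toAlgebra
  have hflat : Flat (Spec.map φ) := by
    rw [Flat.SpecMap_iff]
    change Module.Flat k[X] Γ(Z, ⊤)
    have : IsDomain Γ(Z, ⊤) := inferInstance
    -- Over the Dedekind domain `k[X]`, torsion-free modules are flat.
    have : Module.IsTorsionFree k[X] Γ(Z, ⊤) :=
      Module.isTorsionFree_iff_algebraMap_injective.mpr inj
    have : IsDedekindDomain k[X] := inferInstance
    infer_instance
  have : p = Z.isoSpec.hom ≫ Spec.map φ := by simp [hφ]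
  rw [this]
  infer_instance

lemma flat_cover {f : k[X]} (hf : Squarefree f) (hd : 0 < f.natDegree) : Flat (cover f) := by
  have := curve_isIntegral hf hd
  have : IsZariskiLocalAtTarget @Flat :=
    HasRingHomProperty.instIsZariskiLocalAtTarget (Q := RingHom.Flat) _
  refine IsZariskiLocalAtTarget.of_openCover (P := @Flat) (chartCover k) fun (i : Fin 2) ↦ ?_
  change Flat (pullback.snd (cover f) (chart k i))
  have : Nonempty ↥(pullback (cover f) (chart k i)) :=
    (inferInstance : Surjective (pullback.snd (cover f) (chart k i))).surj.nonempty
  have : IsOpenImmersion (pullback.fst (cover f) (chart k i)) :=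
    MorphismProperty.pullback_fst (P := @IsOpenImmersion) _ _ inferInstance
  have : IsIntegral (pullback (cover f) (chart k i)) :=
    isIntegral_of_isOpenImmersion (pullback.fst (cover f) (chart k i))
  exact flat_of_isAffineHom _

/-- The coordinate ring of the affine part of the fiber product. -/
abbrev fiberRing (f₁ f₂ : k[X]) : Type u := affineRing f₁ ⊗[k[X]] affineRing f₂

/-- The affine part of the fiber product. -/
def fiberChart (f₁ f₂ : k[X]) : Spec (.of (fiberRing f₁ f₂)) ⟶ fiberProduct f₁ f₂ :=
  pullback.lift
    (Spec.map (CommRingCat.ofHom Algebra.TensorProduct.includeLeftRingHom) ≫ affineChart f₁)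
    (Spec.map (CommRingCat.ofHom
      (Algebra.TensorProduct.includeRight (R := k[X]) (A := affineRing f₁)).toRingHom) ≫
        affineChart f₂) (by
    rw [Category.assoc, Category.assoc, affineChart_cover, affineChart_cover, affineCover,
      affineCover, ← Category.assoc, ← Category.assoc, ← Spec.map_comp, ← Spec.map_comp,
      ← CommRingCat.ofHom_comp, ← CommRingCat.ofHom_comp]
    congr 3
    exact RingHom.ext fun p ↦
      (Algebra.TensorProduct.includeRight (R := k[X]) (A := affineRing f₁)
        (B := affineRing f₂)).commutes p |>.symm)

/-- The projection of the affine part of the fiber product to the affine line. -/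
def fiberProj (f₁ f₂ : k[X]) : Spec (.of (fiberRing f₁ f₂)) ⟶ Spec (.of k[X]) :=
  Spec.map (CommRingCat.ofHom Algebra.TensorProduct.includeLeftRingHom) ≫ affineProj f₁

lemma isPullback_fiberChart_fiberFst (f₁ f₂ : k[X]) :
    IsPullback (fiberChart f₁ f₂)
      (Spec.map (CommRingCat.ofHom Algebra.TensorProduct.includeLeftRingHom))
      (fiberFst f₁ f₂) (affineChart f₁) := by
  have h1 := (isPullback_SpecMap_of_isPushout _ _ _ _
    (CommRingCat.isPushout_tensorProduct k[X] (affineRing f₁) (affineRing f₂))).flip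
  have h2 : IsPullback
      (Spec.map (CommRingCat.ofHom
        (Algebra.TensorProduct.includeRight (R := k[X]) (A := affineRing f₁)
          (B := affineRing f₂)).toRingHom))
      (Spec.map (CommRingCat.ofHom Algebra.TensorProduct.includeLeftRingHom))
      (affineProj f₂) (affineProj f₁) := h1
  have h3 := h2.paste_horiz (isPullback_affineChart f₂)
  have h4 : IsPullback (fiberSnd f₁ f₂) (fiberFst f₁ f₂) (cover f₂) (cover f₁) :=
    (IsPullback.of_hasPullback (cover f₁) (cover f₂)).flip
  have h5 : fiberChart f₁ f₂ ≫ fiberSnd f₁ f₂ = Spec.map (CommRingCat.ofHom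
        (Algebra.TensorProduct.includeRight (R := k[X]) (A := affineRing f₁)
          (B := affineRing f₂)).toRingHom) ≫ affineChart f₂ := pullback.lift_snd _ _ _
  have h6 : fiberChart f₁ f₂ ≫ fiberFst f₁ f₂ =
      Spec.map (CommRingCat.ofHom Algebra.TensorProduct.includeLeftRingHom) ≫ affineChart f₁ :=
    pullback.lift_fst _ _ _
  rw [← h5, ← (isPullback_affineChart f₁).w] at h3
  exact IsPullback.of_right h3 h6 h4

lemma isPullback_fiberChart (f₁ f₂ : k[X]) :
    IsPullback (fiberChart f₁ f₂) (fiberProj f₁ f₂) (fiberProductCover f₁ f₂) (lineChart k) :=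
  (isPullback_fiberChart_fiberFst f₁ f₂).paste_vert (isPullback_affineChart f₁)

instance (f₁ f₂ : k[X]) : IsOpenImmersion (fiberChart f₁ f₂) :=
  MorphismProperty.of_isPullback (P := @IsOpenImmersion)
    (isPullback_fiberChart_fiberFst f₁ f₂).flip inferInstance

instance (f₁ f₂ : k[X]) : QuasiCompact (fiberChart f₁ f₂) :=
  MorphismProperty.of_isPullback (P := @QuasiCompact) (isPullback_fiberChart f₁ f₂).flip
    inferInstance

lemma fiberChart_fiberProductCover (f₁ f₂ : k[X]) :
    fiberChart f₁ f₂ ≫ fiberProductCover f₁ f₂ = fiberProj f₁ f₂ ≫ lineChart k :=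
  (isPullback_fiberChart f₁ f₂).w

/-- The line `𝔸¹` is scheme-theoretically dense in `ℙ¹`, and flat base change preserves this: the
fiber product acquires no components or nilpotents at infinity, so its integrality can be read off
from `fiberRing`. -/
lemma isSchemeTheoreticallyDominant_fiberChart {f₁ f₂ : k[X]} (hf₁ : Squarefree f₁)
    (hd₁ : 0 < f₁.natDegree) (hf₂ : Squarefree f₂) (hd₂ : 0 < f₂.natDegree) :
    IsSchemeTheoreticallyDominant (fiberChart f₁ f₂) := by
  have := flat_cover hf₁ hd₁
  have := flat_cover hf₂ hd₂
  have : Flat (fiberProductCover f₁ f₂) :=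
    inferInstanceAs (Flat (pullback.fst (cover f₁) (cover f₂) ≫ cover f₁))
  exact IsSchemeTheoreticallyDominant.of_isPullback (isPullback_fiberChart f₁ f₂).flip

lemma isIntegral_of_isSchemeTheoreticallyDominant {U Z : Scheme.{u}} [IsIntegral U] (j : U ⟶ Z)
    [IsSchemeTheoreticallyDominant j] [QuasiCompact j] : IsIntegral Z := by
  have : IsReduced Z := IsSchemeTheoreticallyDominant.isReduced j
  have : IrreducibleSpace Z := by
    have h := (IrreducibleSpace.isIrreducible_univ U).image j j.continuous.continuousOn
    rw [Set.image_univ] at h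
    refine (irreducibleSpace_def _).mpr ?_
    have := h.closure
    rwa [(IsDominant.denseRange (f := j)).closure_range] at this
  exact isIntegral_of_irreducibleSpace_of_isReduced Z

lemma exists_fiberRing_eq {f₁ f₂ : k[X]} (z : fiberRing f₁ f₂) :
    ∃ a b : affineRing f₁, z = a ⊗ₜ 1 + b ⊗ₜ AdjoinRoot.root _ := by
  induction z using TensorProduct.induction_on with
  | zero => exact ⟨0, 0, by simp⟩
  | tmul a b =>
    obtain ⟨p, q, rfl⟩ := exists_affineRing_eq b
    refine ⟨p • a, q • a, ?_⟩
    rw [TensorProduct.tmul_add, TensorProduct.smul_tmul, TensorProduct.smul_tmul,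
      Algebra.smul_def, Algebra.smul_def, mul_one]
    rfl
  | add z w hz hw =>
    obtain ⟨a, b, rfl⟩ := hz
    obtain ⟨a', b', rfl⟩ := hw
    exact ⟨a + a', b + b', by rw [TensorProduct.add_tmul, TensorProduct.add_tmul]; abel⟩

lemma exists_evalFiber (f₁ f₂ : k[X]) (s z₁ z₂ : K) (h₁ : z₁ ^ 2 = aeval s f₁)
    (h₂ : z₂ ^ 2 = aeval s f₂) : ∃ φ : fiberRing f₁ f₂ →+* K,
      ∀ a b, φ (a ⊗ₜ b) = evalPoint f₁ s z₁ h₁ a * evalPoint f₂ s z₂ h₂ b := by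
  let : Algebra k[X] K := (aeval (R := k) s).toRingHom.toAlgebra
  let φ₁ : affineRing f₁ →ₐ[k[X]] K :=
    { (evalPoint f₁ s z₁ h₁).toRingHom with commutes' := evalPoint_of f₁ s z₁ h₁ }
  let φ₂ : affineRing f₂ →ₐ[k[X]] K :=
    { (evalPoint f₂ s z₂ h₂).toRingHom with commutes' := evalPoint_of f₂ s z₂ h₂ }
  exact ⟨(Algebra.TensorProduct.productMap φ₁ φ₂).toRingHom,
    Algebra.TensorProduct.productMap_apply_tmul φ₁ φ₂⟩

lemma exists_eval_fiberRing_eq (f₁ f₂ : k[X]) (s z₁ z₂ : K) (h₁ : z₁ ^ 2 = aeval s f₁)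
    (h₂ : z₂ ^ 2 = aeval s f₂) (z : fiberRing f₁ f₂) : ∃ p q r t : k[X],
      (p = 0 → q = 0 → r = 0 → t = 0 → z = 0) ∧
      ∀ φ : fiberRing f₁ f₂ →+* K,
        (∀ a b, φ (a ⊗ₜ b) = evalPoint f₁ s z₁ h₁ a * evalPoint f₂ s z₂ h₂ b) →
        φ z = aeval s p + aeval s q * z₁ + aeval s r * z₂ + aeval s t * (z₁ * z₂) := by
  obtain ⟨a, b, rfl⟩ := exists_fiberRing_eq z
  obtain ⟨p, q, rfl⟩ := exists_affineRing_eq a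
  obtain ⟨r, t, rfl⟩ := exists_affineRing_eq b
  refine ⟨p, q, r, t, ?_, fun φ hφ ↦ ?_⟩
  · rintro rfl rfl rfl rfl
    simp
  · rw [map_add, hφ, hφ]
    simp only [map_add, map_mul, evalPoint_of, evalPoint_root, map_one]
    ring

/-- Elements of the tensor product are polynomial combinations of `1, y₁, y₂, y₁y₂`, and the images
of these four are independent over `k(s)`. -/
lemma IsBiquadratic.injective_of_eval {f₁ f₂ : k[X]} {s z₁ z₂ : K}
    (h : IsBiquadratic f₁ f₂ s z₁ z₂) {φ : fiberRing f₁ f₂ →+* K}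
    (hφ : ∀ a b, φ (a ⊗ₜ b) = evalPoint f₁ s z₁ h.sq_fst a * evalPoint f₂ s z₂ h.sq_snd b) :
    Function.Injective φ := by
  rw [injective_iff_map_eq_zero]
  intro z hz
  obtain ⟨p, q, r, t, hz0, hpq⟩ := exists_eval_fiberRing_eq f₁ f₂ s z₁ z₂ h.sq_fst h.sq_snd z
  rw [hpq φ hφ] at hz
  have hm : ∀ p : k[X], aeval s p ∈ IntermediateField.adjoin k {s} := fun p ↦
    aeval_mem_intermediateField _ (IntermediateField.mem_adjoin_simple_self k s) p
  have h0 : ∀ p : k[X], aeval s p = 0 → p = 0 := transcendental_iff.mp h.transcendental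
  obtain ⟨hp, hq, hr, ht⟩ := h.indep _ (hm p) _ (hm q) _ (hm r) _ (hm t) hz
  exact hz0 (h0 _ hp) (h0 _ hq) (h0 _ hr) (h0 _ ht)

/-- The function field of the fiber product of `y₁² = f₁(s)` and `y₂² = f₂(s)`. -/
lemma IsBiquadratic.exists_isFractionRing {f₁ f₂ : k[X]} {s z₁ z₂ : K}
    (h : IsBiquadratic f₁ f₂ s z₁ z₂) : ∃ φ : fiberRing f₁ f₂ →+* K,
      IsDomain (fiberRing f₁ f₂) ∧
      φ.comp Algebra.TensorProduct.includeLeftRingHom = (evalPoint f₁ s z₁ h.sq_fst).toRingHom ∧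
      letI := φ.toAlgebra
      IsFractionRing (fiberRing f₁ f₂) K := by
  obtain ⟨φ, hφ⟩ := exists_evalFiber f₁ f₂ s z₁ z₂ h.sq_fst h.sq_snd
  have inj := h.injective_of_eval hφ
  have hdom : IsDomain (fiberRing f₁ f₂) := inj.isDomain φ
  refine ⟨φ, hdom, ?_, ?_⟩
  · refine RingHom.ext fun a ↦ ?_
    change φ (a ⊗ₜ 1) = evalPoint f₁ s z₁ h.sq_fst a
    rw [hφ, map_one, mul_one]
  let := φ.toAlgebra
  have hfs : FaithfulSMul (fiberRing f₁ f₂) K := (faithfulSMul_iff_algebraMap_injective _ _).mpr inj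
  refine IsFractionRing.of_field _ K fun z ↦ ?_
  have hz : z ∈ IntermediateField.adjoin k {s, z₁, z₂} := by
    rw [h.adjoin_eq_top]; trivial
  obtain ⟨r, hr, t, ht, rfl⟩ := IntermediateField.mem_adjoin_iff_div.mp hz
  have key : ∀ r ∈ Algebra.adjoin k {s, z₁, z₂}, ∃ a, φ a = r := by
    intro r hr
    have hk : ∀ c : k, φ ((AdjoinRoot.of _ (C c)) ⊗ₜ 1) = algebraMap k K c := fun c ↦ by
      rw [hφ, map_one, mul_one, evalPoint_of, aeval_C]
    induction hr using Algebra.adjoin_induction with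
    | mem x hx =>
      rcases hx with rfl | rfl | rfl
      · exact ⟨AdjoinRoot.of _ X ⊗ₜ 1, by rw [hφ, map_one, mul_one, evalPoint_of, aeval_X]⟩
      · exact ⟨AdjoinRoot.root _ ⊗ₜ 1, by rw [hφ, map_one, mul_one, evalPoint_root]⟩
      · exact ⟨1 ⊗ₜ AdjoinRoot.root _, by rw [hφ, map_one, one_mul, evalPoint_root]⟩
    | algebraMap c => exact ⟨_, hk c⟩
    | add x y _ _ hx hy =>
      obtain ⟨a, rfl⟩ := hx
      obtain ⟨b, rfl⟩ := hy
      exact ⟨a + b, map_add ..⟩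
    | mul x y _ _ hx hy =>
      obtain ⟨a, rfl⟩ := hx
      obtain ⟨b, rfl⟩ := hy
      exact ⟨a * b, map_mul ..⟩
  obtain ⟨a, rfl⟩ := key r hr
  obtain ⟨b, rfl⟩ := key t ht
  exact ⟨a, b, rfl⟩

/-- The fiber product of `y₁² = f₁(s)` and `y₂² = f₂(s)` is integral. -/
lemma IsBiquadratic.isIntegral_fiberProduct {f₁ f₂ : k[X]} {s z₁ z₂ : K}
    (h : IsBiquadratic f₁ f₂ s z₁ z₂) (hf₁ : Squarefree f₁)
    (hd₁ : 0 < f₁.natDegree) (hf₂ : Squarefree f₂) (hd₂ : 0 < f₂.natDegree) :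
    IsIntegral (fiberProduct f₁ f₂) := by
  obtain ⟨φ, hdom, -⟩ := h.exists_isFractionRing
  have := isSchemeTheoreticallyDominant_fiberChart hf₁ hd₁ hf₂ hd₂
  exact isIntegral_of_isSchemeTheoreticallyDominant (fiberChart f₁ f₂)

instance (f₁ f₂ : k[X]) : IsIntegralHom (fiberProductCover f₁ f₂) :=
  inferInstanceAs (IsIntegralHom (pullback.fst (cover f₁) (cover f₂) ≫ cover f₁))

/-- The normalization of the fiber product of `y₁² = f₁(s)` and `y₂² = f₂(s)`. -/
lemma IsBiquadratic.nonempty_model_iso {f₁ f₂ : k[X]} {s z₁ z₂ : K}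
    (h : IsBiquadratic f₁ f₂ s z₁ z₂) [IsIntegral (fiberProduct f₁ f₂)] :
    Nonempty (model k s ≅ Over.mk
      (normalizationMap (fiberProduct f₁ f₂) ≫ fiberProductCover f₁ f₂ ≫ P1.toSpec k)) := by
  obtain ⟨φ, hdom, hφ, hfrac⟩ := h.exists_isFractionRing
  let := φ.toAlgebra
  obtain ⟨e, he⟩ := exists_iso_of_chart K (fiberChart f₁ f₂)
  -- The map `s` to `ℙ¹` factors through the generic point of the fiber product followed by the
  -- integral cover, so transitivity identifies the two normalizations.
  have h1 : linePoint k s = (e.hom ≫ genericInclusion (fiberProduct f₁ f₂)) ≫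
      fiberProductCover f₁ f₂ := by
    rw [he, Category.assoc, fiberChart_fiberProductCover, fiberProj, Category.assoc,
      ← Category.assoc, ← Spec.map_comp, ← CommRingCat.ofHom_comp]
    have h2 : (algebraMap (fiberRing f₁ f₂) K).comp Algebra.TensorProduct.includeLeftRingHom =
      (evalPoint f₁ s z₁ h.sq_fst).toRingHom := hφ
    rw [h2]
    exact (SpecMap_evalPoint f₁ s z₁ h.sq_fst).symm
  let a : (linePoint k s).normalization ≅
      (e.hom ≫ genericInclusion (fiberProduct f₁ f₂)).normalization :=
    normalizationCompIso _ _ _ h1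
  let b : (e.hom ≫ genericInclusion (fiberProduct f₁ f₂)).normalization ≅
      normalization (fiberProduct f₁ f₂) := normalizationIsoOfIso _ _ e rfl
  have ha : a.hom ≫ (e.hom ≫ genericInclusion (fiberProduct f₁ f₂)).fromNormalization ≫
      fiberProductCover f₁ f₂ = (linePoint k s).fromNormalization :=
    normalizationCompIso_hom_comp ..
  have hb : b.hom ≫ normalizationMap (fiberProduct f₁ f₂) =
      (e.hom ≫ genericInclusion (fiberProduct f₁ f₂)).fromNormalization :=
    normalizationIsoOfIso_hom_comp ..
  refine ⟨Over.isoMk (a ≪≫ b) ?_⟩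
  change (a.hom ≫ b.hom) ≫ normalizationMap (fiberProduct f₁ f₂) ≫
    fiberProductCover f₁ f₂ ≫ P1.toSpec k = (linePoint k s).fromNormalization ≫ P1.toSpec k
  rw [Category.assoc, ← Category.assoc b.hom, hb, ← ha, Category.assoc, Category.assoc]

/-- Curves `y₁² = f₁(s)` and `y₂² = f₂(s)` that are isomorphic over the projective line do not
define a biquadratic field. -/
lemma IsBiquadratic.not_exists_iso {f₁ f₂ : k[X]} {s z₁ z₂ : K}
    (h : IsBiquadratic f₁ f₂ s z₁ z₂) :
    ¬ ∃ φ : curve f₁ ≅ curve f₂, φ.hom ≫ cover f₂ = cover f₁ := by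
  rintro ⟨φ, hφ⟩
  -- Restricted over `𝔸¹`, the isomorphism gives a `k[x]`-algebra map of coordinate rings, under
  -- which `y₂` goes to some `p + q y₁` with square `f₂`.
  obtain ⟨l, -, hl⟩ := (isPullback_affineChart f₂).exists_lift (affineChart f₁ ≫ φ.hom)
    (affineProj f₁) (by rw [Category.assoc, hφ]; exact (isPullback_affineChart f₁).w)
  obtain ⟨ψ, rfl⟩ := Spec.map_surjective l
  rw [affineProj, affineProj, ← Spec.map_comp] at hl
  have hψ : ∀ p, ψ.hom (AdjoinRoot.of _ p) = AdjoinRoot.of _ p := fun p ↦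
    congr($(Spec.map_injective hl).hom p)
  obtain ⟨p, q, hpq⟩ := exists_affineRing_eq (ψ.hom (AdjoinRoot.root _))
  have h1 : (ψ.hom (AdjoinRoot.root _)) ^ 2 = AdjoinRoot.of _ f₂ := by
    rw [← map_pow, affineRing_root_sq, hψ]
  rw [hpq] at h1
  have h2 := congrArg (evalPoint f₁ s z₁ h.sq_fst) h1
  simp only [map_add, map_mul, map_pow, evalPoint_of, evalPoint_root, ← h.sq_snd] at h2
  have hm : ∀ p : k[X], aeval s p ∈ IntermediateField.adjoin k {s} := fun p ↦
    aeval_mem_intermediateField _ (IntermediateField.mem_adjoin_simple_self k s) p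
  -- Thus `z₂ = ±(p + q z₁)` in `K`, against independence.
  rcases sq_eq_sq_iff_eq_or_eq_neg.mp h2 with h3 | h3
  · have := (h.indep _ (hm p) _ (hm q) (-1) (neg_mem (one_mem _)) 0 (zero_mem _)
      (by linear_combination h3)).2.2.1
    simp at this
  · have := (h.indep _ (hm p) _ (hm q) 1 (one_mem _) 0 (zero_mem _)
      (by linear_combination h3)).2.2.1
    simp at this

end FiberProduct

/-! ### Birationality of `y² = F(x²)` with the fiber product -/

section Birational
open scoped TensorProduct
variable {k : Type u} [Field k]

lemma exists_fiberRing_hom {S : Type u} [CommRing S] (f₁ f₂ : k[X]) (α : k[X] →+* S) (a b : S)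
    (ha : a ^ 2 = α f₁) (hb : b ^ 2 = α f₂) : ∃ θ : fiberRing f₁ f₂ →+* S,
      (∀ p, θ (AdjoinRoot.of _ p ⊗ₜ 1) = α p) ∧ θ (AdjoinRoot.root _ ⊗ₜ 1) = a ∧
      θ (1 ⊗ₜ AdjoinRoot.root _) = b := by
  let : Algebra k[X] S := α.toAlgebra
  let φ₁ : affineRing f₁ →ₐ[k[X]] S := AdjoinRoot.liftAlgHom _ (Algebra.ofId k[X] S) a (by
    rw [eval₂_sub, eval₂_X_pow, eval₂_C, ha]; exact sub_self _)
  let φ₂ : affineRing f₂ →ₐ[k[X]] S := AdjoinRoot.liftAlgHom _ (Algebra.ofId k[X] S) b (by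
    rw [eval₂_sub, eval₂_X_pow, eval₂_C, hb]; exact sub_self _)
  refine ⟨(Algebra.TensorProduct.productMap φ₁ φ₂).toRingHom, fun p ↦ ?_, ?_, ?_⟩
  · refine (Algebra.TensorProduct.productMap_apply_tmul φ₁ φ₂ _ _).trans ?_
    rw [map_one, mul_one]
    exact φ₁.commutes p
  · refine (Algebra.TensorProduct.productMap_apply_tmul φ₁ φ₂ _ _).trans ?_
    rw [map_one, mul_one]
    exact AdjoinRoot.liftAlgHom_root ..
  · refine (Algebra.TensorProduct.productMap_apply_tmul φ₁ φ₂ _ _).trans ?_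
    rw [map_one, one_mul]
    exact AdjoinRoot.liftAlgHom_root ..

/-- The rings `A = k[x, y]` with `y² = F(x²)` and `B = k[x², y, xy]` agree after inverting `y`. -/
lemma isLocalizationAway_of_expand {A B R : Type u} [CommRing A] [CommRing B] [CommRing R]
    [Algebra A R] {F : k[X]} (hF : F ≠ 0) {α : k[X] →+* A} {ρ : A}
    (hρ : ρ ^ 2 = α (expand k 2 F)) (hA : ∀ a, ∃ p q, a = α p + α q * ρ)
    (hi : ∀ p q, α p + α q * ρ = 0 → p = 0 ∧ q = 0)
    [IsLocalization.Away ρ R] (inj : Function.Injective (algebraMap A R))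
    {β : k[X] →+* B} {ρ₁ ρ₂ : B}
    (hB : ∀ b, ∃ p q r t, b = β p + β q * ρ₁ + (β r + β t * ρ₁) * ρ₂) (θ : B →+* R)
    (h1 : ∀ p, θ (β p) = algebraMap A R (α (expand k 2 p))) (h2 : θ ρ₁ = algebraMap A R ρ)
    (h3 : θ ρ₂ = algebraMap A R (α X * ρ)) :
    Function.Injective θ ∧
      letI := θ.toAlgebra
      IsLocalization.Away ρ₁ R := by
  have hθ : Function.Injective θ := by
    rw [injective_iff_map_eq_zero]
    intro z hz
    obtain ⟨p, q, r, t, rfl⟩ := hB z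
    have h4 : θ (β p + β q * ρ₁ + (β r + β t * ρ₁) * ρ₂) =
        algebraMap A R (α (expand k 2 p + X * expand k 2 (t * F)) +
          α (expand k 2 q + X * expand k 2 r) * ρ) := by
      simp only [map_add θ, map_mul θ, h1, h2, h3, map_mul (expand k 2), map_add α, map_mul α,
        ← hρ, map_add (algebraMap A R), map_mul (algebraMap A R), map_pow (algebraMap A R)]
      ring
    rw [h4] at hz
    obtain ⟨h5, h6⟩ := hi _ _ ((injective_iff_map_eq_zero _).mp inj _ hz)
    obtain ⟨rfl, h7⟩ := eq_zero_of_expand_add_X_mul_expand h5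
    obtain ⟨rfl, rfl⟩ := eq_zero_of_expand_add_X_mul_expand h6
    obtain rfl := (mul_eq_zero.mp h7).resolve_right hF
    simp
  refine ⟨hθ, ?_⟩
  let := θ.toAlgebra
  have hmap : ∀ b, algebraMap B R b = θ b := fun _ ↦ rfl
  have hunit : IsUnit (algebraMap A R ρ) := IsLocalization.Away.algebraMap_isUnit ρ
  -- Since `x y` lies in `B`, a polynomial in `x` times a high enough power of `y` comes from `B`.
  have hX : ∀ p : k[X], ∃ n b, algebraMap A R (α p) * algebraMap A R ρ ^ n = θ b := by
    intro p
    induction p using Polynomial.induction_on' with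
    | add p q hp hq =>
      obtain ⟨n, b, hb⟩ := hp
      obtain ⟨m, c, hc⟩ := hq
      refine ⟨n + m, b * ρ₁ ^ m + c * ρ₁ ^ n, ?_⟩
      simp only [map_add, map_mul, map_pow, h2, ← hb, ← hc]
      ring
    | monomial n c =>
      refine ⟨n, β (C c) * ρ₂ ^ n, ?_⟩
      rw [← C_mul_X_pow_eq_monomial]
      simp only [map_mul, map_pow, h1, h3, expand_C]
      ring
  refine { map_units := ?_, surj := fun z ↦ ?_, exists_of_eq := fun {a b} hab ↦ ⟨1, by rw [hθ hab]⟩ }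
  · rintro ⟨_, n, rfl⟩
    rw [hmap, map_pow, h2]
    exact hunit.pow n
  · obtain ⟨m, a, ha⟩ := IsLocalization.Away.surj ρ z
    obtain ⟨p, q, rfl⟩ := hA a
    obtain ⟨n, b, hb⟩ := hX p
    obtain ⟨l, c, hc⟩ := hX q
    refine ⟨⟨b * ρ₁ ^ l + c * ρ₁ * ρ₁ ^ n, ⟨ρ₁ ^ (m + n + l), _, rfl⟩⟩, ?_⟩
    simp only [hmap, map_add, map_mul, map_pow, h2, ← hb, ← hc] at ha ⊢
    linear_combination algebraMap A R ρ ^ (n + l) * ha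

lemma exists_fiberRing_eq' {f₁ f₂ : k[X]} (z : fiberRing f₁ f₂) :
    ∃ p q r t : k[X], z = AdjoinRoot.of _ p ⊗ₜ 1 + AdjoinRoot.of _ q ⊗ₜ 1 * AdjoinRoot.root _ ⊗ₜ 1 +
      (AdjoinRoot.of _ r ⊗ₜ 1 + AdjoinRoot.of _ t ⊗ₜ 1 * AdjoinRoot.root _ ⊗ₜ 1) *
        (1 ⊗ₜ AdjoinRoot.root _) := by
  obtain ⟨a, b, rfl⟩ := exists_fiberRing_eq z
  obtain ⟨p, q, rfl⟩ := exists_affineRing_eq a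
  obtain ⟨r, t, rfl⟩ := exists_affineRing_eq b
  refine ⟨p, q, r, t, ?_⟩
  simp only [TensorProduct.add_tmul, Algebra.TensorProduct.tmul_mul_tmul, one_mul, mul_one,
    add_mul]

lemma lineChart_toSpec :
    lineChart k ≫ P1.toSpec k = Spec.map (CommRingCat.ofHom (algebraMap k k[X])) := by
  rw [lineChart_eq_linePoint, linePoint_toSpec]

/-- The curve `y² = F(x²)` is birational to the fiber product of `y₁² = F(t)` and
`y₂² = t F(t)`. -/
lemma birationalOver_fiberProduct {F : k[X]} (hF : Squarefree F) (hd : 0 < F.natDegree)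
    (hXF : Squarefree (X * F)) (hE : Squarefree (expand k 2 F)) :
    Scheme.BirationalOver (curveOver (expand k 2 F)).hom
      (fiberProductCover F (X * F) ≫ P1.toSpec k) := by
  have hdE : 0 < (expand k 2 F).natDegree := by rw [natDegree_expand]; omega
  have hdX : 0 < (X * F).natDegree := by rw [natDegree_X_mul hF.ne_zero]; omega
  have hdom := affineRing_isDomain hE hdE
  let A := affineRing (expand k 2 F)
  let ρ : A := AdjoinRoot.root _
  have hρ : ρ ^ 2 = AdjoinRoot.of _ (expand k 2 F) := affineRing_root_sq _
  have hρ0 : ρ ≠ 0 := fun h ↦ one_ne_zero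
    (affineRing_add_mul_root_eq_zero (f := expand k 2 F) (p := 0) (q := 1) (by
      rw [map_zero, zero_add, map_one, one_mul]; exact h)).2
  let R := Localization.Away ρ
  have inj : Function.Injective (algebraMap A R) :=
    IsLocalization.injective R (powers_le_nonZeroDivisors_of_noZeroDivisors hρ0)
  obtain ⟨θ, h1, h2, h3⟩ := exists_fiberRing_hom F (X * F)
    (((algebraMap A R).comp (AdjoinRoot.of _)).comp (expand k 2).toRingHom)
    (algebraMap A R ρ) (algebraMap A R (AdjoinRoot.of _ X * ρ)) (by rw [← map_pow, hρ]; rfl) (by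
      rw [← map_pow, mul_pow, hρ]
      change algebraMap A R _ = algebraMap A R (AdjoinRoot.of _ (expand k 2 (X * F)))
      rw [map_mul (expand k 2), expand_X, map_mul (AdjoinRoot.of _), map_pow (AdjoinRoot.of _)])
  obtain ⟨hθ, hloc⟩ := isLocalizationAway_of_expand (A := A) (R := R) (B := fiberRing F (X * F))
    hF.ne_zero hρ exists_affineRing_eq
    (fun p q ↦ affineRing_add_mul_root_eq_zero) inj
    (β := (Algebra.TensorProduct.includeLeftRingHom).comp (AdjoinRoot.of _))
    exists_fiberRing_eq' θ h1 h2 h3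
  let := θ.toAlgebra
  let i : Spec (.of R) ⟶ curve (expand k 2 F) :=
    Spec.map (CommRingCat.ofHom (algebraMap A R)) ≫ affineChart (expand k 2 F)
  let j : Spec (.of R) ⟶ fiberProduct F (X * F) :=
    Spec.map (CommRingCat.ofHom (algebraMap (fiberRing F (X * F)) R)) ≫ fiberChart F (X * F)
  have := isSchemeTheoreticallyDominant_fiberChart hF hd hXF hdX
  have : IsDominant (Spec.map (CommRingCat.ofHom (algebraMap A R))) :=
    isDominant_SpecMap_of_injective _ inj
  have : IsDominant (Spec.map (CommRingCat.ofHom (algebraMap (fiberRing F (X * F)) R))) :=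
    isDominant_SpecMap_of_injective _ hθ
  have : IsOpenImmersion (Spec.map (CommRingCat.ofHom (algebraMap A R))) :=
    .of_isLocalization ρ
  have : IsOpenImmersion (Spec.map (CommRingCat.ofHom (algebraMap (fiberRing F (X * F)) R))) :=
    .of_isLocalization (AdjoinRoot.root _ ⊗ₜ 1)
  have hi : i ≫ cover (expand k 2 F) ≫ P1.toSpec k = Spec.map (CommRingCat.ofHom
      (((algebraMap A R).comp (AdjoinRoot.of _)).comp (algebraMap k k[X]))) := by
    simp only [i, Category.assoc]
    rw [reassoc_of% affineChart_cover, affineCover, Category.assoc, lineChart_toSpec, ← Spec.map_comp,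
      ← Spec.map_comp]
    rfl
  have hj : j ≫ fiberProductCover F (X * F) ≫ P1.toSpec k = Spec.map (CommRingCat.ofHom
      (((algebraMap A R).comp (AdjoinRoot.of _)).comp (algebraMap k k[X]))) := by
    simp only [j, Category.assoc]
    rw [← Category.assoc (fiberChart _ _), fiberChart_fiberProductCover, fiberProj, affineProj]
    simp only [Category.assoc]
    rw [lineChart_toSpec, ← Spec.map_comp, ← Spec.map_comp, ← Spec.map_comp]
    congr 2
    refine CommRingCat.hom_ext (RingHom.ext fun c ↦ ?_)
    refine (h1 (C c)).trans ?_
    change algebraMap A R (AdjoinRoot.of _ (expand k 2 (C c))) = _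
    rw [expand_C]
    rfl
  -- Both curves contain `Spec R` as a dense open subscheme, compatibly over `k`.
  exact (Scheme.Hom.birationalOver i _ _ hi).symm.trans (Scheme.Hom.birationalOver j _ _ hj)

end Birational

/-! ### From the Klein four-group to the Howe curve and back -/

section Main
variable {k : Type u} [Field k]

lemma IsHyperellipticPair.algEquiv_ext {K : Type u} [Field K] [Algebra k K] {f : k[X]} {x y : K}
    (h : IsHyperellipticPair f x y) {σ τ : K ≃ₐ[k] K} (hx : σ x = τ x) (hy : σ y = τ y) :
    σ = τ := by
  ext z
  obtain ⟨p, q, e, he, hz⟩ := h.gen z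
  have hp : ∀ p : k[X], σ (aeval x p) = τ (aeval x p) := fun p ↦ by
    rw [← aeval_algHom_apply, ← aeval_algHom_apply, hx]
  refine mul_right_cancel₀ ((_root_.map_ne_zero σ).mpr (h.aeval_ne_zero he)) ?_
  rw [← map_mul, hz, map_add, map_mul, hp p, hp q, hp e, hy, ← map_mul, ← map_mul, ← map_add, hz]

/-- An involution fixing `x` sends `y` to `±y`, so at most one nontrivial involution fixes `x`,
whereas a Klein pair contains two. -/
lemma IsHyperellipticPair.exists_ne_of_isKleinPair {K : Type u} [Field K] [Algebra k K] {f : k[X]}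
    {x y : K} (h : IsHyperellipticPair f x y) {σ τ : K ≃ₐ[k] K} (H : IsKleinPair σ τ) :
    ∃ ρ : K ≃ₐ[k] K, ρ * ρ = 1 ∧ ρ x ≠ x := by
  by_contra! hall
  have key : ∀ ρ : K ≃ₐ[k] K, ρ * ρ = 1 → ρ ≠ 1 → ρ y = -y := fun ρ h1 h2 ↦ by
    have h3 : (ρ y) ^ 2 = y ^ 2 := by
      rw [← map_pow, h.sq, ← aeval_algHom_apply, hall ρ h1]
    refine (sq_eq_sq_iff_eq_or_eq_neg.mp h3).resolve_left fun h4 ↦ h2 ?_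
    exact h.algEquiv_ext (hall ρ h1) h4
  exact H.ne (h.algEquiv_ext ((hall σ H.left).trans (hall τ H.right).symm)
    ((key σ H.left H.left_ne).trans (key τ H.right H.right_ne).symm))

/-- A hyperelliptic curve whose automorphism group contains a Klein four-group has an equation
`y² = F(x²)`. -/
lemma exists_iso_curveOver_expand [IsAlgClosed k] (h2 : (2 : k) ≠ 0) {g : ℕ} (hg : 2 ≤ g)
    {f : k[X]} (hf : IsModelOfGenus g f) (H : ∃ a b : Aut (curveOver f), IsKleinPair a b) :
    ∃ F : k[X], F.natDegree = g + 1 ∧ Squarefree F ∧ F.eval 0 ≠ 0 ∧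
      IsModelOfGenus g (expand k 2 F) ∧ Nonempty (curveOver f ≅ curveOver (expand k 2 F)) := by
  obtain ⟨K, _, _, x, y, h⟩ := exists_isHyperellipticPair hf.1 hf.natDegree_pos
  obtain ⟨σ, τ, hστ⟩ := exists_isKleinPair_algEquiv h hf.1 hf.natDegree_pos H
  obtain ⟨ρ, hρ, hρx⟩ := h.exists_ne_of_isKleinPair hστ
  obtain ⟨f', x', y', hf', h', hx', ⟨e⟩⟩ := h.exists_neg hg hf h2 ρ hρ hρx
  obtain ⟨F, rfl, hd, hF, h0⟩ := h'.exists_eq_expand hf' h2 ρ hρ hx'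
  obtain ⟨a⟩ := nonempty_curveOver_iso_model hf.1 hf.natDegree_pos h2 h
  obtain ⟨b⟩ := nonempty_curveOver_iso_model hf'.1 hf'.natDegree_pos h2 h'
  exact ⟨F, hd, hF, h0, hf', ⟨a ≪≫ e ≪≫ b.symm⟩⟩

lemma squarefree_X_mul {F : k[X]} (hF : Squarefree F) (h0 : F.eval 0 ≠ 0) :
    Squarefree (X * F) := by
  refine (squarefree_mul_iff ..).mpr ⟨?_, irreducible_X.squarefree, hF⟩
  refine (irreducible_X.coprime_iff_not_dvd.mpr ?_).isRelPrime
  rwa [X_dvd_iff, coeff_zero_eq_eval_zero]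

/-- The curve `y² = F(x²)` is a generalized Howe curve. -/
lemma isGeneralizedHowe_curveOver_expand [IsAlgClosed k] (h2 : (2 : k) ≠ 0) {g : ℕ} (hg : 2 ≤ g)
    {F : k[X]} (hd : F.natDegree = g + 1) (hF : Squarefree F) (h0 : F.eval 0 ≠ 0)
    (hE : IsModelOfGenus g (expand k 2 F)) {Y : Over (Spec (.of k))}
    (e : Y ≅ curveOver (expand k 2 F)) : IsGeneralizedHowe Y := by
  obtain ⟨K, _, _, x, y, h⟩ := exists_isHyperellipticPair hE.1 hE.natDegree_pos
  obtain ⟨g₁, g₂, A, B, D, p, z₁, z₂, hg₁, hg₁₂, hAB, hAD, hBD, hcB, hcD, hz⟩ :=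
    h.isBiquadratic.exists_rootPoly hg hF hd h0
  have hfB := squarefree_rootPoly_mul hAB
  have hfD := squarefree_rootPoly_mul hAD
  have hint := hz.isIntegral_fiberProduct hfB (by rw [natDegree_rootPoly_mul]; omega) hfD
    (by rw [natDegree_rootPoly_mul]; omega)
  refine ⟨g₁, g₂, A, B, D, hg₁, hg₁₂, hAB, hAD, hBD, hcB, hcD, hz.not_exists_iso, hint, ?_⟩
  obtain ⟨a⟩ := nonempty_curveOver_iso_model hE.1 hE.natDegree_pos h2 h
  -- The coordinate is carried along `x ↦ x² ↦ x² - p ↦ (x² - p)⁻¹`, the last being the coordinate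
  -- `s` of the biquadratic presentation.
  obtain ⟨b⟩ := nonempty_model_iso_sq (k := k) x
  obtain ⟨c⟩ := nonempty_model_iso_add (x ^ 2) (-p)
  rw [map_neg, ← sub_eq_add_neg] at c
  have hne : x ^ 2 - algebraMap k K p ≠ 0 := fun h1 ↦ hz.transcendental (by
    rw [h1, inv_zero]; exact isAlgebraic_zero)
  obtain ⟨d⟩ := nonempty_model_iso_inv (k := k) _ hne
  obtain ⟨j⟩ := hz.nonempty_model_iso
  exact ⟨e ≪≫ a ≪≫ b ≪≫ c ≪≫ d ≪≫ j⟩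

lemma IsGeneralizedHowe.exists_isKleinPair (h2 : (2 : k) ≠ 0) {Y : Over (Spec (.of k))}
    (h : IsGeneralizedHowe Y) : ∃ a b : Aut Y, IsKleinPair a b := by
  obtain ⟨g₁, g₂, A, B, D, hg₁, hg₁₂, hAB, hAD, -, hcB, hcD, -, hY⟩ := h
  exact exists_isKleinPair_of_isNormalizedFiberProduct (squarefree_rootPoly_mul hAB)
    (by rw [natDegree_rootPoly_mul]; omega) (squarefree_rootPoly_mul hAD)
    (by rw [natDegree_rootPoly_mul]; omega) h2 hY

end Main

end HoweCurve

end

theorem mainTheorem11 {k : Type u} [Field k] [IsAlgClosed k] (hk : (2 : k) ≠ 0)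
    (g : ℕ) (Y : Over (Spec (.of k))) (hY : HoweCurve.IsHyperelliptic g Y) :
    (HoweCurve.IsGeneralizedHowe Y ↔ ∃ H : Subgroup (Aut Y), IsKleinFour H) ∧
    ((∃ H : Subgroup (Aut Y), IsKleinFour H) →
      ∃ (g₁ g₂ : ℕ) (f : k[X]),
        f.natDegree = g + 1 ∧ f.eval 0 ≠ 0 ∧
        1 ≤ g₁ ∧ HoweCurve.IsModelOfGenus g₁ f ∧ HoweCurve.IsModelOfGenus g₂ (X * f) ∧
        (Even g → g₁ = g₂) ∧ (Odd g → g₂ = g₁ + 1) ∧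
        Scheme.BirationalOver Y.hom
          (HoweCurve.fiberProductCover f (X * f) ≫ HoweCurve.P1.toSpec k)) := by
  obtain ⟨hg, f, hf, ⟨e⟩⟩ := hY
  rw [HoweCurve.exists_isKleinFour_iff]
  have key : (∃ a b : Aut Y, HoweCurve.IsKleinPair a b) → ∃ F : k[X], F.natDegree = g + 1 ∧
      Squarefree F ∧ F.eval 0 ≠ 0 ∧ HoweCurve.IsModelOfGenus g (expand k 2 F) ∧
      Nonempty (Y ≅ HoweCurve.curveOver (expand k 2 F)) := fun H ↦ by
    obtain ⟨F, h1, h2, h3, h4, ⟨e'⟩⟩ := HoweCurve.exists_iso_curveOver_expand hk hg hf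
      (HoweCurve.exists_isKleinPair_of_iso e H)
    exact ⟨F, h1, h2, h3, h4, ⟨e ≪≫ e'⟩⟩
  refine ⟨⟨fun h ↦ h.exists_isKleinPair hk, fun H ↦ ?_⟩, fun H ↦ ?_⟩
  · obtain ⟨F, hd, hF, h0, hE, ⟨e'⟩⟩ := key H
    exact HoweCurve.isGeneralizedHowe_curveOver_expand hk hg hd hF h0 hE e'
  · obtain ⟨F, hd, hF, h0, hE, ⟨e'⟩⟩ := key H
    have hX := HoweCurve.squarefree_X_mul hF h0
    have hdX : (X * F).natDegree = F.natDegree + 1 := natDegree_X_mul hF.ne_zero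
    have : IsIso e'.hom.left := inferInstanceAs (IsIso ((Over.forget _).map e'.hom))
    have hbir : Scheme.BirationalOver Y.hom
        (HoweCurve.fiberProductCover F (X * F) ≫ HoweCurve.P1.toSpec k) :=
      (Scheme.Hom.birationalOver e'.hom.left _ _ (Over.w e'.hom)).trans
        (HoweCurve.birationalOver_fiberProduct hF (by omega) hX hE.1)
    -- The degrees are `g + 1` and `g + 2`; a polynomial of degree `n` has genus `(n - 1) / 2`,
    -- rounded down.
    refine ⟨g / 2, (g + 1) / 2, F, hd, h0, by omega, ⟨hF, by omega⟩, ⟨hX, by omega⟩,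
      fun ⟨m, hm⟩ ↦ by omega, fun ⟨m, hm⟩ ↦ by omega, hbir⟩
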